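/- Let $0<s<1$, let $P,Q$ be irreducible $2\times 2$ stochastic matrices, and let $E$ be a $2\times 2$ matrix such that $$R=\begin{pmatrix} sQ & E\\ 0 & P\end{pmatrix}$$ is stochastic (non-negative entries, row sums $1$). Let $\lambda\neq 1$ and $\beta\ne 1$ be the non-principal eigenvalues of $Q$ and $P$, let $\xi$ be an eigenvector of $Q$ for $\lambda$, and let $\pi_P$ be the stationary distribution of $P$. Consider the four-color urn with replacement matrix $R$: $C_0$ is a deterministic probability (row) vector, and, given $C_0,\dots,C_n$, a color $i$ is drawn with probability $C_{n,i}/(n+1)$ and the $i$-th row of $R$ is added to $C_n$ to give $C_{n+1}$. Write $v_1=(1,1,0,0)'$ and $v_2=(\xi',0,0)'$; these are eigenvectors of $R$ for $s$ and $s\lambda$. Suppose that $R$ is not diagonalizable. Then $\beta=s$ or $\beta=s\lambda$. Let $\alpha$ be the other one of $s$ and $s\lambda$. There is a nonsingular matrix $T=(t_1,t_2,t_3,t_4)$ with $$RT=TJ,\qquad J=\begin{pmatrix}\alpha&0&0&0\\0&\beta&1&0\\0&0&\beta&0\\0&0&0&1\end{pmatrix},$$ such that $t_2=v_1$ if $\beta=s$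 and $t_2=v_2$ if $\beta=s\lambda$. For every such $T$, let $\nu$ be the vector of the lower two coordinates of $t_3$, and $\nu^2$ its coordinatewise square. Then: (i) If $\beta<1/2$, then $\dfrac{C_n t_3}{\sqrt n}\Rightarrow N\!\left(0,\dfrac{\beta^2}{1-2\beta}\,\pi_P\nu^2\right)$, where $N(0,0)$ is the point mass at $0$. (ii) If $\beta\ge 1/2$, then there is a square integrable random variable $W$ such that, almost surely as well as in $L^2$, $$\frac{C_n t_3}{n^\beta\log n}\to W ,$$ where $W=U$, the almost sure and $L^2$ limit of $C_n v_1/n^{s}$, if $\beta=s$, and $W=V$, the almost sure and $L^2$ limit of $C_n v_2/n^{s\lambda}$, if $\beta=s\lambda$. -/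

import Mathlib

open MeasureTheory ProbabilityTheory Filter Topology Matrix
open scoped NNReal ENNReal

namespace FourColorUrn

/-- The information carried by `C 0, …, C n`: the `n`-th σ-algebra of the natural filtration
of the composition process `C`. -/
abbrev history {Ω ι : Type*} (C : ℕ → Ω → ι → ℝ) (n : ℕ) : MeasurableSpace Ω :=
  ⨆ k ≤ n, MeasurableSpace.comap (C k) inferInstance

/-- The urn process with colors `ι`, replacement matrix `R` and initial composition `c₀`
(a probability vector). `C n ω i` is the number of balls of color `i` after the `n`-th trial and
`X n` is the color drawn at trial `n + 1`. Given the past, color `i` is drawn with probability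
`C n i / (n + 1)`, and then the row `R i` is added to the urn. -/
structure IsUrnProcess {Ω ι : Type*} [Fintype ι] [MeasurableSpace Ω]
    (μ : Measure Ω) (R : Matrix ι ι ℝ) (c₀ : ι → ℝ)
    (X : ℕ → Ω → ι) (C : ℕ → Ω → ι → ℝ) : Prop where
  init_mem : c₀ ∈ stdSimplex ℝ ι
  measurable_draw : ∀ n i, MeasurableSet (X n ⁻¹' {i})
  init : ∀ ω, C 0 ω = c₀
  step : ∀ n ω, C (n + 1) ω = C n ω + R (X n ω)
  draw_law : ∀ n i,
    μ[(X n ⁻¹' {i}).indicator (fun _ => (1 : ℝ)) | history C n]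
      =ᵐ[μ] fun ω => C n ω i / ((n : ℝ) + 1)

/-- The set of four colors: white and black are `Sum.inl 0`, `Sum.inl 1`,
green and yellow are `Sum.inr 0`, `Sum.inr 1`. -/
abbrev Color : Type := Fin 2 ⊕ Fin 2

/-- The block upper triangular replacement matrix with blocks `s Q`, `E`, `0`, `P`. -/
def replacement (s : ℝ) (Q E P : Matrix (Fin 2) (Fin 2) ℝ) : Matrix Color Color ℝ :=
  Matrix.fromBlocks (s • Q) E 0 P

/-- Similarity (over the reals) to a diagonal matrix. -/
def IsDiagonalizable {ι : Type*} [Fintype ι] [DecidableEq ι] (A : Matrix ι ι ℝ) : Prop :=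
  ∃ (T : Matrix ι ι ℝ) (d : ι → ℝ), IsUnit T.det ∧ A * T = T * Matrix.diagonal d

/-- `π` is a stationary distribution of `P`. -/
def IsStationaryDistribution {ι : Type*} [Fintype ι] (P : Matrix ι ι ℝ) (π : ι → ℝ) : Prop :=
  π ∈ stdSimplex ℝ ι ∧ π ᵥ* P = π

/-- The column vector `(1', 0')'`, an eigenvector of the replacement matrix for `s`. -/
def v₁ : Color → ℝ := Sum.elim (fun _ => 1) (fun _ => 0)

/-- The column vector `(ξ', 0')'`, an eigenvector of the replacement matrix for `s * lam` when `ξ`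
is an eigenvector of `Q` for `lam`. -/
def v₂ (ξ : Fin 2 → ℝ) : Color → ℝ := Sum.elim ξ (fun _ => 0)

/-- The Jordan matrix with diagonal `α, β, β, 1` and a single off-diagonal entry `1`, which stands
in the second row and the third column. -/
def jordanMatrix (α β : ℝ) : Matrix Color Color ℝ :=
  Matrix.fromBlocks !![α, 0; 0, β] !![0, 0; 1, 0] 0 !![β, 0; 0, 1]

open Classical in
/-- `T` is a Jordan basis of the replacement matrix `R` with repeated eigenvalue `β ∈ {s, s lam}`:
`T` is nonsingular and `R T = T J` with `J` the Jordan matrix with diagonal `α, β, β, 1`, where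
`α` is the other one of `s` and `s lam`; the second column is the eigenvector `v₁` if `β = s`, and
it is the eigenvector `v₂` if `β = s lam`. -/
def IsJordanBasis (R : Matrix Color Color ℝ) (s lam β : ℝ) (ξ : Fin 2 → ℝ)
    (T : Matrix Color Color ℝ) : Prop :=
  IsUnit T.det ∧
  R * T = T * jordanMatrix (if β = s then s * lam else s) β ∧
  (fun i => T i (Sum.inl 1)) = if β = s then v₁ else v₂ ξ

/-- The third column of `T`. -/
def t₃ (T : Matrix Color Color ℝ) : Color → ℝ := fun i => T i (Sum.inr 0)

/-- The lower half of the third column of `T`. -/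
def ν (T : Matrix Color Color ℝ) : Fin 2 → ℝ := fun j => t₃ T (Sum.inr j)

/-- `Y n` converges to the square integrable variable `W`, almost surely as well as in `L²`. -/
def TendstoASL2 {Ω : Type*} [MeasurableSpace Ω] (μ : Measure Ω) (Y : ℕ → Ω → ℝ) (W : Ω → ℝ) :
    Prop :=
  MemLp W 2 μ ∧
  (∀ᵐ ω ∂μ, Tendsto (fun n => Y n ω) atTop (𝓝 (W ω))) ∧
  Tendsto (fun n => eLpNorm (fun ω => Y n ω - W ω) 2 μ) atTop (𝓝 0)

end FourColorUrn

/-! ### Deterministic asymptotics: weighted averages, powers, the product `growth`, linear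
recursions. -/

namespace FourColorUrn

/-! Write `u` for the second and `t` for the third column of `T`: then `R u = β u` and `R t = u + β
t`, and `u` lives on the first two colors. Given the past, `C_n t` grows on average by `(C_n u + β
C_n t) / (n + 1)`. Dividing by `growth β n`, which is asymptotic to `n ^ β / Γ(β + 1)`, absorbs the
`β` term and leaves a constant, a martingale, and the drift `∑ C_k u / ((k + 1) growth β (k + 1))`.
The mean number of balls of the first two colors is of order `n ^ s` with `s < 1`, so the remaining
two colors settle into the proportions `π_P`.

If `β < 1/2`, the martingale dominates. Here `E|C_n u| = o(√n)`
(`tendsto_integral_abs_eigenvector`), and the conditional variances of the increments tend in `L¹`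
to `β² π_P ν²` (`tendsto_integral_abs_variance`). The characteristic function is followed step by
step: one draw multiplies it by a Gaussian factor up to a small error
(`norm_integral_exp_succ_sub_le`), and the errors add up to something negligible
(`tendsto_integral_exp`). The factor `1 / (1 - 2β)` is the limit of `growth β n ^ 2 / n * ∑ growth β
(k + 1) ^ (-2)`. Lévy's continuity theorem concludes.

If `β ≥ 1/2`, then `C_n u / growth β n` is a martingale whose increments have variance `O(k ^ (s - 1
- 2β))`. This is summable because `s < 1 ≤ 2β`, so there is an almost sure and `L²` limit
(`exists_tendstoASL2_eigenvector`). The drift is then a harmonic sum and contributes this limit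
times `log n`, while a Kronecker argument shows that the martingale part is `o(log n)`, even at `β =
1/2` (`tendstoASL2_generalized_eigenvector`).

For the Jordan basis, an eigenvector `n` of `P` for `β` is lifted to `w = (c 1 + d ξ, n)`. Then `R w
- β w` is a combination of `v₁` and `v₂` with coefficients affine in `c` and `d`, of slopes `s - β`
and `s lam - β`. If both can be annihilated, `R` is diagonalizable; otherwise one slope vanishes,
and the coefficient that survives is scaled to `1` (`exists_isJordanBasis`). -/

/-- Weighted averages of a convergent sequence converge to its limit. -/
lemma tendsto_weighted_average {w x : ℕ → ℝ} {L : ℝ} (hw : ∀ k, 0 ≤ w k)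
    (hsum : Tendsto (fun n => ∑ k ∈ Finset.range n, w k) atTop atTop)
    (hx : Tendsto x atTop (𝓝 L)) :
    Tendsto (fun n => (∑ k ∈ Finset.range n, w k * x k) / ∑ k ∈ Finset.range n, w k)
      atTop (𝓝 L) := by
  have h1 : (fun k => w k * (x k - L)) =o[atTop] w := by
    have : (fun k => x k - L) =o[atTop] (fun _ => (1 : ℝ)) := by
      rw [Asymptotics.isLittleO_one_iff]
      simpa using hx.sub_const L
    simpa using (Asymptotics.isBigO_refl w atTop).mul_isLittleO this
  have h2 := (Asymptotics.IsLittleO.sum_range h1 hw hsum).tendsto_div_nhds_zero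
  have h3 := h2.add_const L
  rw [zero_add] at h3
  refine h3.congr' ?_
  filter_upwards [hsum.eventually_gt_atTop 0] with n hn
  simp only [mul_sub, Finset.sum_sub_distrib, ← Finset.sum_mul]
  field_simp
  ring

/-- Weighted averages with asymptotically equivalent normalization. -/
lemma tendsto_weighted_average' {w x b : ℕ → ℝ} {L c : ℝ} (hw : ∀ k, 0 ≤ w k)
    (hsum : Tendsto (fun n => ∑ k ∈ Finset.range n, w k) atTop atTop)
    (hb : Tendsto (fun n => (∑ k ∈ Finset.range n, w k) / b n) atTop (𝓝 c))
    (hx : Tendsto x atTop (𝓝 L)) :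
    Tendsto (fun n => (∑ k ∈ Finset.range n, w k * x k) / b n) atTop (𝓝 (c * L)) := by
  refine (hb.mul (tendsto_weighted_average hw hsum hx)).congr' ?_
  filter_upwards [hsum.eventually_gt_atTop 0] with n hn
  field_simp

lemma tendsto_add_one_rpow_div (p : ℝ) :
    Tendsto (fun n : ℕ => ((n : ℝ) + 1) ^ p / (n : ℝ) ^ p) atTop (𝓝 1) := by
  have h : Tendsto (fun n : ℕ => (1 + 1 / (n : ℝ)) ^ p) atTop (𝓝 ((1 + 0) ^ p)) := by
    refine Tendsto.rpow_const ?_ (Or.inl (by norm_num))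
    exact tendsto_const_nhds.add tendsto_one_div_atTop_nhds_zero_nat
  simp only [add_zero, Real.one_rpow] at h
  refine h.congr' ?_
  filter_upwards [eventually_gt_atTop 0] with n hn
  have hn' : (0 : ℝ) < n := by exact_mod_cast hn
  rw [← Real.div_rpow (by positivity) hn'.le]
  congr 1
  field_simp

lemma tendsto_natCast_rpow_atTop {p : ℝ} (hp : 0 < p) :
    Tendsto (fun n : ℕ => (n : ℝ) ^ p) atTop atTop :=
  (tendsto_rpow_atTop hp).comp tendsto_natCast_atTop_atTop

/-- `(k+1)^p - k^p` is asymptotically `p (k+1)^(p-1)`. -/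
lemma tendsto_rpow_sub_rpow_div (p : ℝ) :
    Tendsto (fun k : ℕ => (((k : ℝ) + 1) ^ p - (k : ℝ) ^ p) / ((k : ℝ) + 1) ^ (p - 1))
      atTop (𝓝 p) := by
  -- With `y = 1 / (k + 1)` the quotient in question is `(1 - (1 - y) ^ p) / y`, minus a difference
  -- quotient at `0`.
  have hd : HasDerivAt (fun y : ℝ => (1 - y) ^ p) (-p) 0 := by
    have h1 : HasDerivAt (fun y : ℝ => 1 - y) (-1) 0 := by
      simpa using (hasDerivAt_id (0 : ℝ)).const_sub 1
    have := h1.rpow_const (p := p) (Or.inl (by norm_num))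
    simpa using this
  have hs := hd.tendsto_slope
  have ht : Tendsto (fun k : ℕ => 1 / ((k : ℝ) + 1)) atTop (𝓝[≠] 0) := by
    refine tendsto_nhdsWithin_iff.2 ⟨tendsto_one_div_add_atTop_nhds_zero_nat, ?_⟩
    filter_upwards with k
    have : (0 : ℝ) < 1 / ((k : ℝ) + 1) := by positivity
    exact this.ne'
  have h := (hs.comp ht).neg
  rw [neg_neg] at h
  refine h.congr fun k => ?_
  have hk : (0 : ℝ) < (k : ℝ) + 1 := by positivity
  have e : (1 - 1 / ((k : ℝ) + 1)) = (k : ℝ) / ((k : ℝ) + 1) := by field_simp; ring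
  simp only [Function.comp, slope_def_field, e, sub_zero, Real.one_rpow]
  rw [Real.div_rpow (by positivity) hk.le, Real.rpow_sub_one hk.ne']
  have : (0 : ℝ) < ((k : ℝ) + 1) ^ p := by positivity
  field_simp
  ring

/-- The weights `(k+1)^p - k^p` telescope to `n^p`, and `(k+1)^(p-1)` is a weight times a factor
tending to `p⁻¹`; so the quotient is a weighted average of these factors. -/
lemma tendsto_sum_rpow_div {p : ℝ} (hp : 0 < p) :
    Tendsto (fun n : ℕ => (∑ k ∈ Finset.range n, ((k : ℝ) + 1) ^ (p - 1)) / (n : ℝ) ^ p)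
      atTop (𝓝 p⁻¹) := by
  have hw : ∀ k : ℕ, (0 : ℝ) ≤ ((k : ℝ) + 1) ^ p - (k : ℝ) ^ p := fun k => by
    have : (k : ℝ) ^ p ≤ ((k : ℝ) + 1) ^ p :=
      Real.rpow_le_rpow (by positivity) (by linarith) hp.le
    linarith
  have htel : ∀ n : ℕ, ∑ k ∈ Finset.range n, (((k : ℝ) + 1) ^ p - (k : ℝ) ^ p) = (n : ℝ) ^ p := by
    intro n
    have := Finset.sum_range_sub (fun k : ℕ => (k : ℝ) ^ p) n
    simpa [Real.zero_rpow hp.ne'] using this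
  have h := tendsto_weighted_average (L := p⁻¹) hw
    (by simpa only [htel] using tendsto_natCast_rpow_atTop hp)
    ((tendsto_rpow_sub_rpow_div p).inv₀ hp.ne')
  simp only [htel] at h
  refine h.congr fun n => ?_
  congr 1
  refine Finset.sum_congr rfl fun k _ => ?_
  have : (0 : ℝ) < ((k : ℝ) + 1) ^ p - (k : ℝ) ^ p := by
    have : (k : ℝ) ^ p < ((k : ℝ) + 1) ^ p :=
      Real.rpow_lt_rpow (by positivity) (by linarith) hp
    linarith
  field_simp

lemma tendsto_sum_rpow_atTop {p : ℝ} (hp : 0 < p) :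
    Tendsto (fun n : ℕ => ∑ k ∈ Finset.range n, ((k : ℝ) + 1) ^ (p - 1)) atTop atTop := by
  refine ((tendsto_natCast_rpow_atTop hp).atTop_mul_pos (inv_pos.2 hp)
    (tendsto_sum_rpow_div hp)).congr' ?_
  filter_upwards [eventually_gt_atTop 0] with n hn
  have hn' : (0 : ℝ) < n := by exact_mod_cast hn
  field_simp

lemma tendsto_sum_rpow_mul_div {p : ℝ} (hp : 0 < p) {x : ℕ → ℝ} {L : ℝ}
    (hx : Tendsto x atTop (𝓝 L)) :
    Tendsto (fun n : ℕ => (∑ k ∈ Finset.range n, ((k : ℝ) + 1) ^ (p - 1) * x k) / (n : ℝ) ^ p)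
      atTop (𝓝 (p⁻¹ * L)) :=
  tendsto_weighted_average' (fun k => by positivity) (tendsto_sum_rpow_atTop hp)
    (tendsto_sum_rpow_div hp) hx

lemma tendsto_log_natCast_atTop : Tendsto (fun n : ℕ => Real.log n) atTop atTop :=
  Real.tendsto_log_atTop.comp tendsto_natCast_atTop_atTop

lemma tendsto_sum_inv_div_log :
    Tendsto (fun n : ℕ => (∑ k ∈ Finset.range n, ((k : ℝ) + 1)⁻¹) / Real.log n) atTop (𝓝 1) := by
  have h := Real.tendsto_harmonic_sub_log.div_atTop tendsto_log_natCast_atTop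
  have h2 := h.add_const 1
  rw [zero_add] at h2
  refine h2.congr' ?_
  filter_upwards [tendsto_log_natCast_atTop.eventually_gt_atTop 0] with n hn
  simp only [harmonic]
  push_cast
  field_simp
  ring

lemma tendsto_sum_inv_atTop :
    Tendsto (fun n : ℕ => ∑ k ∈ Finset.range n, ((k : ℝ) + 1)⁻¹) atTop atTop := by
  refine (tendsto_log_natCast_atTop.atTop_mul_pos one_pos tendsto_sum_inv_div_log).congr' ?_
  filter_upwards [tendsto_log_natCast_atTop.eventually_gt_atTop 0] with n hn
  field_simp

/-- The product `∏_{k < n} (1 + β / (k + 1))`, of order `n ^ β`. -/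
noncomputable def growth (β : ℝ) (n : ℕ) : ℝ := ∏ k ∈ Finset.range n, (1 + β / ((k : ℝ) + 1))

lemma one_add_div_pos {β : ℝ} (hβ : -1 < β) (k : ℕ) : 0 < 1 + β / ((k : ℝ) + 1) := by
  have hk : (0 : ℝ) < (k : ℝ) + 1 := by positivity
  have h0 : (0 : ℝ) ≤ k := by positivity
  have e : 1 + β / ((k : ℝ) + 1) = (k + 1 + β) / ((k : ℝ) + 1) := by field_simp
  rw [e]
  exact div_pos (by linarith) hk

lemma growth_pos {β : ℝ} (hβ : -1 < β) (n : ℕ) : 0 < growth β n :=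
  Finset.prod_pos fun k _ => one_add_div_pos hβ k

@[simp] lemma growth_zero (β : ℝ) : growth β 0 = 1 := by simp [growth]

lemma growth_succ (β : ℝ) (n : ℕ) : growth β (n + 1) = growth β n * (1 + β / ((n : ℝ) + 1)) := by
  simp [growth, Finset.prod_range_succ]

/-- This product is, up to its last factor, the denominator in Euler's limit formula for `Γ(β + 1)`,
which yields the asymptotics of `growth`. -/
lemma prod_add_one_eq {β : ℝ} (n : ℕ) :
    ∏ j ∈ Finset.range n, (β + 1 + (j : ℝ)) = (n.factorial : ℝ) * growth β n := by
  induction n with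
  | zero => simp
  | succ n ih =>
    rw [Finset.prod_range_succ, ih, growth_succ, Nat.factorial_succ]
    push_cast
    have hk : (n : ℝ) + 1 ≠ 0 := by positivity
    field_simp
    ring

/-- `growth β n` is asymptotically `n ^ β / Γ(β + 1)`. -/
lemma tendsto_growth_div {β : ℝ} (hβ : -1 < β) :
    Tendsto (fun n : ℕ => growth β n / (n : ℝ) ^ β) atTop (𝓝 (Real.Gamma (β + 1))⁻¹) := by
  have hG := Real.Gamma_pos_of_pos (s := β + 1) (by linarith)
  have h := (Real.GammaSeq_tendsto_Gamma (β + 1)).inv₀ hG.ne'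
  have h1 : Tendsto (fun n : ℕ => (n : ℝ) / ((n : ℝ) + (β + 1))) atTop (𝓝 1) := by
    have := tendsto_natCast_div_add_atTop (𝕜 := ℝ) (β + 1)
    simpa using this
  have h2 := h.mul h1
  rw [mul_one] at h2
  refine h2.congr' ?_
  filter_upwards [eventually_gt_atTop 0] with n hn
  have hn' : (0 : ℝ) < n := by exact_mod_cast hn
  rw [Real.GammaSeq, Finset.prod_range_succ, prod_add_one_eq, Real.rpow_add hn', Real.rpow_one]
  have h3 : (0 : ℝ) < (n : ℝ) ^ β := by positivity
  have h4 : (0 : ℝ) < n.factorial := by positivity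
  have h5 : (0 : ℝ) < (n : ℝ) + (β + 1) := by linarith
  have h6 : (0 : ℝ) < β + 1 + (n : ℝ) := by linarith
  field_simp
  ring

lemma tendsto_growth_succ_div {β : ℝ} (hβ : -1 < β) :
    Tendsto (fun n : ℕ => growth β (n + 1) / ((n : ℝ) + 1) ^ β) atTop
      (𝓝 (Real.Gamma (β + 1))⁻¹) := by
  simpa [Function.comp_def] using (tendsto_growth_div hβ).comp (tendsto_add_atTop_nat 1)

lemma tendsto_rpow_div_growth_succ {β : ℝ} (hβ : -1 < β) :
    Tendsto (fun n : ℕ => ((n : ℝ) + 1) ^ β / growth β (n + 1)) atTop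
      (𝓝 (Real.Gamma (β + 1))) := by
  have hG := Real.Gamma_pos_of_pos (s := β + 1) (by linarith)
  simpa using (tendsto_growth_succ_div hβ).inv₀ (inv_ne_zero hG.ne')

/-- Discrete Grönwall inequality with integrating factor `growth q`. -/
lemma le_growth_mul {x r : ℕ → ℝ} {q : ℝ} (hq : 0 ≤ q)
    (hx : ∀ k : ℕ, x (k + 1) ≤ (1 + q / ((k : ℝ) + 1)) * x k + r k) (n : ℕ) :
    x n ≤ growth q n * (x 0 + ∑ k ∈ Finset.range n, r k / growth q (k + 1)) := by
  induction n with
  | zero => simp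
  | succ n ih =>
    have h1 := one_add_div_pos (show -1 < q by linarith) n
    have h2 := growth_pos (show -1 < q by linarith) (n + 1)
    refine (hx n).trans ?_
    rw [Finset.sum_range_succ, ← add_assoc, mul_add, mul_div_cancel₀ _ h2.ne']
    have := mul_le_mul_of_nonneg_left ih h1.le
    rw [growth_succ]
    linarith

/-- Nonnegative solutions of a linear recursive inequality with small forcing term are small. -/
lemma tendsto_div_rpow_of_le_recursion {x r : ℕ → ℝ} {p q : ℝ} (hp : 0 < p) (hqp : q < p)
    (h0 : ∀ k, 0 ≤ x k)
    (hx : ∀ k : ℕ, x (k + 1) ≤ (1 + q / ((k : ℝ) + 1)) * x k + r k)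
    (hr : Tendsto (fun k : ℕ => r k / ((k : ℝ) + 1) ^ (p - 1)) atTop (𝓝 0)) :
    Tendsto (fun n : ℕ => x n / (n : ℝ) ^ p) atTop (𝓝 0) := by
  -- Since `x` is nonnegative, a negative `q` may be raised to `0`, which keeps the integrating
  -- factor positive.
  wlog hq : 0 ≤ q generalizing q
  · refine this (q := 0) hp (fun k => (hx k).trans ?_) le_rfl
    have : q / ((k : ℝ) + 1) ≤ 0 / ((k : ℝ) + 1) := by gcongr; linarith
    have := mul_le_mul_of_nonneg_right this (h0 k)
    linarith
  have hq1 : -1 < q := by linarith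
  have hpq : 0 < p - q := by linarith
  have hA : Tendsto (fun k : ℕ => r k / ((k : ℝ) + 1) ^ (p - 1) *
      (((k : ℝ) + 1) ^ q / growth q (k + 1))) atTop (𝓝 0) := by
    simpa using hr.mul (tendsto_rpow_div_growth_succ hq1)
  have hB := tendsto_sum_rpow_mul_div hpq hA
  have hC : Tendsto (fun n : ℕ => x 0 / (n : ℝ) ^ (p - q)) atTop (𝓝 0) :=
    tendsto_const_nhds.div_atTop (tendsto_natCast_rpow_atTop hpq)
  have hD := (tendsto_growth_div hq1).mul (hC.add hB)
  simp only [mul_zero, add_zero] at hD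
  refine squeeze_zero' (Eventually.of_forall fun n => by have := h0 n; positivity) ?_ hD
  filter_upwards [eventually_gt_atTop 0] with n hn
  have hn' : (0 : ℝ) < n := by exact_mod_cast hn
  have hs : ∑ k ∈ Finset.range n, ((k : ℝ) + 1) ^ (p - q - 1) * (r k / ((k : ℝ) + 1) ^ (p - 1) *
      (((k : ℝ) + 1) ^ q / growth q (k + 1))) = ∑ k ∈ Finset.range n, r k / growth q (k + 1) := by
    refine Finset.sum_congr rfl fun k _ => ?_
    have hk : (0 : ℝ) < (k : ℝ) + 1 := by positivity
    have e : ((k : ℝ) + 1) ^ (p - 1) = ((k : ℝ) + 1) ^ (p - q - 1) * ((k : ℝ) + 1) ^ q := by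
      rw [← Real.rpow_add hk]; congr 1; ring
    have e1 : 0 < ((k : ℝ) + 1) ^ (p - q - 1) := by positivity
    have e2 : 0 < ((k : ℝ) + 1) ^ q := by positivity
    have e3 := growth_pos hq1 (k + 1)
    rw [e]
    field_simp
  rw [hs, ← add_div, div_mul_div_comm, ← Real.rpow_add hn']
  have : q + (p - q) = p := by ring
  rw [this]
  gcongr
  exact le_growth_mul hq hx n

end FourColorUrn

/-! ### The urn process: boundedness, measurability, averaging over the next draw, moment
recursions. -/

namespace FourColorUrn

namespace IsUrnProcess

variable {Ω ι : Type*} [Fintype ι] [MeasurableSpace Ω] {μ : Measure Ω} {R : Matrix ι ι ℝ}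
  {c₀ : ι → ℝ} {X : ℕ → Ω → ι} {C : ℕ → Ω → ι → ℝ}

lemma sum_eq [DecidableEq ι] (h : IsUrnProcess μ R c₀ X C) (hR : R ∈ Matrix.rowStochastic ℝ ι)
    (n : ℕ) (ω : Ω) : ∑ i, C n ω i = (n : ℝ) + 1 := by
  induction n with
  | zero => simpa [h.init] using h.init_mem.2
  | succ n ih =>
    simp only [h.step, Pi.add_apply, Finset.sum_add_distrib, ih,
      sum_row_of_mem_rowStochastic hR]
    push_cast; ring

lemma nonneg [DecidableEq ι] (h : IsUrnProcess μ R c₀ X C) (hR : R ∈ Matrix.rowStochastic ℝ ι)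
    (n : ℕ) (ω : Ω) (i : ι) : 0 ≤ C n ω i := by
  induction n with
  | zero => simpa [h.init] using h.init_mem.1 i
  | succ n ih =>
    simp only [h.step, Pi.add_apply]
    exact add_nonneg ih (nonneg_of_mem_rowStochastic hR)

lemma le_add_one [DecidableEq ι] (h : IsUrnProcess μ R c₀ X C)
    (hR : R ∈ Matrix.rowStochastic ℝ ι) (n : ℕ) (ω : Ω) (i : ι) : C n ω i ≤ (n : ℝ) + 1 := by
  rw [← h.sum_eq hR n ω]
  exact Finset.single_le_sum (fun j _ => h.nonneg hR n ω j) (Finset.mem_univ i)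

/-- The law of a draw is given through indicators of colors, so functions of the draw are expanded
in these indicators. -/
lemma apply_draw {α κ E : Type*} [Fintype κ] [AddCommMonoid E] [Module ℝ E] (X : α → κ)
    (F : κ → E) (ω : α) :
    F (X ω) = ∑ i, (X ⁻¹' {i}).indicator (fun _ => (1 : ℝ)) ω • F i := by
  rw [Finset.sum_eq_single (X ω)]
  · simp
  · intro b _ hb
    rw [Set.indicator_of_notMem (by simpa using hb.symm), zero_smul]
  · simp

lemma measurable_apply_draw {E : Type*} [NormedAddCommGroup E] [NormedSpace ℝ E]
    [MeasurableSpace E] [BorelSpace E] [SecondCountableTopology E]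
    (h : IsUrnProcess μ R c₀ X C) (n : ℕ) (F : ι → E) :
    Measurable (fun ω => F (X n ω)) := by
  simp_rw [apply_draw (X n) F]
  refine Finset.measurable_sum _ fun i _ => ?_
  exact (measurable_const.indicator (h.measurable_draw n i)).smul_const _

lemma measurable (h : IsUrnProcess μ R c₀ X C) (n : ℕ) : Measurable (C n) := by
  induction n with
  | zero =>
    have : C 0 = fun _ => c₀ := funext h.init
    rw [this]; exact measurable_const
  | succ n ih =>
    have : C (n + 1) = fun ω => C n ω + R (X n ω) := funext (h.step n)
    rw [this]
    exact ih.add (h.measurable_apply_draw n R)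

lemma history_le (h : IsUrnProcess μ R c₀ X C) (n : ℕ) : history C n ≤ ‹MeasurableSpace Ω› :=
  iSup₂_le fun k _ => (h.measurable k).comap_le

/-- The natural filtration of the composition process. -/
def filtration (h : IsUrnProcess μ R c₀ X C) : Filtration ℕ ‹MeasurableSpace Ω› where
  seq := history C
  mono' _ _ hmn := biSup_mono fun _ hk => hk.trans hmn
  le' := h.history_le

lemma _root_.FourColorUrn.measurable_history {α κ : Type*} {C : ℕ → α → κ → ℝ} {k n : ℕ} (hk : k ≤ n) :
    Measurable[history C n] (C k) := by
  rw [measurable_iff_comap_le]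
  exact le_iSup₂_of_le k hk le_rfl

/-- Continuous functions of the composition are bounded. -/
lemma exists_bound [DecidableEq ι] {E : Type*} [NormedAddCommGroup E]
    (h : IsUrnProcess μ R c₀ X C) (hR : R ∈ Matrix.rowStochastic ℝ ι) {F : (ι → ℝ) → E}
    (hF : Continuous F) (n : ℕ) : ∃ B, ∀ ω, ‖F (C n ω)‖ ≤ B := by
  -- At time `n` the composition stays in the compact box `[0, n + 1]^ι`.
  obtain ⟨B, hB⟩ := (isCompact_Icc (a := (0 : ι → ℝ)) (b := fun _ => (n : ℝ) + 1)
    ).exists_bound_of_continuousOn hF.continuousOn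
  exact ⟨B, fun ω => hB _ ⟨fun i => h.nonneg hR n ω i, fun i => h.le_add_one hR n ω i⟩⟩

lemma stronglyMeasurable_comp {α E : Type*} [NormedAddCommGroup E] {C : ℕ → α → ι → ℝ}
    {F : (ι → ℝ) → E} (hF : Continuous F) {k n : ℕ} (hk : k ≤ n) :
    StronglyMeasurable[history C n] (fun ω => F (C k ω)) :=
  hF.stronglyMeasurable.comp_measurable (measurable_history hk)

lemma integrable_of_bound [IsProbabilityMeasure μ] {E : Type*} [NormedAddCommGroup E]
    (h : IsUrnProcess μ R c₀ X C) {n : ℕ} {G : Ω → E} (hG : StronglyMeasurable[history C n] G)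
    {B : ℝ} (hB : ∀ ω, ‖G ω‖ ≤ B) : Integrable G μ :=
  Integrable.of_bound (hG.mono (h.history_le n)).aestronglyMeasurable B (ae_of_all _ hB)

lemma integrable_comp [DecidableEq ι] [IsProbabilityMeasure μ] {E : Type*} [NormedAddCommGroup E]
    (h : IsUrnProcess μ R c₀ X C) (hR : R ∈ Matrix.rowStochastic ℝ ι) {F : (ι → ℝ) → E}
    (hF : Continuous F) (n : ℕ) : Integrable (fun ω => F (C n ω)) μ := by
  obtain ⟨B, hB⟩ := h.exists_bound hR hF n
  exact h.integrable_of_bound (stronglyMeasurable_comp hF le_rfl) hB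

lemma integral_indicator_smul [IsProbabilityMeasure μ] {E : Type*} [NormedAddCommGroup E]
    [NormedSpace ℝ E] [CompleteSpace E] (h : IsUrnProcess μ R c₀ X C) {n : ℕ} {G : Ω → E}
    (hG : StronglyMeasurable[history C n] G) {B : ℝ} (hB : ∀ ω, ‖G ω‖ ≤ B) (i : ι) :
    ∫ ω, (X n ⁻¹' {i}).indicator (fun _ => (1 : ℝ)) ω • G ω ∂μ
      = ∫ ω, (C n ω i / ((n : ℝ) + 1)) • G ω ∂μ := by
  have hm := h.history_le n
  have hGi := h.integrable_of_bound hG hB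
  have hI : Integrable ((X n ⁻¹' {i}).indicator (fun _ => (1 : ℝ))) μ :=
    (integrable_const _).indicator (h.measurable_draw n i)
  have hIG : Integrable ((X n ⁻¹' {i}).indicator (fun _ => (1 : ℝ)) • G) μ := by
    have : (X n ⁻¹' {i}).indicator (fun _ => (1 : ℝ)) • G = (X n ⁻¹' {i}).indicator G := by
      ext ω
      by_cases hω : ω ∈ X n ⁻¹' {i} <;> simp [hω]
    rw [this]
    exact hGi.indicator (h.measurable_draw n i)
  -- `G` is known at time `n`, so it is pulled out of the conditional expectation of the indicator.
  have e := condExp_smul_of_aestronglyMeasurable_right (m := history C n) (μ := μ) hI hIG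
    hG.aestronglyMeasurable
  have e1 := integral_condExp (μ := μ) hm (f := (X n ⁻¹' {i}).indicator (fun _ => (1 : ℝ)) • G)
  change ∫ ω, ((X n ⁻¹' {i}).indicator (fun _ => (1 : ℝ)) • G) ω ∂μ = _
  rw [← e1]
  refine integral_congr_ae ?_
  filter_upwards [e, h.draw_law n i] with ω h1 h2
  rw [h1, Pi.smul_apply', h2]

/-- Averaging over the next draw given the past. -/
lemma integral_sum_draw [IsProbabilityMeasure μ] {E : Type*} [NormedAddCommGroup E]
    [NormedSpace ℝ E] [CompleteSpace E] (h : IsUrnProcess μ R c₀ X C) {n : ℕ} {G : ι → Ω → E}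
    (hG : ∀ i, StronglyMeasurable[history C n] (G i)) (hB : ∀ i, ∃ B : ℝ, ∀ ω, ‖G i ω‖ ≤ B) :
    ∫ ω, G (X n ω) ω ∂μ = ∫ ω, ∑ i, (C n ω i / ((n : ℝ) + 1)) • G i ω ∂μ := by
  have hGi : ∀ i, Integrable (G i) μ := fun i => by
    obtain ⟨B, hB⟩ := hB i
    exact h.integrable_of_bound (hG i) hB
  have hterm : ∀ i, (fun ω => (X n ⁻¹' {i}).indicator (fun _ => (1 : ℝ)) ω • G i ω)
      = (X n ⁻¹' {i}).indicator (G i) := fun i => by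
    ext ω
    by_cases hω : ω ∈ X n ⁻¹' {i} <;> simp [hω]
  have hI1 : ∀ i, Integrable (fun ω => (X n ⁻¹' {i}).indicator (fun _ => (1 : ℝ)) ω • G i ω) μ :=
    fun i => by
      rw [hterm i]
      exact (hGi i).indicator (h.measurable_draw n i)
  have e0 : ∀ ω, G (X n ω) ω = ∑ i, (X n ⁻¹' {i}).indicator (fun _ => (1 : ℝ)) ω • G i ω :=
    fun ω => apply_draw (X n) (fun i => G i ω) ω
  simp_rw [e0]
  rw [integral_finsetSum _ fun i _ => hI1 i]
  have hI2 : ∀ i, Integrable (fun ω => (C n ω i / ((n : ℝ) + 1)) • G i ω) μ := fun i => by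
    have hm := h.history_le n
    obtain ⟨B, hB⟩ := hB i
    -- The share is a version of a conditional expectation, hence integrable without any assumption
    -- on `R`.
    have hP : Integrable (fun ω => C n ω i / ((n : ℝ) + 1)) μ :=
      integrable_condExp.congr (h.draw_law n i)
    exact hP.smul_bdd B ((hG i).mono hm).aestronglyMeasurable (ae_of_all _ hB)
  rw [integral_finsetSum _ fun i _ => hI2 i]
  refine Finset.sum_congr rfl fun i _ => ?_
  obtain ⟨B, hB⟩ := hB i
  exact h.integral_indicator_smul (hG i) hB i

/-- The Markov property of the composition process. -/
lemma integral_comp_succ [DecidableEq ι] [IsProbabilityMeasure μ] {E : Type*}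
    [NormedAddCommGroup E] [NormedSpace ℝ E] [CompleteSpace E] (h : IsUrnProcess μ R c₀ X C)
    (hR : R ∈ Matrix.rowStochastic ℝ ι) {F : (ι → ℝ) → E} (hF : Continuous F) (n : ℕ) :
    ∫ ω, F (C (n + 1) ω) ∂μ
      = ∫ ω, ∑ i, (C n ω i / ((n : ℝ) + 1)) • F (C n ω + R i) ∂μ := by
  have hc : ∀ i, Continuous fun c : ι → ℝ => F (c + R i) := fun i =>
    hF.comp (continuous_id.add continuous_const)
  simp_rw [h.step]
  exact h.integral_sum_draw (G := fun i ω => F (C n ω + R i))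
    (fun i => stronglyMeasurable_comp (hc i) le_rfl) fun i => h.exists_bound hR (hc i) n

lemma sum_div_eq_one [DecidableEq ι] (h : IsUrnProcess μ R c₀ X C)
    (hR : R ∈ Matrix.rowStochastic ℝ ι) (n : ℕ) (ω : Ω) :
    ∑ i, C n ω i / ((n : ℝ) + 1) = 1 := by
  rw [← Finset.sum_div, h.sum_eq hR]
  exact div_self (by positivity)

lemma sum_div_mul (C : ι → ℝ) (n : ℕ) (f : ι → ℝ) :
    ∑ i, C i / ((n : ℝ) + 1) * f i = (C ⬝ᵥ f) / ((n : ℝ) + 1) := by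
  rw [dotProduct, Finset.sum_div]
  exact Finset.sum_congr rfl fun i _ => by ring

lemma dotProduct_nonneg [DecidableEq ι] (h : IsUrnProcess μ R c₀ X C)
    (hR : R ∈ Matrix.rowStochastic ℝ ι) {f : ι → ℝ} (hf : ∀ i, 0 ≤ f i) (n : ℕ) (ω : Ω) :
    0 ≤ C n ω ⬝ᵥ f :=
  Finset.sum_nonneg fun i _ => mul_nonneg (h.nonneg hR n ω i) (hf i)

lemma abs_dotProduct_le_of_abs_le [DecidableEq ι] (h : IsUrnProcess μ R c₀ X C)
    (hR : R ∈ Matrix.rowStochastic ℝ ι) {f g : ι → ℝ} (hfg : ∀ i, |f i| ≤ g i) (n : ℕ) (ω : Ω) :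
    |C n ω ⬝ᵥ f| ≤ C n ω ⬝ᵥ g := by
  refine (Finset.abs_sum_le_sum_abs _ _).trans (Finset.sum_le_sum fun i _ => ?_)
  rw [abs_mul, abs_of_nonneg (h.nonneg hR n ω i)]
  exact mul_le_mul_of_nonneg_left (hfg i) (h.nonneg hR n ω i)

lemma abs_dotProduct_le [DecidableEq ι] (h : IsUrnProcess μ R c₀ X C)
    (hR : R ∈ Matrix.rowStochastic ℝ ι) {f : ι → ℝ} {B : ℝ} (hf : ∀ i, |f i| ≤ B) (n : ℕ) (ω : Ω) :
    |C n ω ⬝ᵥ f| ≤ B * ((n : ℝ) + 1) := by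
  refine (h.abs_dotProduct_le_of_abs_le hR hf n ω).trans ?_
  rw [← h.sum_eq hR n ω, Finset.mul_sum]
  exact Finset.sum_le_sum fun i _ => by rw [mul_comm]

lemma continuous_dotProduct (f : ι → ℝ) : Continuous fun c : ι → ℝ => c ⬝ᵥ f :=
  continuous_finsetSum _ fun i _ => (continuous_apply i).mul continuous_const

lemma integral_dotProduct_succ [DecidableEq ι] [IsProbabilityMeasure μ]
    (h : IsUrnProcess μ R c₀ X C) (hR : R ∈ Matrix.rowStochastic ℝ ι) (f : ι → ℝ) (n : ℕ) :
    ∫ ω, C (n + 1) ω ⬝ᵥ f ∂μ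
      = ∫ ω, C n ω ⬝ᵥ f ∂μ + (∫ ω, C n ω ⬝ᵥ (R *ᵥ f) ∂μ) / ((n : ℝ) + 1) := by
  rw [h.integral_comp_succ hR (continuous_dotProduct f) n, ← integral_div,
    ← integral_add (h.integrable_comp hR (continuous_dotProduct f) n)
      ((h.integrable_comp hR (continuous_dotProduct _) n).div_const _)]
  refine integral_congr_ae (ae_of_all _ fun ω => ?_)
  have e : ∀ i, R i ⬝ᵥ f = (R *ᵥ f) i := fun i => rfl
  simp only [add_dotProduct, smul_eq_mul, mul_add, Finset.sum_add_distrib, e, sum_div_mul,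
    ← Finset.sum_mul, h.sum_div_eq_one hR, one_mul]

lemma integral_sq_dotProduct_succ [DecidableEq ι] [IsProbabilityMeasure μ]
    (h : IsUrnProcess μ R c₀ X C) (hR : R ∈ Matrix.rowStochastic ℝ ι) (f : ι → ℝ) (n : ℕ) :
    ∫ ω, (C (n + 1) ω ⬝ᵥ f) ^ 2 ∂μ
      = ∫ ω, ((C n ω ⬝ᵥ f) ^ 2 + 2 * (C n ω ⬝ᵥ f) * (C n ω ⬝ᵥ (R *ᵥ f)) / ((n : ℝ) + 1)
        + (C n ω ⬝ᵥ fun i => (R *ᵥ f) i ^ 2) / ((n : ℝ) + 1)) ∂μ := by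
  rw [h.integral_comp_succ hR (F := fun c => (c ⬝ᵥ f) ^ 2) ((continuous_dotProduct f).pow 2) n]
  refine integral_congr_ae (ae_of_all _ fun ω => ?_)
  have e : ∀ i, R i ⬝ᵥ f = (R *ᵥ f) i := fun i => rfl
  simp only [add_dotProduct, smul_eq_mul, e]
  have e1 : ∀ i, C n ω i / ((n : ℝ) + 1) * (C n ω ⬝ᵥ f + (R *ᵥ f) i) ^ 2
      = C n ω i / ((n : ℝ) + 1) * (C n ω ⬝ᵥ f) ^ 2
        + 2 * (C n ω ⬝ᵥ f) * (C n ω i / ((n : ℝ) + 1) * (R *ᵥ f) i)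
        + C n ω i / ((n : ℝ) + 1) * (fun i => (R *ᵥ f) i ^ 2) i := fun i => by ring
  simp only [e1, Finset.sum_add_distrib, ← Finset.sum_mul, ← Finset.mul_sum, sum_div_mul,
    h.sum_div_eq_one hR, one_mul]
  ring

end IsUrnProcess

end FourColorUrn

/-! ### One step of the recursion for characteristic functions. -/

namespace FourColorUrn

/-- Second order expansion of the characteristic function of a bounded discrete variable. -/
lemma norm_sum_exp_sub_le {ι : Type*} [Fintype ι] {p d : ι → ℝ} {B η τ : ℝ} (hp : ∀ i, 0 ≤ p i)
    (hp1 : ∑ i, p i = 1) (hd : ∀ i, |d i| ≤ B) (hη : |η| * B ≤ 1) :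
    ‖∑ i, (p i : ℂ) * Complex.exp (Complex.I * ((η * d i : ℝ) : ℂ)) - ((1 - η ^ 2 * τ / 2 : ℝ) : ℂ)‖
      ≤ |η| * |∑ i, p i * d i| + η ^ 2 * |∑ i, p i * d i ^ 2 - τ| + |η| ^ 3 * B ^ 3 := by
  have hterm : ∀ i, ‖Complex.exp (Complex.I * ((η * d i : ℝ) : ℂ))
      - (1 + Complex.I * ((η * d i : ℝ) : ℂ) - (((η * d i) ^ 2 / 2 : ℝ) : ℂ))‖ ≤ |η| ^ 3 * B ^ 3 := by
    intro i
    have hx : ‖Complex.I * ((η * d i : ℝ) : ℂ)‖ = |η| * |d i| := by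
      rw [norm_mul, Complex.norm_I, one_mul, Complex.norm_real, Real.norm_eq_abs, abs_mul]
    have hx1 : |η| * |d i| ≤ |η| * B := mul_le_mul_of_nonneg_left (hd i) (abs_nonneg _)
    -- The hypothesis `|η| * B ≤ 1` puts the argument in the unit disc, where the cubic remainder
    -- has a constant below `1`.
    have h := Complex.exp_bound (x := Complex.I * ((η * d i : ℝ) : ℂ)) (n := 3)
      (by rw [hx]; exact hx1.trans hη) (by norm_num)
    rw [hx] at h
    have e : ∑ m ∈ Finset.range 3, (Complex.I * ((η * d i : ℝ) : ℂ)) ^ m / (m.factorial : ℂ)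
        = 1 + Complex.I * ((η * d i : ℝ) : ℂ) - (((η * d i) ^ 2 / 2 : ℝ) : ℂ) := by
      simp only [Finset.sum_range_succ, Finset.sum_range_zero, Nat.factorial]
      push_cast
      rw [mul_pow _ _ 2, Complex.I_sq]
      ring
    rw [e] at h
    refine h.trans ?_
    rw [← mul_pow]
    have h3 : (|η| * |d i|) ^ 3 ≤ (|η| * B) ^ 3 := by gcongr
    have h4 : (0 : ℝ) ≤ (|η| * |d i|) ^ 3 := by positivity
    norm_num [Nat.factorial]
    linarith
  have e : ∑ i, (p i : ℂ) * Complex.exp (Complex.I * ((η * d i : ℝ) : ℂ))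
        - ((1 - η ^ 2 * τ / 2 : ℝ) : ℂ)
      = ∑ i, (p i : ℂ) * (Complex.exp (Complex.I * ((η * d i : ℝ) : ℂ))
          - (1 + Complex.I * ((η * d i : ℝ) : ℂ) - (((η * d i) ^ 2 / 2 : ℝ) : ℂ)))
        + (Complex.I * ((η * ∑ i, p i * d i : ℝ) : ℂ)
          + ((-(η ^ 2 / 2 * (∑ i, p i * d i ^ 2 - τ)) : ℝ) : ℂ)) := by
    have h1 : ∑ i, (p i : ℂ) = 1 := by exact_mod_cast hp1
    have h2 : ∑ i, (p i : ℂ) * (Complex.exp (Complex.I * ((η * d i : ℝ) : ℂ))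
          - (1 + Complex.I * ((η * d i : ℝ) : ℂ) - (((η * d i) ^ 2 / 2 : ℝ) : ℂ)))
        = ∑ i, (p i : ℂ) * Complex.exp (Complex.I * ((η * d i : ℝ) : ℂ)) - ∑ i, (p i : ℂ)
          - Complex.I * η * ∑ i, (p i * d i : ℂ) + η ^ 2 / 2 * ∑ i, (p i * d i ^ 2 : ℂ) := by
      rw [Finset.mul_sum, Finset.mul_sum, ← Finset.sum_sub_distrib, ← Finset.sum_sub_distrib,
        ← Finset.sum_add_distrib]
      refine Finset.sum_congr rfl fun i _ => ?_
      push_cast; ring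
    rw [h2, h1]
    push_cast; ring
  rw [e]
  refine (norm_add_le _ _).trans ?_
  have hA : ‖∑ i, (p i : ℂ) * (Complex.exp (Complex.I * ((η * d i : ℝ) : ℂ))
      - (1 + Complex.I * ((η * d i : ℝ) : ℂ) - (((η * d i) ^ 2 / 2 : ℝ) : ℂ)))‖
      ≤ |η| ^ 3 * B ^ 3 := by
    refine (norm_sum_le _ _).trans ?_
    calc _ ≤ ∑ i, p i * (|η| ^ 3 * B ^ 3) := by
          refine Finset.sum_le_sum fun i _ => ?_
          rw [norm_mul, Complex.norm_real, Real.norm_eq_abs, abs_of_nonneg (hp i)]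
          exact mul_le_mul_of_nonneg_left (hterm i) (hp i)
      _ = _ := by rw [← Finset.sum_mul, hp1, one_mul]
  have hB := norm_add_le (Complex.I * ((η * ∑ i, p i * d i : ℝ) : ℂ))
    ((-(η ^ 2 / 2 * (∑ i, p i * d i ^ 2 - τ)) : ℝ) : ℂ)
  rw [norm_mul, Complex.norm_I, one_mul, Complex.norm_real, Complex.norm_real, Real.norm_eq_abs,
    Real.norm_eq_abs, abs_neg, abs_mul, abs_mul, abs_of_nonneg (show (0 : ℝ) ≤ η ^ 2 / 2 by positivity)]
    at hB
  have h5 : 0 ≤ η ^ 2 / 2 * |∑ i, p i * d i ^ 2 - τ| := by positivity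
  linarith

/-- Replaces the factor `1 - η²τ/2` of the expansion by an exponential, so that the factors of
successive steps multiply into a Gaussian. Beyond `x = 1` crude bounds suffice. -/
lemma abs_exp_neg_sub_le {x : ℝ} (hx : 0 ≤ x) : |(1 - x) - Real.exp (-x)| ≤ x ^ 2 := by
  by_cases h1 : x ≤ 1
  · have h := Real.abs_exp_sub_one_sub_id_le (x := -x) (by rwa [abs_neg, abs_of_nonneg hx])
    rw [abs_sub_comm, show Real.exp (-x) - (1 - x) = Real.exp (-x) - 1 - -x by ring]
    simpa using h
  · have h2 := Real.exp_pos (-x)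
    have h3 : Real.exp (-x) ≤ 1 := Real.exp_le_one_iff.2 (by linarith)
    rw [abs_le]
    constructor <;> nlinarith

namespace IsUrnProcess

variable {Ω ι : Type*} [Fintype ι] [DecidableEq ι] [MeasurableSpace Ω] {μ : Measure Ω}
  [IsProbabilityMeasure μ] {R : Matrix ι ι ℝ} {c₀ : ι → ℝ} {X : ℕ → Ω → ι} {C : ℕ → Ω → ι → ℝ}

/-- One step of the recursion for the characteristic function along a generalized eigenvector. -/
lemma norm_integral_exp_succ_sub_le (h : IsUrnProcess μ R c₀ X C)
    (hR : R ∈ Matrix.rowStochastic ℝ ι) {u t : ι → ℝ} {β B θ τ : ℝ} (hβ : -1 < β) (hτ : 0 ≤ τ)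
    (ht : R *ᵥ t = u + β • t)
    (hB : ∀ n ω i, |(R *ᵥ t) i - β * (C n ω ⬝ᵥ t) / ((n : ℝ) + 1)| ≤ B) (n : ℕ)
    (hη : |θ / growth β (n + 1)| * B ≤ 1) :
    ‖∫ ω, Complex.exp (Complex.I * ((θ / growth β (n + 1) * (C (n + 1) ω ⬝ᵥ t) : ℝ) : ℂ)) ∂μ
      - ((Real.exp (-((θ / growth β (n + 1)) ^ 2 * τ / 2)) : ℝ) : ℂ)
        * ∫ ω, Complex.exp (Complex.I * ((θ / growth β n * (C n ω ⬝ᵥ t) : ℝ) : ℂ)) ∂μ‖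
    ≤ |θ / growth β (n + 1)| * ((∫ ω, |C n ω ⬝ᵥ u| ∂μ) / ((n : ℝ) + 1))
      + (θ / growth β (n + 1)) ^ 2 * (∫ ω, |∑ i, C n ω i / ((n : ℝ) + 1)
          * ((R *ᵥ t) i - β * (C n ω ⬝ᵥ t) / ((n : ℝ) + 1)) ^ 2 - τ| ∂μ)
      + (|θ / growth β (n + 1)| ^ 3 * B ^ 3 + ((θ / growth β (n + 1)) ^ 2 * τ / 2) ^ 2) := by
  set η := θ / growth β (n + 1) with hηdef
  have hn : (0 : ℝ) < (n : ℝ) + 1 := by positivity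
  have hg := growth_pos hβ n
  have hg1 := one_add_div_pos hβ n
  -- This is why the frequency is scaled by `growth`: the mean displacement `β C_n t / (n + 1)` is
  -- absorbed by passing from the frequency at time `n + 1` to that at time `n`.
  have hθ : θ / growth β n = η * (1 + β / ((n : ℝ) + 1)) := by
    rw [hηdef, growth_succ, div_mul_eq_mul_div, mul_div_mul_right _ _ hg1.ne']
  clear_value η
  have hF : Continuous fun c : ι → ℝ => Complex.exp (Complex.I * ((η * (c ⬝ᵥ t) : ℝ) : ℂ)) := by
    have := continuous_dotProduct t
    fun_prop
  have hF' : Continuous fun c : ι → ℝ =>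
      Complex.exp (Complex.I * ((θ / growth β n * (c ⬝ᵥ t) : ℝ) : ℂ)) := by
    have := continuous_dotProduct t
    fun_prop
  rw [h.integral_comp_succ hR hF n]
  have hI1 : Integrable (fun ω => ∑ i, (C n ω i / ((n : ℝ) + 1)) •
      Complex.exp (Complex.I * ((η * ((C n ω + R i) ⬝ᵥ t) : ℝ) : ℂ))) μ := by
    refine h.integrable_comp hR (F := fun c => ∑ i, (c i / ((n : ℝ) + 1)) •
      Complex.exp (Complex.I * ((η * ((c + R i) ⬝ᵥ t) : ℝ) : ℂ))) ?_ n
    refine continuous_finsetSum _ fun i _ => ?_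
    exact ((continuous_apply i).div_const _).smul
      (hF.comp (continuous_id.add continuous_const))
  have hI2 := (h.integrable_comp hR hF' n).const_mul
    ((Real.exp (-(η ^ 2 * τ / 2)) : ℝ) : ℂ)
  have hI3 : Integrable (fun ω => |C n ω ⬝ᵥ u|) μ :=
    h.integrable_comp hR (continuous_dotProduct u).abs n
  have hI4 : Integrable (fun ω => |∑ i, C n ω i / ((n : ℝ) + 1)
          * ((R *ᵥ t) i - β * (C n ω ⬝ᵥ t) / ((n : ℝ) + 1)) ^ 2 - τ|) μ := by
    refine h.integrable_comp hR (F := fun c => |∑ i, c i / ((n : ℝ) + 1)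
          * ((R *ᵥ t) i - β * (c ⬝ᵥ t) / ((n : ℝ) + 1)) ^ 2 - τ|) ?_ n
    have := continuous_dotProduct t
    fun_prop
  have hmono : ‖∫ ω, (∑ i, (C n ω i / ((n : ℝ) + 1)) •
        Complex.exp (Complex.I * ((η * ((C n ω + R i) ⬝ᵥ t) : ℝ) : ℂ))
      - ((Real.exp (-(η ^ 2 * τ / 2)) : ℝ) : ℂ)
        * Complex.exp (Complex.I * ((θ / growth β n * (C n ω ⬝ᵥ t) : ℝ) : ℂ))) ∂μ‖
      ≤ ∫ ω, (|η| * (|C n ω ⬝ᵥ u| / ((n : ℝ) + 1))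
      + η ^ 2 * |∑ i, C n ω i / ((n : ℝ) + 1)
          * ((R *ᵥ t) i - β * (C n ω ⬝ᵥ t) / ((n : ℝ) + 1)) ^ 2 - τ|
      + (|η| ^ 3 * B ^ 3 + (η ^ 2 * τ / 2) ^ 2)) ∂μ := by
    refine norm_integral_le_of_norm_le ?_ (ae_of_all _ fun ω => ?_)
    · exact (((hI3.div_const _).const_mul _).add (hI4.const_mul _)).add (integrable_const _)
    set d : ι → ℝ := fun i => (R *ᵥ t) i - β * (C n ω ⬝ᵥ t) / ((n : ℝ) + 1) with hd
    -- The phase known at time `n` splits off exactly; only the displacements `d i` remain to be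
    -- expanded.
    have hfac : ∑ i, (C n ω i / ((n : ℝ) + 1)) •
        Complex.exp (Complex.I * ((η * ((C n ω + R i) ⬝ᵥ t) : ℝ) : ℂ))
        = (∑ i, ((C n ω i / ((n : ℝ) + 1) : ℝ) : ℂ) *
          Complex.exp (Complex.I * ((η * d i : ℝ) : ℂ)))
          * Complex.exp (Complex.I * ((θ / growth β n * (C n ω ⬝ᵥ t) : ℝ) : ℂ)) := by
      rw [Finset.sum_mul]
      refine Finset.sum_congr rfl fun i _ => ?_
      rw [mul_assoc, ← Complex.exp_add, Complex.real_smul, ← mul_add, ← Complex.ofReal_add, hθ]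
      congr 5
      have e : R i ⬝ᵥ t = (R *ᵥ t) i := rfl
      rw [add_dotProduct, e, hd]
      ring
    -- The `β` part of the conditional mean cancels, and only the drift along `u` is left.
    have hsumd : ∑ i, C n ω i / ((n : ℝ) + 1) * d i = (C n ω ⬝ᵥ u) / ((n : ℝ) + 1) := by
      simp only [hd, mul_sub, Finset.sum_sub_distrib, ← Finset.sum_mul, sum_div_mul,
        h.sum_div_eq_one hR, one_mul, ht, dotProduct_add, dotProduct_smul, smul_eq_mul]
      ring
    have key := norm_sum_exp_sub_le (p := fun i => C n ω i / ((n : ℝ) + 1)) (d := d) (τ := τ)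
      (fun i => div_nonneg (h.nonneg hR n ω i) hn.le) (h.sum_div_eq_one hR n ω) (hB n ω) hη
    rw [hsumd, abs_div, abs_of_pos hn] at key
    have hexp : ‖((1 - η ^ 2 * τ / 2 : ℝ) : ℂ) - ((Real.exp (-(η ^ 2 * τ / 2)) : ℝ) : ℂ)‖
        ≤ (η ^ 2 * τ / 2) ^ 2 := by
      rw [← Complex.ofReal_sub, Complex.norm_real, Real.norm_eq_abs]
      exact abs_exp_neg_sub_le (by positivity)
    have htri := norm_add_le (∑ i, ((C n ω i / ((n : ℝ) + 1) : ℝ) : ℂ) *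
          Complex.exp (Complex.I * ((η * d i : ℝ) : ℂ)) - ((1 - η ^ 2 * τ / 2 : ℝ) : ℂ))
      (((1 - η ^ 2 * τ / 2 : ℝ) : ℂ) - ((Real.exp (-(η ^ 2 * τ / 2)) : ℝ) : ℂ))
    rw [sub_add_sub_cancel] at htri
    rw [hfac, ← sub_mul, norm_mul, mul_comm Complex.I, Complex.norm_exp_ofReal_mul_I, mul_one]
    linarith
  rw [integral_sub hI1 hI2, integral_const_mul, integral_add, integral_add,
    integral_const_mul, integral_const_mul, integral_div] at hmono
  · simpa using hmono
  · exact (hI3.div_const _).const_mul _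
  · exact hI4.const_mul _
  · exact ((hI3.div_const _).const_mul _).add (hI4.const_mul _)
  · exact integrable_const _

end IsUrnProcess

end FourColorUrn

/-! ### Convergence of the characteristic functions for `β < 1/2`. -/

namespace FourColorUrn

/-- Weighted averages with weights `growth β (k + 1) ^ (-2)`. -/
lemma tendsto_sum_growth_sq {β : ℝ} (hβ : -1 < β) (hβ2 : β < 1 / 2) {x : ℕ → ℝ} {L : ℝ}
    (hx : Tendsto x atTop (𝓝 L)) :
    Tendsto (fun n : ℕ => ∑ k ∈ Finset.range n,
      (growth β n / Real.sqrt n / growth β (k + 1)) ^ 2 * x k) atTop (𝓝 ((1 - 2 * β)⁻¹ * L)) := by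
  have hG := Real.Gamma_pos_of_pos (s := β + 1) (by linarith)
  have h1 := tendsto_sum_rpow_mul_div (p := 1 - 2 * β) (by linarith)
    (((tendsto_rpow_div_growth_succ hβ).pow 2).mul hx)
  have h2 := ((tendsto_growth_div hβ).pow 2).mul h1
  -- The Gamma constants of `growth β n` and of `growth β (k + 1)` cancel.
  have e : (Real.Gamma (β + 1))⁻¹ ^ 2 * ((1 - 2 * β)⁻¹ * (Real.Gamma (β + 1) ^ 2 * L))
      = (1 - 2 * β)⁻¹ * L := by field_simp
  rw [e] at h2
  refine h2.congr' ?_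
  filter_upwards [eventually_gt_atTop 0] with n hn
  have hn' : (0 : ℝ) < n := by exact_mod_cast hn
  rw [Finset.sum_div, Finset.mul_sum]
  refine Finset.sum_congr rfl fun k _ => ?_
  have hk : (0 : ℝ) < (k : ℝ) + 1 := by positivity
  have e1 : ((k : ℝ) + 1) ^ (1 - 2 * β - 1) = ((((k : ℝ) + 1) ^ β) ^ 2)⁻¹ := by
    rw [← Real.rpow_natCast, ← Real.rpow_mul hk.le, ← Real.rpow_neg hk.le]
    congr 1; push_cast; ring
  have e2 : (n : ℝ) ^ (1 - 2 * β) = n / ((n : ℝ) ^ β) ^ 2 := by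
    rw [Real.rpow_sub hn', Real.rpow_one, ← Real.rpow_natCast, ← Real.rpow_mul hn'.le]
    congr 2; push_cast; ring
  have e3 : (0 : ℝ) < (n : ℝ) ^ β := by positivity
  have e4 : (0 : ℝ) < ((k : ℝ) + 1) ^ β := by positivity
  have e5 := growth_pos hβ (k + 1)
  rw [e1, e2, div_pow, div_pow, div_pow, div_pow, Real.sq_sqrt hn'.le]
  field_simp

/-- Weighted averages with weights `growth β (k + 1) ^ (-1)`. -/
lemma tendsto_sum_growth_mul {β : ℝ} (hβ : -1 < β) (hβ2 : β < 1 / 2) {x : ℕ → ℝ}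
    (hx : Tendsto (fun k : ℕ => x k / ((k : ℝ) + 1) ^ (1 / 2 : ℝ)) atTop (𝓝 0)) :
    Tendsto (fun n : ℕ => ∑ k ∈ Finset.range n,
      growth β n / Real.sqrt n / growth β (k + 1) * (x k / ((k : ℝ) + 1))) atTop (𝓝 0) := by
  have h1 := tendsto_sum_rpow_mul_div (p := 1 / 2 - β) (by linarith)
    ((tendsto_rpow_div_growth_succ hβ).mul hx)
  have h2 := (tendsto_growth_div hβ).mul h1
  simp only [mul_zero] at h2
  refine h2.congr' ?_
  filter_upwards [eventually_gt_atTop 0] with n hn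
  have hn' : (0 : ℝ) < n := by exact_mod_cast hn
  rw [Finset.sum_div, Finset.mul_sum]
  refine Finset.sum_congr rfl fun k _ => ?_
  have hk : (0 : ℝ) < (k : ℝ) + 1 := by positivity
  have e1 : ((k : ℝ) + 1) ^ (1 / 2 - β - 1) = ((k : ℝ) + 1) ^ (1 / 2 : ℝ) /
      (((k : ℝ) + 1) ^ β * ((k : ℝ) + 1)) := by
    rw [Real.rpow_sub hk, Real.rpow_sub hk, Real.rpow_one, div_div]
  have e2 : (n : ℝ) ^ (1 / 2 - β) = Real.sqrt n / (n : ℝ) ^ β := by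
    rw [Real.rpow_sub hn', Real.sqrt_eq_rpow]
  have e3 : (0 : ℝ) < (n : ℝ) ^ β := by positivity
  have e4 : (0 : ℝ) < ((k : ℝ) + 1) ^ β := by positivity
  have e6 : (0 : ℝ) < ((k : ℝ) + 1) ^ (1 / 2 : ℝ) := by positivity
  have e5 := growth_pos hβ (k + 1)
  rw [e1, e2]
  field_simp

/-- The ratios `growth β n / (√n * growth β (k + 1))`, `k < n`, are uniformly small. -/
lemma exists_growth_ratio_bound {β : ℝ} (hβ : -1 < β) (hβ2 : β < 1 / 2) :
    ∃ m : ℕ → ℝ, Tendsto m atTop (𝓝 0) ∧ (∀ n, 0 ≤ m n) ∧ ∀ n : ℕ, ∀ k < n,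
      growth β n / Real.sqrt n / growth β (k + 1) ≤ m n := by
  obtain ⟨K₁, hK₁⟩ := (tendsto_growth_div hβ).bddAbove_range
  obtain ⟨K₂, hK₂⟩ := (tendsto_rpow_div_growth_succ hβ).bddAbove_range
  have hK₁' : ∀ n : ℕ, growth β n / (n : ℝ) ^ β ≤ K₁ := fun n => hK₁ ⟨n, rfl⟩
  have hK₂' : ∀ n : ℕ, ((n : ℝ) + 1) ^ β / growth β (n + 1) ≤ K₂ := fun n => hK₂ ⟨n, rfl⟩
  have hK₁0 : 0 ≤ K₁ := le_trans (by have := growth_pos hβ 1; positivity) (hK₁' 1)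
  have hK₂0 : 0 ≤ K₂ := le_trans (by have := growth_pos hβ (1 + 1); positivity) (hK₂' 1)
  refine ⟨fun n => K₁ * K₂ * ((n : ℝ) ^ (-(1 / 2 - β)) + (n : ℝ) ^ (-(1 / 2 : ℝ))), ?_,
    fun n => by positivity, fun n k hk => ?_⟩
  · have h1 : Tendsto (fun n : ℕ => (n : ℝ) ^ (-(1 / 2 - β))) atTop (𝓝 0) :=
      (tendsto_rpow_neg_atTop (by linarith)).comp tendsto_natCast_atTop_atTop
    have h2 : Tendsto (fun n : ℕ => (n : ℝ) ^ (-(1 / 2 : ℝ))) atTop (𝓝 0) :=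
      (tendsto_rpow_neg_atTop (by norm_num)).comp tendsto_natCast_atTop_atTop
    simpa using (h1.add h2).const_mul (K₁ * K₂)
  · have hn' : (0 : ℝ) < n := by exact_mod_cast (Nat.zero_le k).trans_lt hk
    have hk0 : (0 : ℝ) < (k : ℝ) + 1 := by positivity
    have hkn : (k : ℝ) + 1 ≤ n := by exact_mod_cast hk
    have hk1 : 1 ≤ (k : ℝ) + 1 := by linarith [(Nat.cast_nonneg k : (0 : ℝ) ≤ k)]
    have g1 := growth_pos hβ n
    have g2 := growth_pos hβ (k + 1)
    have p1 : (0 : ℝ) < (n : ℝ) ^ β := by positivity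
    have p2 : (0 : ℝ) < ((k : ℝ) + 1) ^ β := by positivity
    have e : growth β n / Real.sqrt n / growth β (k + 1)
        = (growth β n / (n : ℝ) ^ β) * (((k : ℝ) + 1) ^ β / growth β (k + 1))
          * ((n : ℝ) ^ β * ((k : ℝ) + 1) ^ (-β) / Real.sqrt n) := by
      rw [Real.rpow_neg hk0.le]
      field_simp
    rw [e]
    refine mul_le_mul (mul_le_mul (hK₁' n) (hK₂' k) (by positivity) hK₁0) ?_ (by positivity)
      (by positivity)
    have r1 : (0 : ℝ) < (n : ℝ) ^ (-(1 / 2 - β)) := by positivity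
    have r2 : (0 : ℝ) < (n : ℝ) ^ (-(1 / 2 : ℝ)) := by positivity
    have s1 : (n : ℝ) ^ (-(1 / 2 - β)) = (n : ℝ) ^ β / Real.sqrt n := by
      rw [Real.sqrt_eq_rpow, ← Real.rpow_sub hn']; congr 1; ring
    have s2 : (n : ℝ) ^ (-(1 / 2 : ℝ)) = 1 / Real.sqrt n := by
      rw [Real.sqrt_eq_rpow, Real.rpow_neg hn'.le, one_div (_ ^ _)]
    have hs : 0 < Real.sqrt n := Real.sqrt_pos.2 hn'
    -- The factor `(k + 1) ^ (-β)` is largest at `k = 0` for `β ≥ 0` and at `k = n - 1` for `β < 0`;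
    -- the two summands of `m n` cover the two cases.
    rcases le_or_gt 0 β with hb | hb
    · have : ((k : ℝ) + 1) ^ (-β) ≤ 1 := Real.rpow_le_one_of_one_le_of_nonpos hk1 (by linarith)
      have : (n : ℝ) ^ β * ((k : ℝ) + 1) ^ (-β) / Real.sqrt n ≤ (n : ℝ) ^ β / Real.sqrt n := by
        gcongr
        nlinarith
      linarith
    · have h3 : ((k : ℝ) + 1) ^ (-β) ≤ (n : ℝ) ^ (-β) :=
        Real.rpow_le_rpow hk0.le hkn (by linarith)
      have : (n : ℝ) ^ β * ((k : ℝ) + 1) ^ (-β) / Real.sqrt n ≤ 1 / Real.sqrt n := by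
        gcongr
        calc (n : ℝ) ^ β * ((k : ℝ) + 1) ^ (-β) ≤ (n : ℝ) ^ β * (n : ℝ) ^ (-β) := by gcongr
          _ = 1 := by rw [← Real.rpow_add hn']; simp
      linarith

/-- The factors `exp (-a k)` are at most `1`, so one-step errors are never amplified and simply add.
-/
lemma norm_sub_exp_neg_sum_mul_le {φ : ℕ → ℂ} {a e : ℕ → ℝ} (ha : ∀ k, 0 ≤ a k) {n : ℕ}
    (hφ : ∀ k < n, ‖φ (k + 1) - ((Real.exp (-a k) : ℝ) : ℂ) * φ k‖ ≤ e k) :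
    ‖φ n - ((Real.exp (-∑ k ∈ Finset.range n, a k) : ℝ) : ℂ) * φ 0‖
      ≤ ∑ k ∈ Finset.range n, e k := by
  induction n with
  | zero => simp
  | succ n ih =>
    have h1 := ih fun k hk => hφ k (hk.trans n.lt_succ_self)
    have h2 := hφ n n.lt_succ_self
    rw [Finset.sum_range_succ, Finset.sum_range_succ, neg_add, add_comm (-_), Real.exp_add]
    have e1 : φ (n + 1) - ((Real.exp (-a n) * Real.exp (-∑ k ∈ Finset.range n, a k) : ℝ) : ℂ) * φ 0
        = (φ (n + 1) - ((Real.exp (-a n) : ℝ) : ℂ) * φ n) + ((Real.exp (-a n) : ℝ) : ℂ)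
          * (φ n - ((Real.exp (-∑ k ∈ Finset.range n, a k) : ℝ) : ℂ) * φ 0) := by
      push_cast; ring
    rw [e1]
    refine (norm_add_le _ _).trans ?_
    rw [norm_mul, Complex.norm_real, Real.norm_eq_abs, abs_of_pos (Real.exp_pos _)]
    have h3 : Real.exp (-a n) ≤ 1 := Real.exp_le_one_iff.2 (by linarith [ha n])
    have h4 := mul_le_mul h3 h1 (norm_nonneg _) zero_le_one
    linarith

namespace IsUrnProcess

variable {Ω ι : Type*} [Fintype ι] [DecidableEq ι] [MeasurableSpace Ω] {μ : Measure Ω}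
  [IsProbabilityMeasure μ] {R : Matrix ι ι ℝ} {c₀ : ι → ℝ} {X : ℕ → Ω → ι} {C : ℕ → Ω → ι → ℝ}

/-- Convergence of the characteristic functions along a generalized eigenvector. -/
lemma tendsto_integral_exp (h : IsUrnProcess μ R c₀ X C)
    (hR : R ∈ Matrix.rowStochastic ℝ ι) {u t : ι → ℝ} {β B τ : ℝ} (hβ : -1 < β) (hβ2 : β < 1 / 2)
    (hτ : 0 ≤ τ) (ht : R *ᵥ t = u + β • t)
    (hB : ∀ n ω i, |(R *ᵥ t) i - β * (C n ω ⬝ᵥ t) / ((n : ℝ) + 1)| ≤ B)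
    (hu : Tendsto (fun n : ℕ => (∫ ω, |C n ω ⬝ᵥ u| ∂μ) / ((n : ℝ) + 1) ^ (1 / 2 : ℝ)) atTop (𝓝 0))
    (hv : Tendsto (fun n : ℕ => ∫ ω, |∑ i, C n ω i / ((n : ℝ) + 1)
          * ((R *ᵥ t) i - β * (C n ω ⬝ᵥ t) / ((n : ℝ) + 1)) ^ 2 - τ| ∂μ) atTop (𝓝 0)) (x : ℝ) :
    Tendsto (fun n : ℕ => ∫ ω, Complex.exp (Complex.I * ((x * ((C n ω ⬝ᵥ t) / Real.sqrt n) : ℝ) : ℂ))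
      ∂μ) atTop (𝓝 ((Real.exp (-((1 - 2 * β)⁻¹ * (x ^ 2 * τ / 2))) : ℝ) : ℂ)) := by
  obtain ⟨m, hm, hm0, hmb⟩ := exists_growth_ratio_bound hβ hβ2
  set ρ : ℕ → ℕ → ℝ := fun n k => growth β n / Real.sqrt n / growth β (k + 1) with hρ
  have hρ0 : ∀ n k, 0 ≤ ρ n k := fun n k => by
    have := growth_pos hβ n; have := growth_pos hβ (k + 1); positivity
  -- For each final time `n`, this makes the frequency at time `n` equal to `x / √n`; the recursion
  -- then runs over `k < n` with `θ n` fixed.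
  set θ : ℕ → ℝ := fun n => x * (growth β n / Real.sqrt n) with hθ
  have hη : ∀ n k, θ n / growth β (k + 1) = x * ρ n k := fun n k => by
    simp only [hθ, hρ]; ring
  set φ : ℕ → ℕ → ℂ := fun n k =>
    ∫ ω, Complex.exp (Complex.I * ((θ n / growth β k * (C k ω ⬝ᵥ t) : ℝ) : ℂ)) ∂μ with hφ
  have hB0 : 0 ≤ B := by
    obtain ⟨ω⟩ := nonempty_of_isProbabilityMeasure μ
    have : Nonempty ι := by
      by_contra hne
      rw [not_nonempty_iff] at hne
      have := h.sum_eq hR 0 ω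
      simp at this
    obtain ⟨i⟩ := this
    exact (abs_nonneg _).trans (hB 0 ω i)
  set ε : ℕ → ℝ := fun k => ∫ ω, |C k ω ⬝ᵥ u| ∂μ
  set ε' : ℕ → ℝ := fun n => ∫ ω, |∑ i, C n ω i / ((n : ℝ) + 1)
          * ((R *ᵥ t) i - β * (C n ω ⬝ᵥ t) / ((n : ℝ) + 1)) ^ 2 - τ| ∂μ
  -- The cubic and the quartic errors keep one factor `ρ n k ^ 2` for the summation; their remaining
  -- factors are bounded uniformly in `k` by powers of `m n`, which tends to `0`.
  set K : ℕ → ℝ := fun n => |x| * m n * B ^ 3 + (x * m n) ^ 2 * τ ^ 2 / 4 with hK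
  have hmain : ∀ᶠ n in atTop, ‖φ n n - ((Real.exp (-∑ k ∈ Finset.range n,
      (x * ρ n k) ^ 2 * τ / 2) : ℝ) : ℂ) * φ n 0‖ ≤ |x| * ∑ k ∈ Finset.range n,
        ρ n k * (ε k / ((k : ℝ) + 1)) + x ^ 2 * ∑ k ∈ Finset.range n, ρ n k ^ 2 * ε' k
        + x ^ 2 * K n * ∑ k ∈ Finset.range n, ρ n k ^ 2 * 1 := by
    have hev : ∀ᶠ n in atTop, |x| * m n * B ≤ 1 := by
      have : Tendsto (fun n => |x| * m n * B) atTop (𝓝 0) := by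
        simpa using (hm.const_mul |x|).mul_const B
      exact (this.eventually_lt_const one_pos).mono fun _ => le_of_lt
    filter_upwards [hev] with n hn
    refine (norm_sub_exp_neg_sum_mul_le (e := fun k => |x| * (ρ n k * (ε k / ((k : ℝ) + 1)))
      + x ^ 2 * (ρ n k ^ 2 * ε' k) + x ^ 2 * K n * (ρ n k ^ 2 * 1)) (fun k => by positivity)
      fun k hk => ?_).trans (le_of_eq ?_)
    · have hρm : ρ n k ≤ m n := hmb n k hk
      have habs : |x * ρ n k| = |x| * ρ n k := by rw [abs_mul, abs_of_nonneg (hρ0 n k)]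
      have key := h.norm_integral_exp_succ_sub_le hR (u := u) (t := t) (β := β) (B := B) (θ := θ n)
        (τ := τ) hβ hτ ht hB k (by
          rw [hη, habs]
          refine le_trans ?_ hn
          gcongr)
      rw [hη, habs] at key
      simp only [hφ, hη]
      refine key.trans ?_
      have h1 : (|x| * ρ n k) ^ 3 * B ^ 3 ≤ x ^ 2 * ρ n k ^ 2 * (|x| * m n * B ^ 3) := by
        have : (|x| * ρ n k) ^ 3 * B ^ 3 = x ^ 2 * ρ n k ^ 2 * (|x| * ρ n k * B ^ 3) := by
          rw [← sq_abs x]; ring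
        rw [this]
        have := hρ0 n k
        gcongr
      have h2 : ((x * ρ n k) ^ 2 * τ / 2) ^ 2 ≤ x ^ 2 * ρ n k ^ 2 * ((x * m n) ^ 2 * τ ^ 2 / 4) := by
        have : ((x * ρ n k) ^ 2 * τ / 2) ^ 2
            = x ^ 2 * ρ n k ^ 2 * (x ^ 2 * ρ n k ^ 2 * τ ^ 2 / 4) := by ring
        rw [this, mul_pow]
        have := hρ0 n k
        gcongr
      simp only [hK]
      nlinarith [h1, h2]
    · simp only [Finset.sum_add_distrib, Finset.mul_sum]
  have hS1 : Tendsto (fun n => ∑ k ∈ Finset.range n, ρ n k * (ε k / ((k : ℝ) + 1))) atTop (𝓝 0) :=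
    tendsto_sum_growth_mul hβ hβ2 hu
  have hS2 : Tendsto (fun n => ∑ k ∈ Finset.range n, ρ n k ^ 2 * ε' k) atTop (𝓝 0) := by
    simpa using tendsto_sum_growth_sq hβ hβ2 hv
  have hS3 : Tendsto (fun n => ∑ k ∈ Finset.range n, ρ n k ^ 2 * (1 : ℝ)) atTop
      (𝓝 ((1 - 2 * β)⁻¹ * 1)) := tendsto_sum_growth_sq hβ hβ2 tendsto_const_nhds
  have hK0 : Tendsto K atTop (𝓝 0) := by
    have a1 := (hm.const_mul |x|).mul_const (B ^ 3)
    have a2 := (((hm.const_mul x).pow 2).mul_const (τ ^ 2)).div_const 4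
    simpa using a1.add a2
  have hdiff : Tendsto (fun n => φ n n - ((Real.exp (-∑ k ∈ Finset.range n,
      (x * ρ n k) ^ 2 * τ / 2) : ℝ) : ℂ) * φ n 0) atTop (𝓝 0) := by
    refine squeeze_zero_norm' hmain ?_
    simpa using ((hS1.const_mul |x|).add (hS2.const_mul (x ^ 2))).add
      ((hK0.const_mul (x ^ 2)).mul hS3)
  have hexp : Tendsto (fun n => ((Real.exp (-∑ k ∈ Finset.range n,
      (x * ρ n k) ^ 2 * τ / 2) : ℝ) : ℂ)) atTop
      (𝓝 ((Real.exp (-((1 - 2 * β)⁻¹ * (x ^ 2 * τ / 2))) : ℝ) : ℂ)) := by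
    refine (Complex.continuous_ofReal.tendsto _).comp ((Real.continuous_exp.tendsto _).comp ?_)
    have := (hS3.mul_const (x ^ 2 * τ / 2)).neg
    rw [mul_one] at this
    refine this.congr fun n => ?_
    rw [Finset.sum_mul]
    congr 1
    exact Finset.sum_congr rfl fun k _ => by ring
  -- The initial composition is deterministic and its frequency `θ n` tends to `0`.
  have hφ0 : Tendsto (fun n => φ n 0) atTop (𝓝 1) := by
    have hθ0 : Tendsto θ atTop (𝓝 0) := by
      have hb : Tendsto (fun n : ℕ => growth β n / Real.sqrt n) atTop (𝓝 0) := by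
        refine squeeze_zero' (Eventually.of_forall fun n => ?_) ?_
          (by simpa using hm.mul_const (growth β (0 + 1)))
        · have := growth_pos hβ n; positivity
        · filter_upwards [eventually_gt_atTop 0] with n hn
          have := hmb n 0 hn
          rwa [div_le_iff₀ (growth_pos hβ _)] at this
      simpa [hθ] using hb.const_mul x
    have : Tendsto (fun n => Complex.exp (Complex.I * ((θ n / growth β 0 * (c₀ ⬝ᵥ t) : ℝ) : ℂ)))
        atTop (𝓝 (Complex.exp (Complex.I * ((0 / growth β 0 * (c₀ ⬝ᵥ t) : ℝ) : ℂ)))) := by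
      refine (Complex.continuous_exp.tendsto _).comp (Tendsto.const_mul _
        ((Complex.continuous_ofReal.tendsto _).comp ((hθ0.div_const _).mul_const _)))
    simp only [zero_div, zero_mul, Complex.ofReal_zero, mul_zero, Complex.exp_zero] at this
    refine this.congr fun n => ?_
    simp [hφ, h.init]
  have hfin := hdiff.add (hexp.mul hφ0)
  simp only [sub_add_cancel, zero_add, mul_one] at hfin
  refine hfin.congr fun n => ?_
  simp only [hφ, hθ]
  have hg := growth_pos hβ n
  have e : ∀ ω, x * (growth β n / Real.sqrt n) / growth β n * (C n ω ⬝ᵥ t)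
      = x * ((C n ω ⬝ᵥ t) / Real.sqrt n) := fun ω => by field_simp
  simp only [e]

end IsUrnProcess

end FourColorUrn

/-! ### Almost sure and `L²` convergence; martingale transforms. -/

namespace FourColorUrn

namespace TendstoASL2

variable {Ω : Type*} [MeasurableSpace Ω] {μ : Measure Ω} {Y Y' : ℕ → Ω → ℝ} {W W' : Ω → ℝ}

/-- A real-valued norm makes weighted averages of norms directly accessible. -/
lemma tendsto_lpNorm (h : TendstoASL2 μ Y W) :
    Tendsto (fun n => lpNorm (Y n - W) 2 μ) atTop (𝓝 0) := by
  have h1 := (ENNReal.tendsto_toReal ENNReal.zero_ne_top).comp h.2.2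
  rw [ENNReal.toReal_zero] at h1
  refine squeeze_zero (fun n => lpNorm_nonneg) (fun n => ?_) h1
  by_cases hm : AEStronglyMeasurable (Y n - W) μ
  · rw [← toReal_eLpNorm hm]; exact le_rfl
  · rw [lpNorm_of_not_aestronglyMeasurable hm]
    exact ENNReal.toReal_nonneg

lemma of_tendsto_lpNorm (hY : ∀ n, MemLp (Y n) 2 μ) (hW : MemLp W 2 μ)
    (has : ∀ᵐ ω ∂μ, Tendsto (fun n => Y n ω) atTop (𝓝 (W ω)))
    (h : Tendsto (fun n => lpNorm (Y n - W) 2 μ) atTop (𝓝 0)) : TendstoASL2 μ Y W := by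
  refine ⟨hW, has, ?_⟩
  have h1 := ENNReal.tendsto_ofReal h
  rw [ENNReal.ofReal_zero] at h1
  exact h1.congr fun n => ofReal_lpNorm ((hY n).sub hW)

lemma congr' (h : TendstoASL2 μ Y W) (hYY' : ∀ᶠ n in atTop, ∀ ω, Y n ω = Y' n ω) :
    TendstoASL2 μ Y' W := by
  refine ⟨h.1, ?_, ?_⟩
  · filter_upwards [h.2.1] with ω hω
    exact hω.congr' (hYY'.mono fun n hn => hn ω)
  · refine h.2.2.congr' (hYY'.mono fun n hn => ?_)
    simp only [hn]

lemma add (hY : ∀ n, MemLp (Y n) 2 μ) (hY' : ∀ n, MemLp (Y' n) 2 μ) (h : TendstoASL2 μ Y W)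
    (h' : TendstoASL2 μ Y' W') :
    TendstoASL2 μ (fun n ω => Y n ω + Y' n ω) (fun ω => W ω + W' ω) := by
  refine of_tendsto_lpNorm (fun n => (hY n).add (hY' n)) (h.1.add h'.1) ?_ ?_
  · filter_upwards [h.2.1, h'.2.1] with ω h1 h2 using h1.add h2
  · refine squeeze_zero (fun _ => lpNorm_nonneg) (fun n => ?_)
      (by simpa using h.tendsto_lpNorm.add h'.tendsto_lpNorm)
    have e : ((fun ω => Y n ω + Y' n ω) - fun ω => W ω + W' ω) = (Y n - W) + (Y' n - W') := by
      ext ω; simp only [Pi.sub_apply, Pi.add_apply]; ring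
    rw [e]
    exact lpNorm_add_le ((hY n).sub h.1) (by norm_num)

lemma mul_tendsto {c : ℕ → ℝ} {c' : ℝ} (hY : ∀ n, MemLp (Y n) 2 μ) (h : TendstoASL2 μ Y W)
    (hc : Tendsto c atTop (𝓝 c')) :
    TendstoASL2 μ (fun n ω => c n * Y n ω) (fun ω => c' * W ω) := by
  refine of_tendsto_lpNorm (fun n => (hY n).const_mul _) (h.1.const_mul _) ?_ ?_
  · filter_upwards [h.2.1] with ω h1 using hc.mul h1
  · have h0 : Tendsto (fun n => |c n| * lpNorm (Y n - W) 2 μ + |c n - c'| * lpNorm W 2 μ)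
        atTop (𝓝 0) := by
      have h1 := (hc.abs.mul h.tendsto_lpNorm).add
        (((hc.sub_const c').abs).mul_const (lpNorm W 2 μ))
      simpa using h1
    refine squeeze_zero (fun _ => lpNorm_nonneg) (fun n => ?_) h0
    have e : ((fun ω => c n * Y n ω) - fun ω => c' * W ω)
        = c n • (Y n - W) + (c n - c') • W := by
      ext ω; simp only [Pi.sub_apply, Pi.add_apply, Pi.smul_apply, smul_eq_mul]; ring
    rw [e]
    refine (lpNorm_add_le (((hY n).sub h.1).const_smul _) (by norm_num)).trans (le_of_eq ?_)
    rw [lpNorm_const_smul, lpNorm_const_smul]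
    simp

/-- Harmonically weighted averages converge to the same limit. -/
lemma harmonic_average (hY : ∀ n, MemLp (Y n) 2 μ) (h : TendstoASL2 μ Y W) :
    TendstoASL2 μ (fun n ω => (∑ k ∈ Finset.range n, ((k : ℝ) + 1)⁻¹ * Y k ω) / Real.log n) W := by
  have hw : ∀ k : ℕ, (0 : ℝ) ≤ ((k : ℝ) + 1)⁻¹ := fun k => by positivity
  refine of_tendsto_lpNorm (fun n => ?_) h.1 ?_ ?_
  · simp only [div_eq_mul_inv]
    exact (memLp_finsetSum _ fun k _ => (hY k).const_mul _).mul_const _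
  · filter_upwards [h.2.1] with ω h1
    simpa using tendsto_weighted_average' hw tendsto_sum_inv_atTop tendsto_sum_inv_div_log h1
  · have h1 := tendsto_weighted_average' hw tendsto_sum_inv_atTop tendsto_sum_inv_div_log
      h.tendsto_lpNorm
    have h2 := ((tendsto_sum_inv_div_log.sub_const 1).abs).mul_const (lpNorm W 2 μ)
    have h3 := h1.add h2
    simp only [sub_self, abs_zero, zero_mul, mul_zero, add_zero] at h3
    refine squeeze_zero' (Eventually.of_forall fun _ => lpNorm_nonneg) ?_ h3
    filter_upwards [tendsto_log_natCast_atTop.eventually_gt_atTop 0] with n hn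
    have e : ((fun ω => (∑ k ∈ Finset.range n, ((k : ℝ) + 1)⁻¹ * Y k ω) / Real.log n) - W)
        = ∑ k ∈ Finset.range n, (((k : ℝ) + 1)⁻¹ / Real.log n) • (Y k - W)
          + ((∑ k ∈ Finset.range n, ((k : ℝ) + 1)⁻¹) / Real.log n - 1) • W := by
      ext ω
      simp only [Pi.sub_apply, Pi.add_apply, Finset.sum_apply, Pi.smul_apply, smul_eq_mul,
        mul_sub, Finset.sum_sub_distrib, ← Finset.sum_mul, sub_mul, one_mul, ← Finset.sum_div,
        div_mul_eq_mul_div]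
      ring
    rw [e]
    have hM : ∀ k ∈ Finset.range n, MemLp ((((k : ℝ) + 1)⁻¹ / Real.log n) • (Y k - W)) 2 μ :=
      fun k _ => ((hY k).sub h.1).const_smul _
    have hMs : MemLp (∑ k ∈ Finset.range n, (((k : ℝ) + 1)⁻¹ / Real.log n) • (Y k - W)) 2 μ :=
      memLp_finsetSum' _ hM
    refine (lpNorm_add_le hMs (by norm_num)).trans ?_
    refine add_le_add ((lpNorm_sum_le hM (by norm_num)).trans (le_of_eq ?_))
      (le_of_eq ?_)
    · rw [Finset.sum_div]
      refine Finset.sum_congr rfl fun k _ => ?_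
      rw [lpNorm_const_smul, coe_nnnorm, Real.norm_eq_abs,
        abs_of_nonneg (div_nonneg (hw k) hn.le)]
      ring
    · rw [lpNorm_const_smul]; simp

lemma const [IsProbabilityMeasure μ] (c : ℝ) : TendstoASL2 μ (fun _ _ => c) (fun _ => c) :=
  ⟨memLp_const c, ae_of_all _ fun _ => tendsto_const_nhds, by simp⟩

end TendstoASL2

lemma eLpNorm_two_le_of_integral_sq_le {Ω : Type*} [MeasurableSpace Ω] {μ : Measure Ω}
    {f : Ω → ℝ} {A : ℝ} (hf : MemLp f 2 μ) (hA : ∫ ω, f ω ^ 2 ∂μ ≤ A) :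
    eLpNorm f 2 μ ≤ ENNReal.ofReal (Real.sqrt A) := by
  rw [← ofReal_lpNorm hf, lpNorm_eq_integral_norm_rpow_toReal (by norm_num) (by norm_num) hf.1]
  refine ENNReal.ofReal_le_ofReal ?_
  rw [Real.sqrt_eq_rpow]
  have e : ∀ ω, ‖f ω‖ ^ (2 : ℝ≥0∞).toReal = f ω ^ 2 := fun ω => by
    simp
  simp only [e]
  norm_num
  exact Real.rpow_le_rpow (integral_nonneg fun ω => sq_nonneg _) hA (by norm_num)

namespace IsUrnProcess

variable {Ω ι : Type*} [Fintype ι] [MeasurableSpace Ω] {μ : Measure Ω}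
  {R : Matrix ι ι ℝ} {c₀ : ι → ℝ} {X : ℕ → Ω → ι} {C : ℕ → Ω → ι → ℝ}

/-- The compensated increment of `C n ⬝ᵥ f` as a function of two successive compositions. -/
noncomputable def increment (R : Matrix ι ι ℝ) (f : ι → ℝ) (C : ℕ → Ω → ι → ℝ) (k : ℕ) (ω : Ω) : ℝ :=
  C (k + 1) ω ⬝ᵥ f - C k ω ⬝ᵥ f - (C k ω ⬝ᵥ (R *ᵥ f)) / ((k : ℝ) + 1)

/-- Weighted sums of the compensated increments. -/
noncomputable def martingaleTransform (R : Matrix ι ι ℝ) (f : ι → ℝ) (C : ℕ → Ω → ι → ℝ) (w : ℕ → ℝ) (n : ℕ)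
    (ω : Ω) : ℝ :=
  ∑ k ∈ Finset.range n, w k * increment R f C k ω

lemma increment_eq (h : IsUrnProcess μ R c₀ X C) (f : ι → ℝ) (k : ℕ) (ω : Ω) :
    increment R f C k ω = (R *ᵥ f) (X k ω) - (C k ω ⬝ᵥ (R *ᵥ f)) / ((k : ℝ) + 1) := by
  have e : ∀ i, R i ⬝ᵥ f = (R *ᵥ f) i := fun i => rfl
  rw [increment, h.step, add_dotProduct, e]
  ring

lemma stronglyMeasurable_increment {α : Type*} {C : ℕ → α → ι → ℝ} (f : ι → ℝ) {k n : ℕ}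
    (hk : k < n) : StronglyMeasurable[history C n] (increment R f C k) :=
  ((stronglyMeasurable_comp (continuous_dotProduct f) hk).sub
    (stronglyMeasurable_comp (continuous_dotProduct f) hk.le)).sub
    ((stronglyMeasurable_comp (F := fun c => (c ⬝ᵥ (R *ᵥ f)) / ((k : ℝ) + 1))
      ((continuous_dotProduct _).div_const _) hk.le))

lemma memLp_of_bound [IsProbabilityMeasure μ] (h : IsUrnProcess μ R c₀ X C) {n : ℕ} {G : Ω → ℝ}
    (hG : StronglyMeasurable[history C n] G) {B : ℝ} (hB : ∀ ω, |G ω| ≤ B) : MemLp G 2 μ :=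
  MemLp.of_bound (hG.mono (h.history_le n)).aestronglyMeasurable B (ae_of_all _ hB)

lemma stronglyMeasurable_martingaleTransform {α : Type*} {C : ℕ → α → ι → ℝ} (f : ι → ℝ)
    (w : ℕ → ℝ) {m n : ℕ} (hmn : m ≤ n) :
    StronglyMeasurable[history C n] (martingaleTransform R f C w m) := by
  refine Finset.stronglyMeasurable_fun_sum _ fun k hk => ?_
  exact (stronglyMeasurable_increment f ((Finset.mem_range.1 hk).trans_le hmn)).const_mul _

variable [DecidableEq ι]

lemma exists_bound_increment (h : IsUrnProcess μ R c₀ X C) (hR : R ∈ Matrix.rowStochastic ℝ ι)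
    (f : ι → ℝ) (k : ℕ) : ∃ B, ∀ ω, |increment R f C k ω| ≤ B := by
  obtain ⟨B₁, h₁⟩ := h.exists_bound hR (continuous_dotProduct f) (k + 1)
  obtain ⟨B₂, h₂⟩ := h.exists_bound hR (continuous_dotProduct f) k
  obtain ⟨B₃, h₃⟩ := h.exists_bound hR
    ((continuous_dotProduct (R *ᵥ f)).div_const ((k : ℝ) + 1)) k
  refine ⟨B₁ + B₂ + B₃, fun ω => ?_⟩
  exact (abs_sub _ _).trans (add_le_add ((abs_sub _ _).trans (add_le_add (h₁ ω) (h₂ ω))) (h₃ ω))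

lemma exists_bound_martingaleTransform (h : IsUrnProcess μ R c₀ X C)
    (hR : R ∈ Matrix.rowStochastic ℝ ι) (f : ι → ℝ) (w : ℕ → ℝ) (n : ℕ) :
    ∃ B, ∀ ω, |martingaleTransform R f C w n ω| ≤ B := by
  choose B hB using h.exists_bound_increment hR f
  refine ⟨∑ k ∈ Finset.range n, |w k| * B k, fun ω => ?_⟩
  refine (Finset.abs_sum_le_sum_abs _ _).trans (Finset.sum_le_sum fun k _ => ?_)
  rw [abs_mul]
  exact mul_le_mul_of_nonneg_left (hB k ω) (abs_nonneg _)

variable [IsProbabilityMeasure μ]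

lemma memLp_dotProduct (h : IsUrnProcess μ R c₀ X C) (hR : R ∈ Matrix.rowStochastic ℝ ι)
    (f : ι → ℝ) (n : ℕ) : MemLp (fun ω => C n ω ⬝ᵥ f) 2 μ := by
  obtain ⟨B, hB⟩ := h.exists_bound hR (continuous_dotProduct f) n
  exact h.memLp_of_bound (stronglyMeasurable_comp (continuous_dotProduct f) le_rfl) hB

lemma memLp_martingaleTransform (h : IsUrnProcess μ R c₀ X C) (hR : R ∈ Matrix.rowStochastic ℝ ι)
    (f : ι → ℝ) (w : ℕ → ℝ) (n : ℕ) : MemLp (martingaleTransform R f C w n) 2 μ := by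
  obtain ⟨B, hB⟩ := h.exists_bound_martingaleTransform hR f w n
  exact h.memLp_of_bound (stronglyMeasurable_martingaleTransform f w le_rfl) hB

/-- The compensated increments are centered given the past. Bounded `G` yields orthogonality of
increments, and indicators yield the martingale property. -/
lemma integral_mul_increment (h : IsUrnProcess μ R c₀ X C) (hR : R ∈ Matrix.rowStochastic ℝ ι)
    (f : ι → ℝ) {k : ℕ} {G : Ω → ℝ} (hG : StronglyMeasurable[history C k] G) {B : ℝ}
    (hB : ∀ ω, |G ω| ≤ B) : ∫ ω, G ω * increment R f C k ω ∂μ = 0 := by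
  simp only [h.increment_eq]
  have hcont : ∀ i, Continuous fun c : ι → ℝ => (R *ᵥ f) i - (c ⬝ᵥ (R *ᵥ f)) / ((k : ℝ) + 1) :=
    fun i => continuous_const.sub ((continuous_dotProduct _).div_const _)
  rw [h.integral_sum_draw (G := fun i ω => G ω *
    ((R *ᵥ f) i - (C k ω ⬝ᵥ (R *ᵥ f)) / ((k : ℝ) + 1)))]
  · rw [← integral_zero Ω ℝ (μ := μ)]
    refine integral_congr_ae (ae_of_all _ fun ω => ?_)
    have e : ∀ i, (C k ω i / ((k : ℝ) + 1)) • (G ω *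
        ((R *ᵥ f) i - (C k ω ⬝ᵥ (R *ᵥ f)) / ((k : ℝ) + 1)))
        = G ω * (C k ω i / ((k : ℝ) + 1) * (R *ᵥ f) i
          - C k ω i / ((k : ℝ) + 1) * ((C k ω ⬝ᵥ (R *ᵥ f)) / ((k : ℝ) + 1))) := fun i => by
      rw [smul_eq_mul]; ring
    simp only [e, ← Finset.mul_sum, Finset.sum_sub_distrib, ← Finset.sum_mul, sum_div_mul,
      h.sum_div_eq_one hR, one_mul, sub_self, mul_zero]
  · intro i
    exact hG.mul (stronglyMeasurable_comp (hcont i) le_rfl)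
  · intro i
    obtain ⟨B', hB'⟩ := h.exists_bound hR (hcont i) k
    refine ⟨B * B', fun ω => ?_⟩
    rw [norm_mul]
    exact mul_le_mul (hB ω) (hB' ω) (norm_nonneg _) ((abs_nonneg _).trans (hB ω))

/-- A conditional variance is at most the conditional second moment, which is linear in the
composition. -/
lemma integral_increment_sq_le (h : IsUrnProcess μ R c₀ X C) (hR : R ∈ Matrix.rowStochastic ℝ ι)
    (f : ι → ℝ) (k : ℕ) :
    ∫ ω, increment R f C k ω ^ 2 ∂μ
      ≤ (∫ ω, C k ω ⬝ᵥ (fun i => (R *ᵥ f) i ^ 2) ∂μ) / ((k : ℝ) + 1) := by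
  simp only [h.increment_eq]
  have hcont : ∀ i, Continuous fun c : ι → ℝ =>
      ((R *ᵥ f) i - (c ⬝ᵥ (R *ᵥ f)) / ((k : ℝ) + 1)) ^ 2 :=
    fun i => (continuous_const.sub ((continuous_dotProduct _).div_const _)).pow 2
  rw [h.integral_sum_draw (G := fun i ω =>
    ((R *ᵥ f) i - (C k ω ⬝ᵥ (R *ᵥ f)) / ((k : ℝ) + 1)) ^ 2)
    (fun i => stronglyMeasurable_comp (hcont i) le_rfl) fun i => h.exists_bound hR (hcont i) k,
    ← integral_div]
  refine integral_mono ?_ ((h.integrable_comp hR (continuous_dotProduct _) k).div_const _) ?_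
  · refine h.integrable_comp hR (F := fun c => ∑ i, (c i / ((k : ℝ) + 1)) •
      ((R *ᵥ f) i - (c ⬝ᵥ (R *ᵥ f)) / ((k : ℝ) + 1)) ^ 2) ?_ k
    exact continuous_finsetSum _ fun i _ => ((continuous_apply i).div_const _).smul (hcont i)
  · intro ω
    set y := (C k ω ⬝ᵥ (R *ᵥ f)) / ((k : ℝ) + 1) with hy
    have e : ∀ i, (C k ω i / ((k : ℝ) + 1)) • ((R *ᵥ f) i - y) ^ 2
        = C k ω i / ((k : ℝ) + 1) * (fun i => (R *ᵥ f) i ^ 2) i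
          - 2 * y * (C k ω i / ((k : ℝ) + 1) * (R *ᵥ f) i)
          + C k ω i / ((k : ℝ) + 1) * y ^ 2 := fun i => by
      rw [smul_eq_mul]; ring
    simp only [e, Finset.sum_add_distrib, Finset.sum_sub_distrib, ← Finset.mul_sum,
      ← Finset.sum_mul, sum_div_mul, h.sum_div_eq_one hR, one_mul, ← hy]
    nlinarith [sq_nonneg y]

lemma integral_martingaleTransform_sub_sq_le (h : IsUrnProcess μ R c₀ X C)
    (hR : R ∈ Matrix.rowStochastic ℝ ι) (f : ι → ℝ) (w : ℕ → ℝ) {n m : ℕ} (hnm : n ≤ m) :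
    ∫ ω, (martingaleTransform R f C w m ω - martingaleTransform R f C w n ω) ^ 2 ∂μ
      ≤ ∑ k ∈ Finset.Ico n m, w k ^ 2 *
        ((∫ ω, C k ω ⬝ᵥ (fun i => (R *ᵥ f) i ^ 2) ∂μ) / ((k : ℝ) + 1)) := by
  induction m, hnm using Nat.le_induction with
  | base => simp
  | succ m hnm ih =>
    rw [Finset.sum_Ico_succ_top hnm]
    obtain ⟨B₁, hB₁⟩ := h.exists_bound_martingaleTransform hR f w m
    obtain ⟨B₂, hB₂⟩ := h.exists_bound_martingaleTransform hR f w n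
    obtain ⟨B₃, hB₃⟩ := h.exists_bound_increment hR f m
    have hS : StronglyMeasurable[history C m] (fun ω => martingaleTransform R f C w m ω
        - martingaleTransform R f C w n ω) :=
      (stronglyMeasurable_martingaleTransform f w le_rfl).sub
        (stronglyMeasurable_martingaleTransform f w hnm)
    have hSB : ∀ ω, |martingaleTransform R f C w m ω - martingaleTransform R f C w n ω|
        ≤ B₁ + B₂ := fun ω => (abs_sub _ _).trans (add_le_add (hB₁ ω) (hB₂ ω))
    have hSL := h.memLp_of_bound hS hSB
    have hIL := h.memLp_of_bound (stronglyMeasurable_increment (R := R) f m.lt_succ_self) hB₃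
    have e : ∀ ω, (martingaleTransform R f C w (m + 1) ω - martingaleTransform R f C w n ω) ^ 2
        = (martingaleTransform R f C w m ω - martingaleTransform R f C w n ω) ^ 2
          + (2 * w m) * ((martingaleTransform R f C w m ω - martingaleTransform R f C w n ω)
            * increment R f C m ω) + w m ^ 2 * increment R f C m ω ^ 2 := fun ω => by
      rw [martingaleTransform, Finset.sum_range_succ, ← martingaleTransform]; ring
    simp only [e]
    have hI := hSL.integrable_mul hIL
    have hI' : Integrable (fun ω => (2 * w m) * ((martingaleTransform R f C w m ω
        - martingaleTransform R f C w n ω) * increment R f C m ω)) μ := hI.const_mul _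
    have hI'' : Integrable (fun ω => (martingaleTransform R f C w m ω
        - martingaleTransform R f C w n ω) ^ 2 + (2 * w m) * ((martingaleTransform R f C w m ω
        - martingaleTransform R f C w n ω) * increment R f C m ω)) μ := hSL.integrable_sq.add hI'
    rw [integral_add hI'' (hIL.integrable_sq.const_mul _),
      integral_add hSL.integrable_sq hI', integral_const_mul, integral_const_mul,
      h.integral_mul_increment hR f hS hSB, mul_zero, add_zero]
    exact add_le_add ih (mul_le_mul_of_nonneg_left (h.integral_increment_sq_le hR f m)
      (sq_nonneg _))

lemma martingale_martingaleTransform (h : IsUrnProcess μ R c₀ X C)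
    (hR : R ∈ Matrix.rowStochastic ℝ ι) (f : ι → ℝ) (w : ℕ → ℝ) :
    Martingale (martingaleTransform R f C w) h.filtration μ := by
  have hint : ∀ n, Integrable (martingaleTransform R f C w n) μ := fun n =>
    (h.memLp_martingaleTransform hR f w n).integrable (by norm_num)
  refine martingale_nat (fun n => stronglyMeasurable_martingaleTransform f w le_rfl) hint
    fun n => ?_
  refine ae_eq_condExp_of_forall_setIntegral_eq (h.filtration.le n) (hint (n + 1))
    (fun s _ _ => (hint n).integrableOn) (fun s hs _ => ?_)
    (stronglyMeasurable_martingaleTransform f w le_rfl).aestronglyMeasurable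
  have hs' : MeasurableSet s := h.history_le n s hs
  have hinc : Integrable (increment R f C n) μ := by
    obtain ⟨B, hB⟩ := h.exists_bound_increment hR f n
    exact h.integrable_of_bound (stronglyMeasurable_increment f n.lt_succ_self) hB
  have e : ∀ ω, martingaleTransform R f C w (n + 1) ω
      = martingaleTransform R f C w n ω + w n * increment R f C n ω := fun ω => by
    rw [martingaleTransform, Finset.sum_range_succ, ← martingaleTransform]
  simp only [e]
  rw [integral_add (hint n).integrableOn (hinc.const_mul _).integrableOn, integral_const_mul]
  have h0 : ∫ ω in s, increment R f C n ω ∂μ = 0 := by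
    rw [← integral_indicator hs']
    have hG : StronglyMeasurable[history C n] (s.indicator fun _ => (1 : ℝ)) :=
      stronglyMeasurable_const.indicator hs
    rw [← h.integral_mul_increment hR f hG (B := 1) fun ω => by
      by_cases hω : ω ∈ s <;> simp [hω]]
    refine integral_congr_ae (ae_of_all _ fun ω => ?_)
    by_cases hω : ω ∈ s <;> simp [hω]
  rw [h0, mul_zero, add_zero]

/-- Martingale transforms with summable variances converge almost surely and in `L²`. -/
lemma exists_tendstoASL2_martingaleTransform (h : IsUrnProcess μ R c₀ X C)
    (hR : R ∈ Matrix.rowStochastic ℝ ι) (f : ι → ℝ) (w : ℕ → ℝ)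
    (hs : Summable fun k => w k ^ 2 *
      ((∫ ω, C k ω ⬝ᵥ (fun i => (R *ᵥ f) i ^ 2) ∂μ) / ((k : ℝ) + 1))) :
    ∃ W, TendstoASL2 μ (martingaleTransform R f C w) W := by
  set v : ℕ → ℝ := fun k => w k ^ 2 *
      ((∫ ω, C k ω ⬝ᵥ (fun i => (R *ᵥ f) i ^ 2) ∂μ) / ((k : ℝ) + 1)) with hv
  have hv0 : ∀ k, 0 ≤ v k := fun k => by
    refine mul_nonneg (sq_nonneg _) (div_nonneg (integral_nonneg fun ω => ?_) (by positivity))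
    exact h.dotProduct_nonneg hR (fun i => sq_nonneg _) k ω
  set N := martingaleTransform R f C w with hN
  have hNL : ∀ n, MemLp (N n) 2 μ := h.memLp_martingaleTransform hR f w
  have hdiff : ∀ n m, n ≤ m → ∫ ω, (N m ω - N n ω) ^ 2 ∂μ
      ≤ ∑' k, v k - ∑ k ∈ Finset.range n, v k := fun n m hnm => by
    refine (h.integral_martingaleTransform_sub_sq_le hR f w hnm).trans ?_
    rw [Finset.sum_Ico_eq_sub _ hnm]
    exact sub_le_sub_right (hs.sum_le_tsum _ fun k _ => hv0 k) _
  -- The `L²` bound is weakened to an `L¹` bound, as needed for Doob's convergence theorem.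
  have hbdd : ∀ n, eLpNorm (N n) 1 μ ≤ (Real.sqrt (∑' k, v k)).toNNReal := fun n => by
    refine (eLpNorm_le_eLpNorm_of_exponent_le (q := 2) (by norm_num) (hNL n).1).trans ?_
    refine eLpNorm_two_le_of_integral_sq_le (hNL n) ?_
    simpa [hN, martingaleTransform] using hdiff 0 n (Nat.zero_le n)
  obtain ⟨W, hWmeas, has⟩ := measurable_limit_of_tendsto_metrizable_ae
    (fun n => (hNL n).1.aemeasurable)
    ((h.martingale_martingaleTransform hR f w).submartingale.exists_ae_tendsto_of_bdd hbdd)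
  have hWm : AEStronglyMeasurable W μ := hWmeas.aestronglyMeasurable
  have hnorm : ∀ n, eLpNorm (fun ω => N n ω - W ω) 2 μ
      ≤ ENNReal.ofReal (Real.sqrt (∑' k, v k - ∑ k ∈ Finset.range n, v k)) := fun n => by
    -- Fatou's lemma turns the Cauchy estimate into a bound on the distance to the almost sure
    -- limit. At `n = 0`, where `N` vanishes, it also shows that `W` is square integrable.
    refine (Lp.eLpNorm_lim_le_liminf_eLpNorm (f := fun m ω => N n ω - N m ω)
      (fun m => ((hNL n).sub (hNL m)).1) _ ?_).trans ?_
    · filter_upwards [has] with ω hω using hω.const_sub _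
    · refine liminf_le_of_frequently_le' (Eventually.frequently ?_)
      filter_upwards [eventually_ge_atTop n] with m hm
      refine eLpNorm_two_le_of_integral_sq_le ((hNL n).sub (hNL m)) ?_
      refine le_trans (le_of_eq (integral_congr_ae (ae_of_all _ fun ω => ?_))) (hdiff n m hm)
      change (N n ω - N m ω) ^ 2 = (N m ω - N n ω) ^ 2
      ring
  have hWL : MemLp W 2 μ := by
    refine ⟨hWm, ?_⟩
    have h0 := hnorm 0
    have e : (fun ω => N 0 ω - W ω) = -W := by
      ext ω; simp [hN, martingaleTransform]
    rw [e, eLpNorm_neg] at h0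
    exact h0.trans_lt ENNReal.ofReal_lt_top
  refine ⟨W, hWL, has, ?_⟩
  have hlim : Tendsto (fun n => ENNReal.ofReal (Real.sqrt
      (∑' k, v k - ∑ k ∈ Finset.range n, v k))) atTop (𝓝 0) := by
    have h1 := hs.hasSum.tendsto_sum_nat.const_sub (∑' k, v k)
    rw [sub_self] at h1
    simpa using ENNReal.tendsto_ofReal h1.sqrt
  exact tendsto_of_tendsto_of_tendsto_of_le_of_le tendsto_const_nhds hlim (fun _ => zero_le)
    hnorm

end IsUrnProcess

end FourColorUrn

/-! ### Limits along eigenvectors and generalized eigenvectors. -/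

namespace FourColorUrn

lemma exists_rpow_div_growth_bound {β : ℝ} (hβ : -1 < β) :
    ∃ K, 0 ≤ K ∧ ∀ n : ℕ, ((n : ℝ) + 1) ^ β / growth β (n + 1) ≤ K := by
  obtain ⟨K, hK⟩ := (tendsto_rpow_div_growth_succ hβ).bddAbove_range
  have hK' : ∀ n : ℕ, ((n : ℝ) + 1) ^ β / growth β (n + 1) ≤ K := fun n => hK ⟨n, rfl⟩
  exact ⟨K, le_trans (by have := growth_pos hβ (0 + 1); positivity) (hK' 0), hK'⟩

lemma exists_growth_le {β : ℝ} (hβ : -1 < β) :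
    ∃ K, 0 ≤ K ∧ ∀ n : ℕ, growth β n ≤ K * ((n : ℝ) + 1) ^ β := by
  have hlim : Tendsto (fun n : ℕ => growth β n / ((n : ℝ) + 1) ^ β) atTop
      (𝓝 ((Real.Gamma (β + 1))⁻¹ * 1⁻¹)) := by
    refine ((tendsto_growth_div hβ).mul ((tendsto_add_one_rpow_div β).inv₀ one_ne_zero)).congr' ?_
    filter_upwards [eventually_gt_atTop 0] with n hn
    have hn' : (0 : ℝ) < n := by exact_mod_cast hn
    have h1 : (0 : ℝ) < (n : ℝ) ^ β := by positivity
    have h2 : (0 : ℝ) < ((n : ℝ) + 1) ^ β := by positivity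
    field_simp
  obtain ⟨K, hK⟩ := hlim.bddAbove_range
  have hK' : ∀ n : ℕ, growth β n / ((n : ℝ) + 1) ^ β ≤ K := fun n => hK ⟨n, rfl⟩
  refine ⟨K, le_trans (by have := growth_pos hβ 0; positivity) (hK' 0), fun n => ?_⟩
  have := hK' n
  rwa [div_le_iff₀ (by positivity)] at this

lemma summable_add_one_rpow {p : ℝ} (hp : p < -1) : Summable fun k : ℕ => ((k : ℝ) + 1) ^ p := by
  have h := (summable_nat_add_iff 1).2 (Real.summable_nat_rpow.2 hp)
  simpa using h

lemma tendsto_growth_div_growth_succ {β : ℝ} (hβ : -1 < β) :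
    Tendsto (fun n : ℕ => growth β n / growth β (n + 1)) atTop (𝓝 1) := by
  have h1 : Tendsto (fun n : ℕ => 1 + β / ((n : ℝ) + 1)) atTop (𝓝 (1 + 0)) := by
    refine tendsto_const_nhds.add ?_
    simpa [div_eq_mul_inv] using
      (tendsto_one_div_add_atTop_nhds_zero_nat (𝕜 := ℝ)).const_mul β
  rw [add_zero] at h1
  have h2 := h1.inv₀ one_ne_zero
  rw [inv_one] at h2
  refine h2.congr fun n => ?_
  have := growth_pos hβ n
  have := one_add_div_pos hβ n
  rw [growth_succ]
  field_simp

/-- `1 + ∑_{k < n} 1 / (k + 1)`. -/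
noncomputable def shiftedHarmonic (n : ℕ) : ℝ := 1 + ∑ k ∈ Finset.range n, ((k : ℝ) + 1)⁻¹

lemma shiftedHarmonic_pos (n : ℕ) : 0 < shiftedHarmonic n := by
  have : 0 ≤ ∑ k ∈ Finset.range n, ((k : ℝ) + 1)⁻¹ := Finset.sum_nonneg fun k _ => by positivity
  unfold shiftedHarmonic
  linarith

lemma shiftedHarmonic_succ (n : ℕ) :
    shiftedHarmonic (n + 1) = shiftedHarmonic n + ((n : ℝ) + 1)⁻¹ := by
  simp [shiftedHarmonic, Finset.sum_range_succ, add_assoc]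

lemma tendsto_shiftedHarmonic_div_log :
    Tendsto (fun n : ℕ => shiftedHarmonic n / Real.log n) atTop (𝓝 1) := by
  have h1 : Tendsto (fun n : ℕ => 1 / Real.log n) atTop (𝓝 0) :=
    tendsto_const_nhds.div_atTop tendsto_log_natCast_atTop
  have h2 := h1.add tendsto_sum_inv_div_log
  rw [zero_add] at h2
  exact h2.congr fun n => by rw [shiftedHarmonic, add_div]

/-- Comparison with the telescoping differences of `1 / shiftedHarmonic`; starting the harmonic sums
at `1` makes the total at most `1`. -/
lemma summable_inv_mul_shiftedHarmonic_sq :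
    Summable fun k : ℕ => ((k : ℝ) + 1)⁻¹ * (shiftedHarmonic (k + 1) ^ 2)⁻¹ := by
  have hle : ∀ k : ℕ, ((k : ℝ) + 1)⁻¹ * (shiftedHarmonic (k + 1) ^ 2)⁻¹
      ≤ (shiftedHarmonic k)⁻¹ - (shiftedHarmonic (k + 1))⁻¹ := fun k => by
    have h0 := shiftedHarmonic_pos k
    have h1 := shiftedHarmonic_pos (k + 1)
    have hs := shiftedHarmonic_succ k
    have hk : (0 : ℝ) < ((k : ℝ) + 1)⁻¹ := by positivity
    have e : (shiftedHarmonic k)⁻¹ - (shiftedHarmonic (k + 1))⁻¹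
        = ((k : ℝ) + 1)⁻¹ * (shiftedHarmonic k * shiftedHarmonic (k + 1))⁻¹ := by
      have : ((k : ℝ) + 1)⁻¹ = shiftedHarmonic (k + 1) - shiftedHarmonic k := by linarith
      rw [this]
      field_simp
    rw [e]
    have : shiftedHarmonic k ≤ shiftedHarmonic (k + 1) := by linarith
    gcongr
    rw [sq]
    gcongr
  refine summable_of_sum_range_le (c := 1) (fun k => by positivity) fun n => ?_
  refine (Finset.sum_le_sum fun k _ => hle k).trans ?_
  rw [Finset.sum_range_sub']
  have := inv_pos.2 (shiftedHarmonic_pos n)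
  simp only [shiftedHarmonic, Finset.sum_range_zero, add_zero, inv_one] at this ⊢
  linarith

namespace IsUrnProcess

variable {Ω ι : Type*} [Fintype ι] [DecidableEq ι] [MeasurableSpace Ω] {μ : Measure Ω}
  [IsProbabilityMeasure μ] {R : Matrix ι ι ℝ} {c₀ : ι → ℝ} {X : ℕ → Ω → ι} {C : ℕ → Ω → ι → ℝ}

/-- Along an eigenvector for `β` whose increments have variance of order `n ^ (s - 1)`, `s < 2 β`,
the normalized process converges. -/
lemma exists_tendstoASL2_eigenvector (h : IsUrnProcess μ R c₀ X C)
    (hR : R ∈ Matrix.rowStochastic ℝ ι) {u : ι → ℝ} {β s K : ℝ} (hβ : -1 < β) (hsβ : s < 2 * β)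
    (hu : R *ᵥ u = β • u)
    (hq : ∀ k : ℕ, (∫ ω, C k ω ⬝ᵥ (fun i => (R *ᵥ u) i ^ 2) ∂μ) / ((k : ℝ) + 1)
      ≤ K * ((k : ℝ) + 1) ^ (s - 1)) :
    ∃ W, TendstoASL2 μ (fun n ω => (growth β n)⁻¹ * (C n ω ⬝ᵥ u)) W := by
  obtain ⟨L, hL0, hL⟩ := exists_rpow_div_growth_bound hβ
  have hsum : Summable fun k => (growth β (k + 1))⁻¹ ^ 2 *
      ((∫ ω, C k ω ⬝ᵥ (fun i => (R *ᵥ u) i ^ 2) ∂μ) / ((k : ℝ) + 1)) := by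
    refine Summable.of_nonneg_of_le (fun k => ?_) (fun k => ?_)
      ((summable_add_one_rpow (p := s - 1 - 2 * β) (by linarith)).mul_left (L ^ 2 * K))
    · refine mul_nonneg (sq_nonneg _) (div_nonneg (integral_nonneg fun ω => ?_) (by positivity))
      exact h.dotProduct_nonneg hR (fun i => sq_nonneg _) k ω
    · have hk : (0 : ℝ) < (k : ℝ) + 1 := by positivity
      have hg := growth_pos hβ (k + 1)
      have hp : (0 : ℝ) < ((k : ℝ) + 1) ^ β := by positivity
      have hp2 : (0 : ℝ) < ((k : ℝ) + 1) ^ (s - 1) := by positivity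
      have h0 : 0 ≤ (∫ ω, C k ω ⬝ᵥ (fun i => (R *ᵥ u) i ^ 2) ∂μ) / ((k : ℝ) + 1) :=
        div_nonneg (integral_nonneg fun ω => h.dotProduct_nonneg hR (fun i => sq_nonneg _) k ω)
          hk.le
      have hK : 0 ≤ K := by
        have := h0.trans (hq k)
        exact nonneg_of_mul_nonneg_left this hp2
      have e : ((k : ℝ) + 1) ^ (s - 1 - 2 * β)
          = ((k : ℝ) + 1) ^ (s - 1) * ((((k : ℝ) + 1) ^ β)⁻¹) ^ 2 := by
        rw [← Real.rpow_neg hk.le, ← Real.rpow_natCast, ← Real.rpow_mul hk.le,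
          ← Real.rpow_add hk]
        congr 1; push_cast; ring
      have h1 : (growth β (k + 1))⁻¹ ≤ L * (((k : ℝ) + 1) ^ β)⁻¹ := by
        have := hL k
        rw [div_le_iff₀ hg] at this
        rw [← div_eq_mul_inv, le_div_iff₀ hp, inv_mul_le_iff₀ hg]
        linarith
      calc _ ≤ (L * (((k : ℝ) + 1) ^ β)⁻¹) ^ 2 * (K * ((k : ℝ) + 1) ^ (s - 1)) := by
            gcongr
            exact hq k
        _ = _ := by rw [e]; ring
  obtain ⟨W, hW⟩ := h.exists_tendstoASL2_martingaleTransform hR u _ hsum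
  -- Since `u` is an eigenvector, the normalized process is exactly `c₀ u` plus the martingale
  -- transform with weights `1 / growth β (k + 1)`.
  refine ⟨fun ω => c₀ ⬝ᵥ u + W ω, (TendstoASL2.add (fun n => memLp_const _)
    (h.memLp_martingaleTransform hR u _) (TendstoASL2.const (c₀ ⬝ᵥ u)) hW).congr'
      (Eventually.of_forall fun n ω => ?_)⟩
  induction n with
  | zero => simp [martingaleTransform, h.init]
  | succ n ih =>
    rw [martingaleTransform, Finset.sum_range_succ, ← martingaleTransform, ← add_assoc, ih,
      increment, hu, dotProduct_smul, smul_eq_mul, growth_succ]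
    have hg := growth_pos hβ n
    have hg1 := one_add_div_pos hβ n
    have hn : (0 : ℝ) < (n : ℝ) + 1 := by positivity
    have e : (growth β n)⁻¹ = (growth β n * (1 + β / ((n : ℝ) + 1)))⁻¹ * (1 + β / ((n : ℝ) + 1)) := by
      rw [mul_inv, mul_assoc, inv_mul_cancel₀ hg1.ne', mul_one]
    rw [e]
    ring

/-- Along a generalized eigenvector `t` with `R t = u + β t`, `1/2 ≤ β`, the process normalized by
`n ^ β log n` has the same limit as the process along `u` normalized by `n ^ β`. -/
lemma tendstoASL2_generalized_eigenvector (h : IsUrnProcess μ R c₀ X C)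
    (hR : R ∈ Matrix.rowStochastic ℝ ι) {u t : ι → ℝ} {β : ℝ} (hβ2 : 1 / 2 ≤ β)
    (ht : R *ᵥ t = u + β • t) {W : Ω → ℝ}
    (hW : TendstoASL2 μ (fun n ω => (growth β n)⁻¹ * (C n ω ⬝ᵥ u)) W) :
    TendstoASL2 μ (fun n ω => (growth β n)⁻¹ * (C n ω ⬝ᵥ t) / Real.log n) W := by
  have hβ : -1 < β := by linarith
  obtain ⟨L, hL0, hL⟩ := exists_rpow_div_growth_bound hβ
  obtain ⟨B, hB⟩ : ∃ B, ∀ i, |(R *ᵥ t) i ^ 2| ≤ B := by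
    obtain ⟨B, hB⟩ := (Set.finite_range fun i => |(R *ᵥ t) i ^ 2|).bddAbove
    exact ⟨B, fun i => hB ⟨i, rfl⟩⟩
  have hq : ∀ k : ℕ, (∫ ω, C k ω ⬝ᵥ (fun i => (R *ᵥ t) i ^ 2) ∂μ) / ((k : ℝ) + 1) ≤ B := fun k => by
    have hk : (0 : ℝ) < (k : ℝ) + 1 := by positivity
    rw [div_le_iff₀ hk]
    refine (integral_mono (h.integrable_comp hR (continuous_dotProduct _) k) (integrable_const _)
      fun ω => (le_abs_self _).trans (h.abs_dotProduct_le hR hB k ω)).trans (le_of_eq ?_)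
    simp
  have hq0 : ∀ k : ℕ, 0 ≤ (∫ ω, C k ω ⬝ᵥ (fun i => (R *ᵥ t) i ^ 2) ∂μ) / ((k : ℝ) + 1) :=
    fun k => div_nonneg (integral_nonneg fun ω => h.dotProduct_nonneg hR (fun i => sq_nonneg _) k ω)
      (by positivity)
  -- Kronecker's device: the natural weights `1 / growth` may fail to be square summable at `β =
  -- 1/2`, but the extra harmonic factor makes the transform converge.
  set w : ℕ → ℝ := fun k => (growth β (k + 1) * shiftedHarmonic (k + 1))⁻¹ with hw
  have hsum : Summable fun k => w k ^ 2 *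
      ((∫ ω, C k ω ⬝ᵥ (fun i => (R *ᵥ t) i ^ 2) ∂μ) / ((k : ℝ) + 1)) := by
    refine Summable.of_nonneg_of_le (fun k => mul_nonneg (sq_nonneg _) (hq0 k)) (fun k => ?_)
      (summable_inv_mul_shiftedHarmonic_sq.mul_left (L ^ 2 * B))
    have hk : (0 : ℝ) < (k : ℝ) + 1 := by positivity
    have hg := growth_pos hβ (k + 1)
    have hh := shiftedHarmonic_pos (k + 1)
    have hp : (0 : ℝ) < ((k : ℝ) + 1) ^ β := by positivity
    have hq0k := hq0 k
    have hB0 : 0 ≤ B := hq0k.trans (hq k)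
    have h1 : (growth β (k + 1))⁻¹ ≤ L * (((k : ℝ) + 1) ^ β)⁻¹ := by
      have := hL k
      rw [div_le_iff₀ hg] at this
      rw [← div_eq_mul_inv, le_div_iff₀ hp, inv_mul_le_iff₀ hg]
      linarith
    -- This is where `β ≥ 1/2` enters.
    have h2 : ((((k : ℝ) + 1) ^ β)⁻¹) ^ 2 ≤ ((k : ℝ) + 1)⁻¹ := by
      rw [← Real.rpow_neg hk.le, ← Real.rpow_natCast, ← Real.rpow_mul hk.le, ← Real.rpow_neg_one]
      refine Real.rpow_le_rpow_of_exponent_le ?_ ?_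
      · linarith [(Nat.cast_nonneg k : (0 : ℝ) ≤ k)]
      · push_cast; linarith
    calc _ ≤ ((L * (((k : ℝ) + 1) ^ β)⁻¹) * (shiftedHarmonic (k + 1))⁻¹) ^ 2 * B := by
          simp only [hw, mul_inv]
          gcongr
          exact hq k
      _ = L ^ 2 * B * (((((k : ℝ) + 1) ^ β)⁻¹) ^ 2 * (shiftedHarmonic (k + 1) ^ 2)⁻¹) := by
          rw [mul_pow, mul_pow, inv_pow (shiftedHarmonic _)]; ring
      _ ≤ _ := by gcongr
  obtain ⟨N, hN⟩ := h.exists_tendstoASL2_martingaleTransform hR t w hsum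
  have hNL := h.memLp_martingaleTransform hR t w
  have hUL : ∀ n, MemLp (fun ω => (growth β n)⁻¹ * (C n ω ⬝ᵥ u)) 2 μ := fun n =>
    (h.memLp_dotProduct hR u n).const_mul _
  have hD := ((hW.mul_tendsto hUL (tendsto_growth_div_growth_succ hβ))).harmonic_average
    (fun n => (hUL n).const_mul _)
  -- The boundary term and the sum from summation by parts, each divided by `log n`, tend to `N` and
  -- `-N`, so the martingale part disappears.
  have hM1 := hN.mul_tendsto hNL tendsto_shiftedHarmonic_div_log
  have hM2 := (hN.harmonic_average hNL).mul_tendsto (c := fun _ => (-1 : ℝ)) (c' := -1)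
    (fun n => by
      simp only [div_eq_mul_inv]
      exact (memLp_finsetSum _ fun k _ => (hNL k).const_mul _).mul_const _) tendsto_const_nhds
  have hc := (TendstoASL2.const (μ := μ) (c₀ ⬝ᵥ t)).mul_tendsto (fun _ => memLp_const _)
    (show Tendsto (fun n : ℕ => (Real.log n)⁻¹) atTop (𝓝 0) from
      tendsto_inv_atTop_zero.comp tendsto_log_natCast_atTop)
  have hM2L : ∀ n : ℕ, MemLp (fun ω => (-1 : ℝ) * ((∑ k ∈ Finset.range n, ((k : ℝ) + 1)⁻¹ *
      martingaleTransform R t C w k ω) / Real.log n)) 2 μ := fun n => by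
    simp only [div_eq_mul_inv]
    exact ((memLp_finsetSum _ fun k _ => (hNL k).const_mul _).mul_const _).const_mul _
  have hDL : ∀ n : ℕ, MemLp (fun ω => (∑ k ∈ Finset.range n, ((k : ℝ) + 1)⁻¹ *
      (growth β k / growth β (k + 1) * ((growth β k)⁻¹ * (C k ω ⬝ᵥ u)))) / Real.log n) 2 μ :=
    fun n => by
      simp only [div_eq_mul_inv]
      exact (memLp_finsetSum _ fun k _ => ((hUL k).const_mul _).const_mul _).mul_const _
  have hM := TendstoASL2.add (fun n => (hNL n).const_mul _) hM2L hM1 hM2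
  have hML := fun n => (((hNL n).const_mul (shiftedHarmonic n / Real.log n)).add (hM2L n))
  have hMD := TendstoASL2.add hML hDL hM hD
  have hall := TendstoASL2.add (fun n => (memLp_const _).const_mul _)
    (fun n => (hML n).add (hDL n)) hc hMD
  have eW : (fun ω => 0 * (c₀ ⬝ᵥ t) + (1 * N ω + -1 * N ω + 1 * W ω)) = W := by
    ext ω; ring
  rw [eW] at hall
  refine hall.congr' (Eventually.of_forall fun n ω => ?_)
  -- Summation by parts with the harmonic factor, whose increments are `1 / (k + 1)`, together with
  -- the drift along `u`.
  have key : ∀ n : ℕ, (growth β n)⁻¹ * (C n ω ⬝ᵥ t) = c₀ ⬝ᵥ t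
      + (shiftedHarmonic n * martingaleTransform R t C w n ω
        - ∑ k ∈ Finset.range n, ((k : ℝ) + 1)⁻¹ * martingaleTransform R t C w k ω
        + ∑ k ∈ Finset.range n, ((k : ℝ) + 1)⁻¹ *
          (growth β k / growth β (k + 1) * ((growth β k)⁻¹ * (C k ω ⬝ᵥ u)))) := by
    intro n
    induction n with
    | zero => simp [martingaleTransform, h.init]
    | succ n ih =>
      have hg := growth_pos hβ n
      have hg1 := one_add_div_pos hβ n
      have hg2 := growth_pos hβ (n + 1)
      have hn : (0 : ℝ) < (n : ℝ) + 1 := by positivity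
      have hh := shiftedHarmonic_pos (n + 1)
      have e : (growth β n)⁻¹ = (growth β (n + 1))⁻¹ * (1 + β / ((n : ℝ) + 1)) := by
        rw [growth_succ, mul_inv, mul_assoc, inv_mul_cancel₀ hg1.ne', mul_one]
      have e2 : growth β n / growth β (n + 1) * ((growth β n)⁻¹ * (C n ω ⬝ᵥ u))
          = (growth β (n + 1))⁻¹ * (C n ω ⬝ᵥ u) := by field_simp
      have e3 : shiftedHarmonic (n + 1) * (w n * increment R t C n ω)
          = (growth β (n + 1))⁻¹ * increment R t C n ω := by
        simp only [hw]; field_simp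
      have e4 : martingaleTransform R t C w (n + 1) ω
          = martingaleTransform R t C w n ω + w n * increment R t C n ω := by
        rw [martingaleTransform, Finset.sum_range_succ, ← martingaleTransform]
      rw [Finset.sum_range_succ, Finset.sum_range_succ, e2, e4, mul_add, e3, shiftedHarmonic_succ]
      have e5 : increment R t C n ω = C (n + 1) ω ⬝ᵥ t - C n ω ⬝ᵥ t
          - (C n ω ⬝ᵥ u + β * (C n ω ⬝ᵥ t)) / ((n : ℝ) + 1) := by
        rw [increment, ht, dotProduct_add, dotProduct_smul, smul_eq_mul]
      rw [e] at ih
      rw [e5]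
      linear_combination ih
  rw [key n]
  simp only [Pi.add_apply]
  ring

end IsUrnProcess

end FourColorUrn

/-! ### The four-color urn: moment bounds, law of large numbers, central limit theorem. -/

namespace FourColorUrn

lemma stochastic_fin_two {P : Matrix (Fin 2) (Fin 2) ℝ} (hP : P ∈ Matrix.rowStochastic ℝ (Fin 2)) :
    P 0 0 = 1 - P 0 1 ∧ P 1 1 = 1 - P 1 0 ∧ 0 ≤ P 0 1 ∧ 0 ≤ P 1 0 ∧ P 0 1 ≤ 1 ∧ P 1 0 ≤ 1 := by
  have h0 := sum_row_of_mem_rowStochastic hP 0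
  have h1 := sum_row_of_mem_rowStochastic hP 1
  rw [Fin.sum_univ_two] at h0 h1
  exact ⟨by linarith, by linarith, nonneg_of_mem_rowStochastic hP, nonneg_of_mem_rowStochastic hP,
    le_one_of_mem_rowStochastic hP, le_one_of_mem_rowStochastic hP⟩

/-- The non-principal eigenvalue of a stochastic `2 × 2` matrix. -/
lemma eigenvalue_fin_two {P : Matrix (Fin 2) (Fin 2) ℝ} (hP : P ∈ Matrix.rowStochastic ℝ (Fin 2))
    {β : ℝ} (hβ : β ≠ 1) {v : Fin 2 → ℝ} (hv : P *ᵥ v = β • v) (hv0 : v ≠ 0) :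
    v 0 ≠ v 1 ∧ β = 1 - P 0 1 - P 1 0 := by
  obtain ⟨h00, h11, -⟩ := stochastic_fin_two hP
  have e0 := congrFun hv 0
  have e1 := congrFun hv 1
  simp only [mulVec, dotProduct, Fin.sum_univ_two, h00, h11, Pi.smul_apply, smul_eq_mul] at e0 e1
  have hne : v 0 ≠ v 1 := by
    intro h
    have hz : (1 - β) * v 1 = 0 := by rw [h] at e0; linarith
    have hv1 : v 1 = 0 := (mul_eq_zero.1 hz).resolve_left (sub_ne_zero.2 hβ.symm)
    refine hv0 (funext fun i => ?_)
    fin_cases i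
    · exact h.trans hv1
    · exact hv1
  refine ⟨hne, mul_right_cancel₀ (sub_ne_zero.2 hne) ?_⟩
  linarith

/-- The orthogonal complement of `π` is a `P`-invariant line, so `P` acts on it by its other
eigenvalue, trace minus one. -/
lemma mulVec_eq_of_dotProduct_eq_zero {P : Matrix (Fin 2) (Fin 2) ℝ}
    (hP : P ∈ Matrix.rowStochastic ℝ (Fin 2)) {π : Fin 2 → ℝ} (hπ : IsStationaryDistribution P π)
    {g : Fin 2 → ℝ} (hg : π ⬝ᵥ g = 0) : P *ᵥ g = (1 - P 0 1 - P 1 0) • g := by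
  obtain ⟨h00, h11, -⟩ := stochastic_fin_two hP
  have hsum := hπ.1.2
  have hst := congrFun hπ.2 0
  simp only [vecMul, dotProduct, Fin.sum_univ_two, h00] at hsum hst hg
  have hp : P 0 1 = π 1 * (P 0 1 + P 1 0) := by linear_combination -hst - P 0 1 * hsum
  have hq : P 1 0 = π 0 * (P 0 1 + P 1 0) := by linear_combination hst - P 1 0 * hsum
  ext i
  fin_cases i <;>
    simp only [mulVec, dotProduct, Fin.sum_univ_two, Fin.zero_eta, Fin.mk_one, h00, h11,
      Pi.smul_apply, smul_eq_mul]
  · linear_combination (P 0 1 + P 1 0) * hg + g 1 * hp + g 0 * hq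
  · linear_combination (P 0 1 + P 1 0) * hg + g 1 * hp + g 0 * hq

lemma dotProduct_eigenvector_eq_zero {P : Matrix (Fin 2) (Fin 2) ℝ} {π g : Fin 2 → ℝ} {β : ℝ}
    (hπ : IsStationaryDistribution P π) (hβ : β ≠ 1) (hg : P *ᵥ g = β • g) : π ⬝ᵥ g = 0 := by
  have h1 : π ⬝ᵥ (P *ᵥ g) = π ⬝ᵥ g := by rw [dotProduct_mulVec, hπ.2]
  rw [hg, dotProduct_smul, smul_eq_mul] at h1
  have h2 : (β - 1) * (π ⬝ᵥ g) = 0 := by linarith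
  exact (mul_eq_zero.1 h2).resolve_left (sub_ne_zero.2 hβ)

lemma replacement_mulVec (s : ℝ) (Q E P : Matrix (Fin 2) (Fin 2) ℝ) (a b : Fin 2 → ℝ) :
    replacement s Q E P *ᵥ Sum.elim a b = Sum.elim (s • (Q *ᵥ a) + E *ᵥ b) (P *ᵥ b) := by
  rw [replacement, fromBlocks_mulVec]
  congr 1
  · simp [smul_mulVec]
  · simp

lemma replacement_mulVec_v₁ {s : ℝ} {Q : Matrix (Fin 2) (Fin 2) ℝ}
    (hQ : Q ∈ Matrix.rowStochastic ℝ (Fin 2)) (E P : Matrix (Fin 2) (Fin 2) ℝ) :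
    replacement s Q E P *ᵥ v₁ = s • v₁ := by
  have h1 : Q *ᵥ (fun _ => 1) = fun _ => 1 := hQ.2
  have h0 : (fun _ => 0 : Fin 2 → ℝ) = 0 := rfl
  rw [v₁, replacement_mulVec, h1, h0, mulVec_zero, mulVec_zero, add_zero]
  ext i; rcases i with i | i <;> simp

lemma v₁_nonneg (i : Color) : 0 ≤ v₁ i := by rcases i with i | i <;> simp [v₁]

/-- A vector supported on the first two colors is dominated by a multiple of `v₁`. -/
lemma exists_abs_le_v₁ {u : Color → ℝ} (hu : ∀ j, u (Sum.inr j) = 0) :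
    ∃ K : ℝ, 0 ≤ K ∧ ∀ i, |u i| ≤ (K • v₁) i := by
  refine ⟨|u (Sum.inl 0)| + |u (Sum.inl 1)|, by positivity, fun i => ?_⟩
  have h0 := abs_nonneg (u (Sum.inl 0))
  have h1 := abs_nonneg (u (Sum.inl 1))
  rcases i with i | i
  · fin_cases i <;> simp [v₁]
  · simp [v₁, hu]

namespace IsUrnProcess

section General

variable {Ω ι : Type*} [Fintype ι] [DecidableEq ι] [MeasurableSpace Ω] {μ : Measure Ω}
  [IsProbabilityMeasure μ] {R : Matrix ι ι ℝ} {c₀ : ι → ℝ} {X : ℕ → Ω → ι} {C : ℕ → Ω → ι → ℝ}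

/-- The variance of `|C_n f|` is nonnegative. -/
lemma integral_abs_le_sqrt (h : IsUrnProcess μ R c₀ X C) (hR : R ∈ Matrix.rowStochastic ℝ ι)
    (f : ι → ℝ) (n : ℕ) :
    ∫ ω, |C n ω ⬝ᵥ f| ∂μ ≤ Real.sqrt (∫ ω, (C n ω ⬝ᵥ f) ^ 2 ∂μ) := by
  refine Real.le_sqrt_of_sq_le ?_
  set m := ∫ ω, |C n ω ⬝ᵥ f| ∂μ with hm
  have h1 : Integrable (fun ω => (C n ω ⬝ᵥ f) ^ 2) μ :=
    h.integrable_comp hR (F := fun c => (c ⬝ᵥ f) ^ 2) ((continuous_dotProduct f).pow 2) n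
  have h2 : Integrable (fun ω => |C n ω ⬝ᵥ f|) μ :=
    h.integrable_comp hR (continuous_dotProduct f).abs n
  have h3 : 0 ≤ ∫ ω, ((C n ω ⬝ᵥ f) ^ 2 - 2 * m * |C n ω ⬝ᵥ f| + m ^ 2) ∂μ := by
    refine integral_nonneg fun ω => ?_
    have := sq_nonneg (|C n ω ⬝ᵥ f| - m)
    rw [sub_sq, sq_abs] at this
    change 0 ≤ (C n ω ⬝ᵥ f) ^ 2 - 2 * m * |C n ω ⬝ᵥ f| + m ^ 2
    linarith
  have h4 : Integrable (fun ω => (C n ω ⬝ᵥ f) ^ 2 - 2 * m * |C n ω ⬝ᵥ f|) μ :=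
    h1.sub (h2.const_mul _)
  rw [integral_add h4 (integrable_const _), integral_sub h1 (h2.const_mul _), integral_const_mul, ← hm] at h3
  simp at h3
  linarith

lemma tendsto_integral_abs_div (h : IsUrnProcess μ R c₀ X C) (hR : R ∈ Matrix.rowStochastic ℝ ι)
    {f : ι → ℝ} {r : ℝ} (hr : 0 < r)
    (hf : Tendsto (fun n : ℕ => (∫ ω, (C n ω ⬝ᵥ f) ^ 2 ∂μ) / (n : ℝ) ^ (2 * r)) atTop (𝓝 0)) :
    Tendsto (fun n : ℕ => (∫ ω, |C n ω ⬝ᵥ f| ∂μ) / ((n : ℝ) + 1) ^ r) atTop (𝓝 0) := by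
  have h1 := hf.sqrt
  rw [Real.sqrt_zero] at h1
  refine squeeze_zero' (Eventually.of_forall fun n =>
    div_nonneg (integral_nonneg fun ω => abs_nonneg _) (by positivity)) ?_ h1
  filter_upwards [eventually_gt_atTop 0] with n hn
  have hn' : (0 : ℝ) < n := by exact_mod_cast hn
  have e : Real.sqrt ((n : ℝ) ^ (2 * r)) = (n : ℝ) ^ r := by
    rw [mul_comm, Real.rpow_mul hn'.le]
    norm_num
    exact Real.sqrt_sq (by positivity)
  rw [Real.sqrt_div' _ (by positivity), e]
  have := h.integral_abs_le_sqrt hR f n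
  gcongr
  linarith

end General

variable {Ω : Type*} [MeasurableSpace Ω] {μ : Measure Ω} [IsProbabilityMeasure μ] {s β : ℝ}
  {Q E P : Matrix (Fin 2) (Fin 2) ℝ} {c₀ : Color → ℝ} {X : ℕ → Ω → Color}
  {C : ℕ → Ω → Color → ℝ}

/-- The expected number of balls of the first two colors is of order `n ^ s`. -/
lemma exists_integral_v₁_le (h : IsUrnProcess μ (replacement s Q E P) c₀ X C)
    (hR : replacement s Q E P ∈ Matrix.rowStochastic ℝ Color)
    (hQ : Q ∈ Matrix.rowStochastic ℝ (Fin 2)) (hs0 : 0 < s) :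
    ∃ K, 0 ≤ K ∧ ∀ n : ℕ, ∫ ω, C n ω ⬝ᵥ v₁ ∂μ ≤ K * ((n : ℝ) + 1) ^ s := by
  obtain ⟨K, hK0, hK⟩ := exists_growth_le (show -1 < s by linarith)
  have h0 : 0 ≤ c₀ ⬝ᵥ v₁ :=
    Finset.sum_nonneg fun i _ => mul_nonneg (h.init_mem.1 i) (v₁_nonneg i)
  -- The mean along an eigenvector satisfies the recursion of `growth` exactly.
  have e : ∀ n : ℕ, ∫ ω, C n ω ⬝ᵥ v₁ ∂μ = growth s n * (c₀ ⬝ᵥ v₁) := fun n => by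
    induction n with
    | zero => simp [h.init]
    | succ n ih =>
      rw [h.integral_dotProduct_succ hR, replacement_mulVec_v₁ hQ, growth_succ]
      simp only [dotProduct_smul, smul_eq_mul]
      rw [integral_const_mul, ih]
      ring
  refine ⟨K * (c₀ ⬝ᵥ v₁), by positivity, fun n => ?_⟩
  rw [e]
  calc _ ≤ K * ((n : ℝ) + 1) ^ s * (c₀ ⬝ᵥ v₁) := by gcongr; exact hK n
    _ = _ := by ring

lemma exists_integral_upper_le (h : IsUrnProcess μ (replacement s Q E P) c₀ X C)
    (hR : replacement s Q E P ∈ Matrix.rowStochastic ℝ Color)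
    (hQ : Q ∈ Matrix.rowStochastic ℝ (Fin 2)) (hs0 : 0 < s) {u : Color → ℝ}
    (hu : ∀ j, u (Sum.inr j) = 0) :
    ∃ K, 0 ≤ K ∧ ∀ n : ℕ, ∫ ω, |C n ω ⬝ᵥ u| ∂μ ≤ K * ((n : ℝ) + 1) ^ s := by
  obtain ⟨K, hK0, hK⟩ := h.exists_integral_v₁_le hR hQ hs0
  obtain ⟨L, hL0, hL⟩ := exists_abs_le_v₁ hu
  refine ⟨L * K, by positivity, fun n => ?_⟩
  calc ∫ ω, |C n ω ⬝ᵥ u| ∂μ ≤ ∫ ω, L * (C n ω ⬝ᵥ v₁) ∂μ := by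
        refine integral_mono (h.integrable_comp hR (continuous_dotProduct u).abs n)
          ((h.integrable_comp hR (continuous_dotProduct v₁) n).const_mul _) fun ω => ?_
        refine (h.abs_dotProduct_le_of_abs_le hR hL n ω).trans (le_of_eq ?_)
        rw [dotProduct_smul, smul_eq_mul]
    _ = L * ∫ ω, C n ω ⬝ᵥ v₁ ∂μ := integral_const_mul _ _
    _ ≤ L * (K * ((n : ℝ) + 1) ^ s) := by gcongr; exact hK n
    _ = _ := by ring

lemma exists_integral_upper_div_le (h : IsUrnProcess μ (replacement s Q E P) c₀ X C)
    (hR : replacement s Q E P ∈ Matrix.rowStochastic ℝ Color)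
    (hQ : Q ∈ Matrix.rowStochastic ℝ (Fin 2)) (hs0 : 0 < s) {u : Color → ℝ}
    (hu : ∀ j, u (Sum.inr j) = 0) :
    ∃ K, 0 ≤ K ∧ ∀ n : ℕ, (∫ ω, C n ω ⬝ᵥ u ∂μ) / ((n : ℝ) + 1) ≤ K * ((n : ℝ) + 1) ^ (s - 1) := by
  obtain ⟨K, hK0, hK⟩ := h.exists_integral_upper_le hR hQ hs0 hu
  refine ⟨K, hK0, fun n => ?_⟩
  have hn : (0 : ℝ) < (n : ℝ) + 1 := by positivity
  rw [Real.rpow_sub_one hn.ne', ← mul_div_assoc]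
  gcongr
  exact (integral_mono (h.integrable_comp hR (continuous_dotProduct u) n)
    (h.integrable_comp hR (continuous_dotProduct u).abs n) fun ω => le_abs_self _).trans (hK n)

lemma _root_.FourColorUrn.tendsto_add_one_rpow_neg {p : ℝ} (hp : p < 0) :
    Tendsto (fun n : ℕ => ((n : ℝ) + 1) ^ p) atTop (𝓝 0) := by
  have h1 : Tendsto (fun n : ℕ => (n : ℝ) + 1) atTop atTop :=
    tendsto_atTop_add_const_right _ _ tendsto_natCast_atTop_atTop
  have := (tendsto_rpow_neg_atTop (y := -p) (by linarith)).comp h1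
  simpa [Function.comp_def] using this

/-- An eigenvector for `β < 1/2` supported on the first two colors is negligible at scale `√n`. -/
lemma tendsto_integral_abs_eigenvector (h : IsUrnProcess μ (replacement s Q E P) c₀ X C)
    (hR : replacement s Q E P ∈ Matrix.rowStochastic ℝ Color)
    (hQ : Q ∈ Matrix.rowStochastic ℝ (Fin 2)) (hs0 : 0 < s) (hs1 : s < 1) (hβ2 : β < 1 / 2)
    {u : Color → ℝ} (hu : ∀ j, u (Sum.inr j) = 0) (hRu : replacement s Q E P *ᵥ u = β • u) :
    Tendsto (fun n : ℕ => (∫ ω, |C n ω ⬝ᵥ u| ∂μ) / ((n : ℝ) + 1) ^ (1 / 2 : ℝ)) atTop (𝓝 0) := by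
  -- The squared increments also live on the first two colors, so the forcing term is `O(n ^ (s -
  -- 1))` rather than `O(1)`; this makes the second moment `o(n)`.
  have hu2 : ∀ j, (fun i => (replacement s Q E P *ᵥ u) i ^ 2) (Sum.inr j) = 0 := fun j => by
    simp [hRu, hu]
  obtain ⟨K, hK0, hK⟩ := h.exists_integral_upper_div_le hR hQ hs0
    (u := fun i => (replacement s Q E P *ᵥ u) i ^ 2) hu2
  refine h.tendsto_integral_abs_div hR (by norm_num) ?_
  have h1 : (2 * (1 / 2) : ℝ) = 1 := by norm_num
  rw [h1]
  refine tendsto_div_rpow_of_le_recursion (q := 2 * β)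
    (r := fun n : ℕ => K * ((n : ℝ) + 1) ^ (s - 1)) one_pos (by linarith)
    (fun n => integral_nonneg fun ω => sq_nonneg _) (fun n => ?_) ?_
  · rw [h.integral_sq_dotProduct_succ hR]
    refine le_trans (le_of_eq ?_) (add_le_add le_rfl (hK n))
    have i1 : Integrable (fun ω => (C n ω ⬝ᵥ u) ^ 2) μ :=
      h.integrable_comp hR (F := fun c => (c ⬝ᵥ u) ^ 2) ((continuous_dotProduct u).pow 2) n
    rw [← integral_const_mul, ← integral_div,
      ← integral_add (i1.const_mul _) ((h.integrable_comp hR (continuous_dotProduct _) n).div_const _)]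
    refine integral_congr_ae (ae_of_all _ fun ω => ?_)
    simp only [hRu, dotProduct_smul, smul_eq_mul]
    ring
  · simpa using (tendsto_add_one_rpow_neg (show s - 1 < 0 by linarith)).const_mul K

/-- A vector supported on the last two colors and orthogonal to `π_P` is negligible at scale
`n`. -/
lemma tendsto_integral_abs_lower (h : IsUrnProcess μ (replacement s Q E P) c₀ X C)
    (hR : replacement s Q E P ∈ Matrix.rowStochastic ℝ Color)
    (hQ : Q ∈ Matrix.rowStochastic ℝ (Fin 2)) (hs0 : 0 < s) (hs1 : s < 1) (hβ1 : β < 1)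
    {g : Fin 2 → ℝ} (hg : P *ᵥ g = β • g) :
    Tendsto (fun n : ℕ => (∫ ω, |C n ω ⬝ᵥ Sum.elim 0 g| ∂μ) / ((n : ℝ) + 1)) atTop (𝓝 0) := by
  set R := replacement s Q E P with hRdef
  set w : Color → ℝ := Sum.elim 0 g with hw
  set e : Color → ℝ := Sum.elim (E *ᵥ g) 0 with he
  have hRw : R *ᵥ w = e + β • w := by
    rw [hw, replacement_mulVec, hg, mulVec_zero, smul_zero, zero_add]
    ext i; rcases i with i | i <;> simp [he]
  obtain ⟨K, hK0, hK⟩ := h.exists_integral_upper_le hR hQ hs0 (u := e) fun j => by simp [he]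
  obtain ⟨B, hB⟩ : ∃ B, ∀ i, |w i| ≤ B := by
    obtain ⟨B, hB⟩ := (Set.finite_range fun i => |w i|).bddAbove
    exact ⟨B, fun i => hB ⟨i, rfl⟩⟩
  have hB0 : 0 ≤ B := (abs_nonneg _).trans (hB (Sum.inl 0))
  obtain ⟨B', hB'⟩ : ∃ B, ∀ i, |(R *ᵥ w) i ^ 2| ≤ B := by
    obtain ⟨B, hB⟩ := (Set.finite_range fun i => |(R *ᵥ w) i ^ 2|).bddAbove
    exact ⟨B, fun i => hB ⟨i, rfl⟩⟩
  have main := h.tendsto_integral_abs_div hR (f := w) (r := 1) one_pos (by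
    -- In the second moment recursion the cross term is controlled by `|C_n w| ≤ B (n + 1)` and
    -- `E|C_n e| = O(n ^ s)`, so the forcing term is `o(n)`; as `2β < 2`, the second moment is
    -- `o(n²)`.
    refine tendsto_div_rpow_of_le_recursion (q := 2 * β)
      (r := fun n : ℕ => 2 * B * K * ((n : ℝ) + 1) ^ s + B') (by norm_num) (by linarith)
      (fun n => integral_nonneg fun ω => sq_nonneg _) (fun n => ?_) ?_
    · rw [h.integral_sq_dotProduct_succ hR]
      have hn : (0 : ℝ) < (n : ℝ) + 1 := by positivity
      have i1 : Integrable (fun ω => (C n ω ⬝ᵥ w) ^ 2) μ :=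
        h.integrable_comp hR (F := fun c => (c ⬝ᵥ w) ^ 2) ((continuous_dotProduct w).pow 2) n
      have i2 : Integrable (fun ω => |C n ω ⬝ᵥ e|) μ :=
        h.integrable_comp hR (continuous_dotProduct e).abs n
      have i3 : Integrable (fun ω => (1 + 2 * β / ((n : ℝ) + 1)) * (C n ω ⬝ᵥ w) ^ 2
          + 2 * B * |C n ω ⬝ᵥ e|) μ := (i1.const_mul _).add (i2.const_mul _)
      calc _ ≤ ∫ ω, ((1 + 2 * β / ((n : ℝ) + 1)) * (C n ω ⬝ᵥ w) ^ 2
            + 2 * B * |C n ω ⬝ᵥ e| + B') ∂μ := by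
            refine integral_mono ?_ (i3.add (integrable_const _)) fun ω => ?_
            · refine h.integrable_comp hR (F := fun c => (c ⬝ᵥ w) ^ 2
                + 2 * (c ⬝ᵥ w) * (c ⬝ᵥ (R *ᵥ w)) / ((n : ℝ) + 1)
                + (c ⬝ᵥ fun i => (R *ᵥ w) i ^ 2) / ((n : ℝ) + 1)) ?_ n
              have c1 := continuous_dotProduct w
              have c2 := continuous_dotProduct (R *ᵥ w)
              have c3 := continuous_dotProduct fun i => (R *ᵥ w) i ^ 2
              fun_prop
            · have b1 : (C n ω ⬝ᵥ fun i => (R *ᵥ w) i ^ 2) / ((n : ℝ) + 1) ≤ B' := by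
                rw [div_le_iff₀ hn]
                exact (le_abs_self _).trans (h.abs_dotProduct_le hR hB' n ω)
              have b2 : (C n ω ⬝ᵥ w) * (C n ω ⬝ᵥ e) / ((n : ℝ) + 1) ≤ B * |C n ω ⬝ᵥ e| := by
                rw [div_le_iff₀ hn]
                refine (le_abs_self _).trans ?_
                rw [abs_mul]
                have := mul_le_mul_of_nonneg_right (h.abs_dotProduct_le hR hB n ω)
                  (abs_nonneg (C n ω ⬝ᵥ e))
                linarith
              have b3 : 2 * (C n ω ⬝ᵥ w) * (C n ω ⬝ᵥ (R *ᵥ w)) / ((n : ℝ) + 1)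
                  = 2 * ((C n ω ⬝ᵥ w) * (C n ω ⬝ᵥ e) / ((n : ℝ) + 1))
                    + 2 * β / ((n : ℝ) + 1) * (C n ω ⬝ᵥ w) ^ 2 := by
                rw [hRw, dotProduct_add, dotProduct_smul, smul_eq_mul]; ring
              simp only [b3]
              linarith
        _ = (1 + 2 * β / ((n : ℝ) + 1)) * ∫ ω, (C n ω ⬝ᵥ w) ^ 2 ∂μ
            + 2 * B * ∫ ω, |C n ω ⬝ᵥ e| ∂μ + B' := by
            rw [integral_add i3 (integrable_const _),
              integral_add (i1.const_mul _) (i2.const_mul _), integral_const_mul,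
              integral_const_mul]
            simp
        _ ≤ _ := by
            have := mul_le_mul_of_nonneg_left (hK n) (show 0 ≤ 2 * B by linarith)
            linarith
    · have t1 := (tendsto_add_one_rpow_neg (show s - 1 < 0 by linarith)).const_mul (2 * B * K)
      have t2 := (tendsto_add_one_rpow_neg (show (-1 : ℝ) < 0 by norm_num)).const_mul B'
      have t3 := t1.add t2
      simp only [mul_zero, add_zero] at t3
      refine t3.congr fun n => ?_
      have hn : (0 : ℝ) < (n : ℝ) + 1 := by positivity
      rw [Real.rpow_sub_one hn.ne', Real.rpow_neg_one]
      norm_num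
      field_simp)
  simpa using main

/-- Law of large numbers: the proportions of the colors converge to `(0, 0, π_P)`. -/
lemma tendsto_integral_abs_proportion (h : IsUrnProcess μ (replacement s Q E P) c₀ X C)
    (hR : replacement s Q E P ∈ Matrix.rowStochastic ℝ Color)
    (hQ : Q ∈ Matrix.rowStochastic ℝ (Fin 2)) (hP : P ∈ Matrix.rowStochastic ℝ (Fin 2))
    (hs0 : 0 < s) (hs1 : s < 1) (hβ : β = 1 - P 0 1 - P 1 0) (hβ1 : β < 1)
    {π : Fin 2 → ℝ} (hπ : IsStationaryDistribution P π) (f : Color → ℝ) :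
    Tendsto (fun n : ℕ => ∫ ω, |(C n ω ⬝ᵥ f) / ((n : ℝ) + 1) - π ⬝ᵥ fun j => f (Sum.inr j)| ∂μ)
      atTop (𝓝 0) := by
  set c := π ⬝ᵥ fun j => f (Sum.inr j) with hc
  -- Decomposition `f = c 1 + a + (0, g)`: the constant part contributes exactly `c`, `a` sees only
  -- the vanishing first two colors, and `g` is orthogonal to `π`.
  set g : Fin 2 → ℝ := fun j => f (Sum.inr j) - c with hg
  set a : Color → ℝ := Sum.elim (fun j => f (Sum.inl j) - c) 0 with ha
  have hsum : π 0 + π 1 = 1 := by simpa [Fin.sum_univ_two] using hπ.1.2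
  have hg0 : π ⬝ᵥ g = 0 := by
    have hc' := hc
    simp only [hg, dotProduct, Fin.sum_univ_two] at hc' ⊢
    linear_combination -c * hsum - hc'
  have hgP : P *ᵥ g = β • g := by
    rw [hβ]; exact mulVec_eq_of_dotProduct_eq_zero hP hπ hg0
  have l1 := h.tendsto_integral_abs_lower hR hQ hs0 hs1 hβ1 hgP
  obtain ⟨K, hK0, hK⟩ := h.exists_integral_upper_le hR hQ hs0 (u := a) fun j => by simp [ha]
  have l2 : Tendsto (fun n : ℕ => (∫ ω, |C n ω ⬝ᵥ a| ∂μ) / ((n : ℝ) + 1)) atTop (𝓝 0) := by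
    refine squeeze_zero (fun n => div_nonneg (integral_nonneg fun ω => abs_nonneg _)
      (by positivity)) (fun n => ?_)
      (by simpa using (tendsto_add_one_rpow_neg (show s - 1 < 0 by linarith)).const_mul K)
    have hn : (0 : ℝ) < (n : ℝ) + 1 := by positivity
    rw [Real.rpow_sub_one hn.ne', ← mul_div_assoc]
    gcongr
    exact hK n
  have l3 := l2.add l1
  rw [add_zero] at l3
  refine squeeze_zero (fun n => integral_nonneg fun ω => abs_nonneg _) (fun n => ?_) l3
  have hn : (0 : ℝ) < (n : ℝ) + 1 := by positivity
  have i1 : Integrable (fun ω => |C n ω ⬝ᵥ a|) μ :=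
    h.integrable_comp hR (continuous_dotProduct a).abs n
  have i2 : Integrable (fun ω => |C n ω ⬝ᵥ Sum.elim 0 g|) μ :=
    h.integrable_comp hR (continuous_dotProduct _).abs n
  rw [← integral_div, ← integral_div, ← integral_add (i1.div_const _) (i2.div_const _)]
  refine integral_mono ?_ ((i1.div_const _).add (i2.div_const _)) fun ω => ?_
  · refine h.integrable_comp hR (F := fun x => |(x ⬝ᵥ f) / ((n : ℝ) + 1) - c|) ?_ n
    exact (((continuous_dotProduct f).div_const _).sub continuous_const).abs
  · have e : (C n ω ⬝ᵥ f) / ((n : ℝ) + 1) - c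
        = (C n ω ⬝ᵥ a) / ((n : ℝ) + 1) + (C n ω ⬝ᵥ Sum.elim 0 g) / ((n : ℝ) + 1) := by
      have hS := h.sum_eq hR n ω
      rw [← add_div, ← dotProduct_add, eq_div_iff hn.ne', sub_mul, div_mul_cancel₀ _ hn.ne', ← hS]
      simp only [dotProduct, Finset.mul_sum, ← Finset.sum_sub_distrib]
      refine Finset.sum_congr rfl fun i _ => ?_
      rcases i with i | i <;> simp [ha, hg] <;> ring
    change |(C n ω ⬝ᵥ f) / ((n : ℝ) + 1) - c| ≤ |C n ω ⬝ᵥ a| / ((n : ℝ) + 1)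
      + |C n ω ⬝ᵥ Sum.elim 0 g| / ((n : ℝ) + 1)
    rw [e]
    refine (abs_add_le _ _).trans (le_of_eq ?_)
    rw [abs_div, abs_div, abs_of_pos hn]

/-- The conditional variances of the increments along `t` converge to `β² π_P ν²`. -/
lemma tendsto_integral_abs_variance (h : IsUrnProcess μ (replacement s Q E P) c₀ X C)
    (hR : replacement s Q E P ∈ Matrix.rowStochastic ℝ Color)
    (hQ : Q ∈ Matrix.rowStochastic ℝ (Fin 2)) (hP : P ∈ Matrix.rowStochastic ℝ (Fin 2))
    (hs0 : 0 < s) (hs1 : s < 1) (hβ : β = 1 - P 0 1 - P 1 0) (hβ1 : β < 1)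
    {π : Fin 2 → ℝ} (hπ : IsStationaryDistribution P π) {t : Color → ℝ}
    (ht : π ⬝ᵥ (fun j => t (Sum.inr j)) = 0) :
    Tendsto (fun n : ℕ => ∫ ω, |∑ i, C n ω i / ((n : ℝ) + 1)
          * ((replacement s Q E P *ᵥ t) i - β * (C n ω ⬝ᵥ t) / ((n : ℝ) + 1)) ^ 2
          - π ⬝ᵥ fun j => (replacement s Q E P *ᵥ t) (Sum.inr j) ^ 2| ∂μ) atTop (𝓝 0) := by
  set R := replacement s Q E P with hRdef
  set τ := π ⬝ᵥ fun j => (R *ᵥ t) (Sum.inr j) ^ 2 with hτ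
  obtain ⟨B₁, hB₁⟩ : ∃ B, ∀ i, |(R *ᵥ t) i| ≤ B := by
    obtain ⟨B, hB⟩ := (Set.finite_range fun i => |(R *ᵥ t) i|).bddAbove
    exact ⟨B, fun i => hB ⟨i, rfl⟩⟩
  obtain ⟨B₂, hB₂⟩ : ∃ B, ∀ i, |t i| ≤ B := by
    obtain ⟨B, hB⟩ := (Set.finite_range fun i => |t i|).bddAbove
    exact ⟨B, fun i => hB ⟨i, rfl⟩⟩
  have l1 := h.tendsto_integral_abs_proportion hR hQ hP hs0 hs1 hβ hβ1 hπ
    (fun i => (R *ᵥ t) i ^ 2)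
  have l2 := h.tendsto_integral_abs_proportion hR hQ hP hs0 hs1 hβ hβ1 hπ t
  rw [ht] at l2
  have l3 := l1.add (l2.const_mul (2 * |β| * B₁ + β ^ 2 * B₂))
  simp only [mul_zero, add_zero, sub_zero] at l3
  refine squeeze_zero (fun n => integral_nonneg fun ω => abs_nonneg _) (fun n => ?_) l3
  have hn : (0 : ℝ) < (n : ℝ) + 1 := by positivity
  have i1 : Integrable (fun ω => |(C n ω ⬝ᵥ fun i => (R *ᵥ t) i ^ 2) / ((n : ℝ) + 1) - τ|) μ := by
    refine h.integrable_comp hR (F := fun c => |(c ⬝ᵥ fun i => (R *ᵥ t) i ^ 2) / ((n : ℝ) + 1)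
      - τ|) ?_ n
    exact (((continuous_dotProduct _).div_const _).sub continuous_const).abs
  have i2 : Integrable (fun ω => |(C n ω ⬝ᵥ t) / ((n : ℝ) + 1)|) μ :=
    h.integrable_comp hR ((continuous_dotProduct t).div_const _).abs n
  rw [← integral_const_mul, ← integral_add i1 (i2.const_mul _)]
  refine integral_mono ?_ (i1.add (i2.const_mul _)) fun ω => ?_
  · refine h.integrable_comp hR (F := fun c => |∑ i, c i / ((n : ℝ) + 1)
          * ((R *ᵥ t) i - β * (c ⬝ᵥ t) / ((n : ℝ) + 1)) ^ 2 - τ|) ?_ n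
    have := continuous_dotProduct t
    fun_prop
  · set y := (C n ω ⬝ᵥ t) / ((n : ℝ) + 1) with hy
    set z := (C n ω ⬝ᵥ (R *ᵥ t)) / ((n : ℝ) + 1) with hz
    have e : ∀ i, C n ω i / ((n : ℝ) + 1) * ((R *ᵥ t) i - β * (C n ω ⬝ᵥ t) / ((n : ℝ) + 1)) ^ 2
        = C n ω i / ((n : ℝ) + 1) * (fun i => (R *ᵥ t) i ^ 2) i
          - 2 * (β * y) * (C n ω i / ((n : ℝ) + 1) * (R *ᵥ t) i)
          + C n ω i / ((n : ℝ) + 1) * (β * y) ^ 2 := fun i => by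
      rw [mul_div_assoc β, ← hy]; ring
    have hyB : |y| ≤ B₂ := by
      rw [hy, abs_div, abs_of_pos hn, div_le_iff₀ hn]
      exact h.abs_dotProduct_le hR hB₂ n ω
    have hzB : |z| ≤ B₁ := by
      rw [hz, abs_div, abs_of_pos hn, div_le_iff₀ hn]
      exact h.abs_dotProduct_le hR hB₁ n ω
    -- Expanding the square leaves these two terms; both carry a factor `y`, which tends to `0` in
    -- `L¹` because `π` annihilates the lower part of `t`.
    have hb : |-(2 * β * z * y) + β ^ 2 * y * y| ≤ (2 * |β| * B₁ + β ^ 2 * B₂) * |y| := by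
      refine (abs_add_le _ _).trans ?_
      rw [abs_neg, abs_mul, abs_mul, abs_mul, abs_mul, abs_mul, abs_two, abs_of_nonneg (sq_nonneg β),
        add_mul]
      gcongr
    simp only [e, Finset.sum_add_distrib, Finset.sum_sub_distrib, ← Finset.mul_sum,
      ← Finset.sum_mul, sum_div_mul, h.sum_div_eq_one hR, one_mul, ← hz]
    refine le_trans (le_of_eq ?_) ((abs_add_le _ _).trans (add_le_add le_rfl hb))
    congr 1
    ring

/-- The central limit theorem along a generalized eigenvector. -/
lemma tendstoInDistribution_generalized_eigenvector
    (h : IsUrnProcess μ (replacement s Q E P) c₀ X C)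
    (hR : replacement s Q E P ∈ Matrix.rowStochastic ℝ Color)
    (hQ : Q ∈ Matrix.rowStochastic ℝ (Fin 2)) (hP : P ∈ Matrix.rowStochastic ℝ (Fin 2))
    (hs0 : 0 < s) (hs1 : s < 1) (hβ : β = 1 - P 0 1 - P 1 0) (hβ0 : -1 < β) (hβ2 : β < 1 / 2)
    {π : Fin 2 → ℝ} (hπ : IsStationaryDistribution P π) {u t : Color → ℝ}
    (hu : ∀ j, u (Sum.inr j) = 0) (hRu : replacement s Q E P *ᵥ u = β • u)
    (hRt : replacement s Q E P *ᵥ t = u + β • t)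
    (ht : π ⬝ᵥ (fun j => t (Sum.inr j)) = 0) :
    TendstoInDistribution (fun (n : ℕ) ω => (C n ω ⬝ᵥ t) / Real.sqrt n) atTop
      (id : ℝ → ℝ) (fun _ => μ) (gaussianReal 0
        (β ^ 2 / (1 - 2 * β) * (π ⬝ᵥ fun j => t (Sum.inr j) ^ 2)).toNNReal) := by
  set R := replacement s Q E P with hRdef
  have hτ0 : 0 ≤ π ⬝ᵥ fun j => t (Sum.inr j) ^ 2 :=
    Finset.sum_nonneg fun j _ => mul_nonneg (hπ.1.1 j) (sq_nonneg _)
  set τ := π ⬝ᵥ fun j => (R *ᵥ t) (Sum.inr j) ^ 2 with hτ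
  -- On the last two colors `u` vanishes, so `R t` is `β t` there.
  have hτe : τ = β ^ 2 * (π ⬝ᵥ fun j => t (Sum.inr j) ^ 2) := by
    simp only [hτ, hRt, Pi.add_apply, hu, zero_add, Pi.smul_apply, smul_eq_mul, dotProduct,
      Finset.mul_sum]
    exact Finset.sum_congr rfl fun j _ => by ring
  obtain ⟨B₁, hB₁⟩ : ∃ B, ∀ i, |(R *ᵥ t) i| ≤ B := by
    obtain ⟨B, hB⟩ := (Set.finite_range fun i => |(R *ᵥ t) i|).bddAbove
    exact ⟨B, fun i => hB ⟨i, rfl⟩⟩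
  obtain ⟨B₂, hB₂⟩ : ∃ B, ∀ i, |t i| ≤ B := by
    obtain ⟨B, hB⟩ := (Set.finite_range fun i => |t i|).bddAbove
    exact ⟨B, fun i => hB ⟨i, rfl⟩⟩
  have key := h.tendsto_integral_exp hR (B := B₁ + |β| * B₂) (τ := τ) hβ0 hβ2
    (by rw [hτe]; positivity) hRt (fun n ω i => by
      have hn : (0 : ℝ) < (n : ℝ) + 1 := by positivity
      refine (abs_sub _ _).trans (add_le_add (hB₁ i) ?_)
      rw [mul_div_assoc, abs_mul]
      gcongr
      rw [abs_div, abs_of_pos hn, div_le_iff₀ hn]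
      exact h.abs_dotProduct_le hR hB₂ n ω)
    (h.tendsto_integral_abs_eigenvector hR hQ hs0 hs1 hβ2 hu hRu)
    (h.tendsto_integral_abs_variance hR hQ hP hs0 hs1 hβ (by linarith) hπ ht)
  have hmeas : ∀ n : ℕ, AEMeasurable (fun ω => (C n ω ⬝ᵥ t) / Real.sqrt n) μ := fun n =>
    (((continuous_dotProduct t).measurable.comp (h.measurable n)).div_const _).aemeasurable
  -- Lévy's continuity theorem; a vanishing variance needs no separate treatment.
  refine ⟨hmeas, aemeasurable_id, ProbabilityMeasure.tendsto_iff_tendsto_charFun.2 fun x => ?_⟩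
  simp only [ProbabilityMeasure.coe_mk, Measure.map_id]
  rw [charFun_gaussianReal]
  have hv : 0 ≤ β ^ 2 / (1 - 2 * β) * (π ⬝ᵥ fun j => t (Sum.inr j) ^ 2) :=
    mul_nonneg (div_nonneg (sq_nonneg _) (by linarith)) hτ0
  have elim : Complex.exp (x * ((0 : ℝ) : ℂ) * Complex.I
      - (((β ^ 2 / (1 - 2 * β) * (π ⬝ᵥ fun j => t (Sum.inr j) ^ 2)).toNNReal : ℝ) : ℂ)
        * (x : ℂ) ^ 2 / 2) = ((Real.exp (-((1 - 2 * β)⁻¹ * (x ^ 2 * τ / 2))) : ℝ) : ℂ) := by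
    rw [Real.coe_toNNReal _ hv, hτe]
    push_cast
    congr 1
    ring
  have goal_eq : ∀ n : ℕ, charFun (μ.map fun ω => (C n ω ⬝ᵥ t) / Real.sqrt n) x
      = ∫ ω, Complex.exp (Complex.I * ((x * ((C n ω ⬝ᵥ t) / Real.sqrt n) : ℝ) : ℂ)) ∂μ := fun n => by
    rw [charFun_apply_real, integral_map (hmeas n) (by fun_prop)]
    refine integral_congr_ae (ae_of_all _ fun ω => ?_)
    simp only
    congr 1
    push_cast
    ring
  simp only [goal_eq]
  rw [elim]
  exact key x

end IsUrnProcess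

end FourColorUrn

/-! ### Change of normalization and the Jordan basis. -/

namespace FourColorUrn

lemma TendstoASL2.div_rpow_of_growth {Ω : Type*} [MeasurableSpace Ω] {μ : Measure Ω}
    {Y : ℕ → Ω → ℝ} {W : Ω → ℝ} {β : ℝ} (hβ : -1 < β) (hY : ∀ n, MemLp (Y n) 2 μ)
    (h : TendstoASL2 μ (fun n ω => (growth β n)⁻¹ * Y n ω) W) :
    TendstoASL2 μ (fun n ω => Y n ω / (n : ℝ) ^ β) (fun ω => (Real.Gamma (β + 1))⁻¹ * W ω) := by
  refine (h.mul_tendsto (fun n => (hY n).const_mul _) (tendsto_growth_div hβ)).congr'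
    (Eventually.of_forall fun n ω => ?_)
  have := growth_pos hβ n
  field_simp

/-- The block triangular matrix with columns `(a, 0)`, `(b, 0)`, `w`, `1`. -/
def columnMatrix (a b : Fin 2 → ℝ) (w : Color → ℝ) : Matrix Color Color ℝ :=
  Matrix.fromBlocks !![a 0, b 0; a 1, b 1] !![w (Sum.inl 0), 1; w (Sum.inl 1), 1] 0
    !![w (Sum.inr 0), 1; w (Sum.inr 1), 1]

lemma isUnit_det_columnMatrix {a b : Fin 2 → ℝ} {w : Color → ℝ}
    (hab : a 0 * b 1 - b 0 * a 1 ≠ 0) (hw : w (Sum.inr 0) ≠ w (Sum.inr 1)) :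
    IsUnit (columnMatrix a b w).det := by
  rw [columnMatrix, det_fromBlocks_zero₂₁, det_fin_two_of, det_fin_two_of, isUnit_iff_ne_zero]
  refine mul_ne_zero hab ?_
  rw [mul_one, one_mul]
  exact sub_ne_zero.2 hw

lemma columnMatrix_col (a b : Fin 2 → ℝ) (w : Color → ℝ) :
    (fun i => columnMatrix a b w i (Sum.inl 0)) = Sum.elim a 0 ∧
    (fun i => columnMatrix a b w i (Sum.inl 1)) = Sum.elim b 0 ∧
    (fun i => columnMatrix a b w i (Sum.inr 0)) = w ∧
    (fun i => columnMatrix a b w i (Sum.inr 1)) = 1 := by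
  refine ⟨?_, ?_, ?_, ?_⟩ <;>
  · ext i
    rcases i with i | i <;> fin_cases i <;> simp [columnMatrix]

/-- Matrix equations `R T = T M` for a matrix `T` with prescribed columns. -/
lemma mul_columnMatrix_eq {R M : Matrix Color Color ℝ} {a b : Fin 2 → ℝ} {w : Color → ℝ}
    (ha : R *ᵥ Sum.elim a 0 = fun i => (columnMatrix a b w * M) i (Sum.inl 0))
    (hb : R *ᵥ Sum.elim b 0 = fun i => (columnMatrix a b w * M) i (Sum.inl 1))
    (hw : R *ᵥ w = fun i => (columnMatrix a b w * M) i (Sum.inr 0))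
    (h1 : R *ᵥ 1 = fun i => (columnMatrix a b w * M) i (Sum.inr 1)) :
    R * columnMatrix a b w = columnMatrix a b w * M := by
  obtain ⟨ea, eb, ew, e1⟩ := columnMatrix_col a b w
  ext i j
  have hR : (R * columnMatrix a b w) i j = (R *ᵥ fun k => columnMatrix a b w k j) i := rfl
  rw [hR]
  rcases j with j | j <;> fin_cases j
  · exact (congrArg (fun v => (R *ᵥ v) i) ea).trans (congrFun ha i)
  · exact (congrArg (fun v => (R *ᵥ v) i) eb).trans (congrFun hb i)
  · exact (congrArg (fun v => (R *ᵥ v) i) ew).trans (congrFun hw i)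
  · exact (congrArg (fun v => (R *ᵥ v) i) e1).trans (congrFun h1 i)

lemma isDiagonalizable_of_columns {R : Matrix Color Color ℝ} {a b : Fin 2 → ℝ} {w : Color → ℝ}
    {x y β : ℝ} (hab : a 0 * b 1 - b 0 * a 1 ≠ 0) (hw0 : w (Sum.inr 0) ≠ w (Sum.inr 1))
    (ha : R *ᵥ Sum.elim a 0 = x • Sum.elim a 0) (hb : R *ᵥ Sum.elim b 0 = y • Sum.elim b 0)
    (hw : R *ᵥ w = β • w) (h1 : R *ᵥ 1 = 1) : IsDiagonalizable R := by
  obtain ⟨ea, eb, ew, e1⟩ := columnMatrix_col a b w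
  refine ⟨columnMatrix a b w, Sum.elim ![x, y] ![β, 1], isUnit_det_columnMatrix hab hw0,
    mul_columnMatrix_eq ?_ ?_ ?_ ?_⟩
  · rw [ha, ← ea]; ext i; simp [mul_comm]
  · rw [hb, ← eb]; ext i; simp [mul_comm]
  · rw [hw]; nth_rewrite 1 [← ew]; ext i; simp [mul_comm]
  · rw [h1, ← e1]; ext i; simp

lemma exists_jordanMatrix_of_columns {R : Matrix Color Color ℝ} {a b : Fin 2 → ℝ} {w : Color → ℝ}
    {α β : ℝ} (hab : a 0 * b 1 - b 0 * a 1 ≠ 0) (hw0 : w (Sum.inr 0) ≠ w (Sum.inr 1))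
    (ha : R *ᵥ Sum.elim a 0 = α • Sum.elim a 0) (hb : R *ᵥ Sum.elim b 0 = β • Sum.elim b 0)
    (hw : R *ᵥ w = Sum.elim b 0 + β • w) (h1 : R *ᵥ 1 = 1) :
    IsUnit (columnMatrix a b w).det ∧
      R * columnMatrix a b w = columnMatrix a b w * jordanMatrix α β ∧
      (fun i => columnMatrix a b w i (Sum.inl 1)) = Sum.elim b 0 := by
  obtain ⟨ea, eb, ew, e1⟩ := columnMatrix_col a b w
  refine ⟨isUnit_det_columnMatrix hab hw0, mul_columnMatrix_eq ?_ ?_ ?_ ?_, eb⟩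
  · rw [ha, ← ea]; ext i
    simp [mul_apply, jordanMatrix, Fintype.sum_sum_type, Fin.sum_univ_two, mul_comm]
  · rw [hb, ← eb]; ext i
    simp [mul_apply, jordanMatrix, Fintype.sum_sum_type, Fin.sum_univ_two, mul_comm]
  · have e : ∀ i, columnMatrix a b w i (Sum.inr 0) = w i := congrFun ew
    rw [hw, ← eb]; ext i
    simp [mul_apply, jordanMatrix, Fintype.sum_sum_type, Fin.sum_univ_two, mul_comm, e]
  · rw [h1, ← e1]; ext i
    simp [mul_apply, jordanMatrix, Fintype.sum_sum_type, Fin.sum_univ_two]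

lemma replacement_mulVec_v₂ {s lam : ℝ} {Q : Matrix (Fin 2) (Fin 2) ℝ} {ξ : Fin 2 → ℝ}
    (hξ : Q *ᵥ ξ = lam • ξ) (E P : Matrix (Fin 2) (Fin 2) ℝ) :
    replacement s Q E P *ᵥ v₂ ξ = (s * lam) • v₂ ξ := by
  have h0 : (fun _ => 0 : Fin 2 → ℝ) = 0 := rfl
  rw [v₂, replacement_mulVec, hξ, h0, mulVec_zero, mulVec_zero, add_zero]
  ext i; rcases i with i | i <;> simp [mul_assoc]

/-- The repeated eigenvalue and the Jordan basis of a non-diagonalizable replacement matrix. -/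
lemma exists_isJordanBasis {s lam β : ℝ} {Q E P : Matrix (Fin 2) (Fin 2) ℝ} (hs0 : 0 < s)
    (hQ : Q ∈ Matrix.rowStochastic ℝ (Fin 2))
    (hR : replacement s Q E P ∈ Matrix.rowStochastic ℝ Color) (hlam : lam ≠ 1) {ξ n : Fin 2 → ℝ}
    (hξ : Q *ᵥ ξ = lam • ξ) (hξ0 : ξ 0 ≠ ξ 1) (hn : P *ᵥ n = β • n) (hn0 : n 0 ≠ n 1)
    (hdiag : ¬ IsDiagonalizable (replacement s Q E P)) :
    (β = s ∨ β = s * lam) ∧ ∃ T, IsJordanBasis (replacement s Q E P) s lam β ξ T := by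
  set R := replacement s Q E P with hRdef
  have hv1 : (v₁ : Color → ℝ) = Sum.elim (fun _ => 1) 0 := rfl
  have hv2 : v₂ ξ = Sum.elim ξ 0 := rfl
  have hR1 := replacement_mulVec_v₁ (s := s) hQ E P
  have hR2 := replacement_mulVec_v₂ (s := s) hξ E P
  rw [← hRdef, hv1] at hR1
  rw [← hRdef, hv2] at hR2
  have hone : R *ᵥ 1 = 1 := hR.2
  have hne : s * lam ≠ s := fun h => hlam (mul_left_cancel₀ hs0.ne' (h.trans (mul_one s).symm))
  have hξd : ξ 0 - ξ 1 ≠ 0 := sub_ne_zero.2 hξ0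
  -- Coordinates of `E n` in the basis `1, ξ` of eigenvectors of `Q`.
  obtain ⟨x, y, hxy⟩ : ∃ x y : ℝ, E *ᵥ n = x • (fun _ => 1) + y • ξ := by
    refine ⟨(E *ᵥ n) 0 - ((E *ᵥ n) 0 - (E *ᵥ n) 1) / (ξ 0 - ξ 1) * ξ 0,
      ((E *ᵥ n) 0 - (E *ᵥ n) 1) / (ξ 0 - ξ 1), ?_⟩
    ext i
    fin_cases i <;> simp only [Fin.zero_eta, Fin.mk_one, Pi.add_apply, Pi.smul_apply, smul_eq_mul]
    · ring
    · field_simp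
      ring
  have hRw : ∀ c d : ℝ, R *ᵥ Sum.elim (c • (fun _ => 1) + d • ξ) n
      = ((s - β) * c + x) • Sum.elim (fun _ => 1) 0 + ((s * lam - β) * d + y) • Sum.elim ξ 0
        + β • Sum.elim (c • (fun _ => 1) + d • ξ) n := fun c d => by
    have h1 : Q *ᵥ (fun _ => 1) = fun _ => 1 := hQ.2
    rw [hRdef, replacement_mulVec, mulVec_add, mulVec_smul, mulVec_smul, h1, hξ, hn, hxy]
    ext i
    rcases i with i | i
    · simp only [Sum.elim_inl, Pi.add_apply, Pi.smul_apply, smul_eq_mul]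
      ring
    · simp
  have hab1 : (fun _ => 1 : Fin 2 → ℝ) 0 * ξ 1 - ξ 0 * (fun _ => 1 : Fin 2 → ℝ) 1 ≠ 0 := by
    simpa using sub_ne_zero.2 hξ0.symm
  have hab2 : ξ 0 * (fun _ => 1 : Fin 2 → ℝ) 1 - (fun _ => 1 : Fin 2 → ℝ) 0 * ξ 1 ≠ 0 := by
    simpa using hξd
  -- If both coefficients vanish, the lift of `n` is an eigenvector, and with `v₁`, `v₂` and `1` it
  -- forms an eigenbasis.
  have hdiag' : ∀ c d : ℝ, (s - β) * c + x = 0 → (s * lam - β) * d + y = 0 → False := by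
    intro c d hc hd
    refine hdiag (isDiagonalizable_of_columns (w := Sum.elim (c • (fun _ => 1) + d • ξ) n)
      hab1 hn0 hR1 hR2 (β := β) ?_ hone)
    rw [hRw, hc, hd, zero_smul, zero_smul, zero_add, zero_add]
  have hcases : β = s ∨ β = s * lam := by
    by_contra! hcon
    have h1 : s - β ≠ 0 := sub_ne_zero.2 hcon.1.symm
    have h2 : s * lam - β ≠ 0 := sub_ne_zero.2 hcon.2.symm
    refine hdiag' (-x / (s - β)) (-y / (s * lam - β)) ?_ ?_
    · field_simp; ring
    · field_simp; ring
  refine ⟨hcases, ?_⟩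
  by_cases hβ : β = s
  · have h2 : s * lam - β ≠ 0 := by rw [hβ]; exact sub_ne_zero.2 hne
    have hd : (s * lam - β) * (-y / (s * lam - β)) + y = 0 := by field_simp; ring
    have hx : x ≠ 0 := fun hx0 => hdiag' 0 _ (by rw [hx0]; ring) hd
    -- As `β = s`, the coefficient of `v₁` is `x` whatever `c` is, so `c = 0` is as good as any; `d`
    -- removes the `v₂` part, and `x⁻¹` later normalizes the off-diagonal entry to `1`.
    set w : Color → ℝ := Sum.elim ((0 : ℝ) • (fun _ => (1 : ℝ)) + (-y / (s * lam - β)) • ξ) n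
      with hwdef
    have hw : R *ᵥ w = x • Sum.elim (fun _ => 1) 0 + β • w := by
      have e : (s - β) * 0 + x = x := by ring
      rw [hwdef, hRw, hd, e, zero_smul ℝ (Sum.elim ξ 0 : Color → ℝ), add_zero]
    have hcol := exists_jordanMatrix_of_columns (R := R) (a := ξ) (b := fun _ => 1) (w := x⁻¹ • w)
      (α := s * lam) (β := β) hab2 (by
        simpa [hwdef, hx] using hn0) hR2 (by rw [hβ]; exact hR1) (by
        rw [mulVec_smul, hw, smul_add, smul_smul, inv_mul_cancel₀ hx, one_smul, smul_comm]) hone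
    refine ⟨columnMatrix ξ (fun _ => 1) (x⁻¹ • w), hcol.1, ?_, ?_⟩
    · rw [if_pos hβ]; exact hcol.2.1
    · rw [if_pos hβ]; exact hcol.2.2
  · have hβ' : β = s * lam := hcases.resolve_left hβ
    have h1 : s - β ≠ 0 := sub_ne_zero.2 (Ne.symm hβ)
    have hc : (s - β) * (-x / (s - β)) + x = 0 := by field_simp; ring
    have hy : y ≠ 0 := fun hy0 => hdiag' _ 0 hc (by rw [hy0]; ring)
    set w : Color → ℝ := Sum.elim ((-x / (s - β)) • (fun _ => (1 : ℝ)) + (0 : ℝ) • ξ) n with hwdef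
    have hw : R *ᵥ w = y • Sum.elim ξ 0 + β • w := by
      have e : (s * lam - β) * 0 + y = y := by ring
      rw [hwdef, hRw, hc, e, zero_smul ℝ (Sum.elim (fun _ => 1) 0 : Color → ℝ), zero_add]
    have hcol := exists_jordanMatrix_of_columns (R := R) (a := fun _ => 1) (b := ξ) (w := y⁻¹ • w)
      (α := s) (β := β) hab1 (by
        simpa [hwdef, hy] using hn0) hR1 (by rw [hβ']; exact hR2) (by
        rw [mulVec_smul, hw, smul_add, smul_smul, inv_mul_cancel₀ hy, one_smul, smul_comm]) hone
    refine ⟨columnMatrix (fun _ => 1) ξ (y⁻¹ • w), hcol.1, ?_, ?_⟩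
    · rw [if_neg hβ]; exact hcol.2.1
    · rw [if_neg hβ]; exact hcol.2.2

lemma IsJordanBasis.mulVec_columns {R T : Matrix Color Color ℝ} {s lam β : ℝ} {ξ : Fin 2 → ℝ}
    (hT : IsJordanBasis R s lam β ξ T) :
    (R *ᵥ fun i => T i (Sum.inl 1)) = (β • fun i => T i (Sum.inl 1)) ∧
    R *ᵥ t₃ T = (fun i => T i (Sum.inl 1)) + β • t₃ T := by
  obtain ⟨-, hRT, -⟩ := hT
  constructor
  · ext i
    have h := congrFun (congrFun hRT i) (Sum.inl 1)
    rw [show (R * T) i (Sum.inl 1) = (R *ᵥ fun k => T k (Sum.inl 1)) i from rfl] at h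
    rw [h]
    simp [mul_apply, jordanMatrix, Fintype.sum_sum_type, Fin.sum_univ_two, mul_comm]
  · ext i
    have h := congrFun (congrFun hRT i) (Sum.inr 0)
    rw [show (R * T) i (Sum.inr 0) = (R *ᵥ t₃ T) i from rfl] at h
    rw [h]
    simp [mul_apply, jordanMatrix, Fintype.sum_sum_type, Fin.sum_univ_two, mul_comm, t₃]

lemma IsJordanBasis.column_inr_eq_zero {R T : Matrix Color Color ℝ} {s lam β : ℝ}
    {ξ : Fin 2 → ℝ} (hT : IsJordanBasis R s lam β ξ T) (j : Fin 2) :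
    T (Sum.inr j) (Sum.inl 1) = 0 := by
  refine (congrFun hT.2.2 (Sum.inr j)).trans ?_
  split_ifs <;> rfl

/-- The lower block of `R t₃ = t₂ + β t₃`, where `t₂` vanishes. It gives `π_P ν = 0`, the centering
needed for the variance limit. -/
lemma IsJordanBasis.mulVec_ν {s lam β : ℝ} {Q E P : Matrix (Fin 2) (Fin 2) ℝ} {ξ : Fin 2 → ℝ}
    {T : Matrix Color Color ℝ} (hT : IsJordanBasis (replacement s Q E P) s lam β ξ T) :
    P *ᵥ ν T = β • ν T := by
  have e : t₃ T = Sum.elim (fun j => t₃ T (Sum.inl j)) (ν T) := by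
    ext i; rcases i with i | i <;> rfl
  have h := hT.mulVec_columns.2
  ext j
  have hj := congrFun h (Sum.inr j)
  rw [e, replacement_mulVec] at hj
  simpa [hT.column_inr_eq_zero] using hj

end FourColorUrn

/-! ### Assembly of the theorem. -/

theorem proposition4p4
    {Ω : Type*} [MeasurableSpace Ω] (μ : Measure Ω) [IsProbabilityMeasure μ]
    (s : ℝ) (hs0 : 0 < s) (hs1 : s < 1)
    (Q E P : Matrix (Fin 2) (Fin 2) ℝ)
    (hQ : Q ∈ Matrix.rowStochastic ℝ (Fin 2)) (hQirr : Q.IsIrreducible)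
    (hP : P ∈ Matrix.rowStochastic ℝ (Fin 2)) (hPirr : P.IsIrreducible)
    (hR : FourColorUrn.replacement s Q E P ∈ Matrix.rowStochastic ℝ FourColorUrn.Color)
    -- the non-principal eigenvalue of `Q`, with an eigenvector
    (lam : ℝ) (hlam : lam ≠ 1) (ξ : Fin 2 → ℝ)
    (hξ : Module.End.HasEigenvector (Matrix.toLin' Q) lam ξ)
    -- the non-principal eigenvalue of `P`
    (β : ℝ) (hβ1 : β ≠ 1) (hβ : Module.End.HasEigenvalue (Matrix.toLin' P) β)
    (πP : Fin 2 → ℝ) (hπP : FourColorUrn.IsStationaryDistribution P πP)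
    (hdiag : ¬ FourColorUrn.IsDiagonalizable (FourColorUrn.replacement s Q E P))
    (c₀ : FourColorUrn.Color → ℝ)
    (X : ℕ → Ω → FourColorUrn.Color) (C : ℕ → Ω → FourColorUrn.Color → ℝ)
    (hC : FourColorUrn.IsUrnProcess μ (FourColorUrn.replacement s Q E P) c₀ X C) :
    (β = s ∨ β = s * lam) ∧
    (∃ T, FourColorUrn.IsJordanBasis (FourColorUrn.replacement s Q E P) s lam β ξ T) ∧
    ∀ T, FourColorUrn.IsJordanBasis (FourColorUrn.replacement s Q E P) s lam β ξ T →
      (β < 1 / 2 →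
        TendstoInDistribution
          (fun (n : ℕ) ω => (C n ω ⬝ᵥ FourColorUrn.t₃ T) / Real.sqrt n) atTop
          (id : ℝ → ℝ) (fun _ => μ)
          (gaussianReal 0
            (β ^ 2 / (1 - 2 * β) * (πP ⬝ᵥ fun j => FourColorUrn.ν T j ^ 2)).toNNReal)) ∧
      (1 / 2 ≤ β →
        ∃ W : Ω → ℝ,
          -- `W` is the limit `U` of `C_n v₁ / n ^ s` if `β = s`
          (β = s → FourColorUrn.TendstoASL2 μ
            (fun n ω => (C n ω ⬝ᵥ FourColorUrn.v₁) / (n : ℝ) ^ s) W) ∧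
          -- `W` is the limit `V` of `C_n v₂ / n ^ (s * lam)` if `β = s * lam`
          (β = s * lam → FourColorUrn.TendstoASL2 μ
            (fun n ω => (C n ω ⬝ᵥ FourColorUrn.v₂ ξ) / (n : ℝ) ^ (s * lam)) W) ∧
          FourColorUrn.TendstoASL2 μ
            (fun n ω => (C n ω ⬝ᵥ FourColorUrn.t₃ T) / ((n : ℝ) ^ β * Real.log n)) W) := by
  obtain ⟨n, hn⟩ := hβ.exists_hasEigenvector
  have hPn : P *ᵥ n = β • n := by simpa using hn.apply_eq_smul
  have hQξ : Q *ᵥ ξ = lam • ξ := by simpa using hξ.apply_eq_smul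
  obtain ⟨hn01, hβe⟩ := FourColorUrn.eigenvalue_fin_two hP hβ1 hPn hn.2
  obtain ⟨hξ01, hlame⟩ := FourColorUrn.eigenvalue_fin_two hQ hlam hQξ hξ.2
  obtain ⟨hcases, hT⟩ := FourColorUrn.exists_isJordanBasis hs0 hQ hR hlam hQξ hξ01 hPn hn01 hdiag
  have hlam1 : lam < 1 := lt_of_le_of_ne (by
    obtain ⟨-, -, h0, h1, -, -⟩ := FourColorUrn.stochastic_fin_two hQ
    linarith) hlam
  have hlam0 : -1 ≤ lam := by
    obtain ⟨-, -, -, -, h0, h1⟩ := FourColorUrn.stochastic_fin_two hQ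
    linarith
  have hβlt : β < 1 := by
    rcases hcases with h | h
    · linarith
    · nlinarith
  -- From `lam ≥ -1` and `s < 1`; this keeps every factor of `growth β` positive.
  have hβgt : -1 < β := by
    rcases hcases with h | h
    · linarith
    · nlinarith
  refine ⟨hcases, hT, fun T hT => ?_⟩
  obtain ⟨hRu, hRt⟩ := hT.mulVec_columns
  have hu := hT.column_inr_eq_zero
  set u : FourColorUrn.Color → ℝ := fun i => T i (Sum.inl 1) with hudef
  have hu' : ∀ j, u (Sum.inr j) = 0 := hu
  refine ⟨fun hβ2 => ?_, fun hβ2 => ?_⟩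
  · exact hC.tendstoInDistribution_generalized_eigenvector hR hQ hP hs0 hs1 hβe hβgt hβ2 hπP hu'
      hRu hRt (FourColorUrn.dotProduct_eigenvector_eq_zero hπP hβ1 hT.mulVec_ν)
  · obtain ⟨K, -, hK⟩ := hC.exists_integral_upper_div_le hR hQ hs0
      (u := fun i => (FourColorUrn.replacement s Q E P *ᵥ u) i ^ 2) fun j => by simp [hRu, hu']
    obtain ⟨W', hW'⟩ := hC.exists_tendstoASL2_eigenvector hR hβgt (s := s) (by linarith) hRu hK
    have hW := FourColorUrn.TendstoASL2.div_rpow_of_growth hβgt (hC.memLp_dotProduct hR u) hW'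
    have ht := hC.tendstoASL2_generalized_eigenvector hR hβ2 hRt hW'
    have hu2 := hT.2.2
    -- The Gamma factor comes from replacing `growth β n` by `n ^ β`; it is the same along `u` and
    -- along `t`, so the two limits agree.
    refine ⟨fun ω => (Real.Gamma (β + 1))⁻¹ * W' ω, fun h => ?_, fun h => ?_, ?_⟩
    · rw [if_pos h] at hu2
      rw [← hu2, ← h]
      exact hW
    · have hne : β ≠ s := by
        rw [h]
        intro h'
        exact hlam (mul_left_cancel₀ hs0.ne' (h'.trans (mul_one s).symm))
      rw [if_neg hne] at hu2
      rw [← hu2, ← h]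
      exact hW
    · refine (FourColorUrn.TendstoASL2.div_rpow_of_growth hβgt
        (Y := fun (n : ℕ) ω => (C n ω ⬝ᵥ FourColorUrn.t₃ T) / Real.log n) (fun n => ?_)
        (ht.congr' (Eventually.of_forall fun n ω => mul_div_assoc _ _ _))).congr'
        (Eventually.of_forall fun n ω => ?_)
      · simp only [div_eq_mul_inv]
        exact (hC.memLp_dotProduct hR _ n).mul_const _
      · rw [div_div, mul_comm (Real.log _)]
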